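/- Spaces are simplicial sets. $\Delta$ is the category of the finite ordered sets $[p]=\{0,\dots,p\}$, $p\ge 0$, and $\Delta_{\le j}$ is its full subcategory on the $[p]$ with $p\le j$. For $n\ge 0$ an $n$-cosimplicial space is a functor from $\Delta^n=\Delta\times\cdots\times\Delta$ to simplicial sets. A map $X\to Y$ of simplicial sets is a weak equivalence if $[Y,K]\to[X,K]$ is a bijection on simplicial homotopy classes for every Kan complex $K$, and $\sim$ means: joined by a finite zigzag of weak equivalences. For a diagram $F$ of simplicial sets indexed by a small category $C$, $\operatorname{holim}_C F$ is the Bousfield–Kan homotopy limit, that is, the simplicial set of maps of $C$-diagrams from $c\mapsto N(C/c)$ to $F$. $\operatorname{holim}^i_{\Delta_{\le j}}$ is this homotopy limit, over $\Delta_{\le j}$, in the $i$-th direction of a multicosimplicial space only. $\operatorname{cosk}^i_{j}$ restricts an $n$-cosimplicial space to $\Delta_{\le j}$ in the $i$-th direction and then takes the right Kan extension back to $\Delta^n$, and $\operatorname{cosk}_{j_1,\dots,j_n}=\operatorname{cosk}^1_{j_1}\cdots\operatorname{cosk}^n_{j_n}$. $\operatorname{diag}$ is the diagonal cosimplicial space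 $p\mapsto Z^{p,\dots,p}$. An $n$-cosimplicial space $Z$ is Reedy fibrant if for every $m\in\Delta^n$ the matching map $Z^m\to\lim Z^{m'}$ is a Kan fibration, where the limit is over all arrows $m\to m'$ that are surjective in every coordinate and not isomorphisms. Proposition. Let $Y$ be any $n$-cosimplicial space and let $j_1,\dots,j_n\ge 0$, $J=\sum_i j_i$. Then $$\operatorname{holim}^1_{\Delta_{\le j_1}}\operatorname{holim}^2_{\Delta_{\le j_2}}\cdots\operatorname{holim}^n_{\Delta_{\le j_n}} Y\;\sim\;\operatorname{holim}_{\Delta_{\le J}}\operatorname{diag}\,\operatorname{cosk}_{j_1,\dots,j_n}Y,$$ where, as usual, both sides are formed after a fibrant replacement of $Y$. Precisely: let $Y\to Y'$ and $Y\to Y''$ be objectwise weak equivalences such that $Y'$ is objectwise a Kan complex and $Y''$ is Reedy fibrant. Then $$\operatorname{holim}^1_{\Delta_{\le j_1}}\operatorname{holim}^2_{\Delta_{\le j_2}}\cdots\operatorname{holim}^n_{\Delta_{\le j_n}} Y'\;\sim\;\operatorname{holim}_{\Delta_{\le J}}\operatorname{diag}\,\operatorname{cosk}_{j_1,\dots,j_n}Y''.$$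 In particular, if $Y$ itself is Reedy fibrant, one may take $Y'=Y''=Y$. -/

import Mathlib

open CategoryTheory MonoidalCategory Limits Simplicial

universe u

noncomputable section

namespace MultiCosimplicial

/-! ### Weak equivalences of simplicial sets

The word space means simplicial set, and a fibrant space is a Kan complex. -/

/-- Two maps of simplicial sets are homotopic if there is a simplicial homotopy
`X ⊗ Δ[1] ⟶ K` from one to the other (an equivalence relation when `K` is a Kan complex). -/
def Homotopic {X K : SSet.{u}} (f g : X ⟶ K) : Prop :=
  Nonempty (SSet.Homotopy f g)

/-- A map `f : X ⟶ Y` of simplicial sets is a weak equivalence if for every Kan complex `K`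
precomposition with `f` is a bijection `[Y, K] → [X, K]` on simplicial homotopy classes. The two
conjuncts are surjectivity and injectivity of this map. -/
def IsWeakEquiv {X Y : SSet.{u}} (f : X ⟶ Y) : Prop :=
  ∀ K : SSet.{u}, SSet.KanComplex K →
    (∀ g : X ⟶ K, ∃ h : Y ⟶ K, Homotopic (f ≫ h) g) ∧
    (∀ h h' : Y ⟶ K, Homotopic (f ≫ h) (f ≫ h') → Homotopic h h')

/-- Two simplicial sets are weakly equivalent if they are joined by a finite zigzag of weak
equivalences. -/
def WeaklyEquivalent (X Y : SSet.{u}) : Prop :=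
  Relation.EqvGen (fun A B : SSet.{u} => ∃ f : A ⟶ B, IsWeakEquiv f) X Y

/-! ### Homotopy limits -/

/-- The functor `c ↦ N(C / c)`, the nerve of the over-category. -/
def overNerve (C : Type) [SmallCategory C] : C ⥤ SSet.{u} :=
  Over.mapFunctor C ⋙ nerveFunctor ⋙ SSet.uliftFunctor.{u, 0}

/-- The Bousfield-Kan homotopy limit: the simplicial mapping space from `N(C / -)` to `F` in the
category of `C`-diagrams of simplicial sets. Its `k`-simplices are the natural transformations
`N(C / -) ⊗ Δ[k] ⟶ F`. -/
def holim (C : Type) [SmallCategory C] : (C ⥤ SSet.{u}) ⥤ SSet.{u} :=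
  yoneda ⋙ (Functor.whiskeringLeft _ _ _).obj
    (SSet.stdSimplex.{u} ⋙ Functor.const C ⋙ tensorLeft (overNerve.{u} C)).op

/-- The restriction of a cosimplicial space to `Δ_{≤ j}` followed by the homotopy limit over
`Δ_{≤ j}`. -/
def holimTrunc (j : ℕ) : (SimplexCategory ⥤ SSet.{u}) ⥤ SSet.{u} :=
  (Functor.whiskeringLeft _ _ _).obj (SimplexCategory.Truncated.inclusion j) ⋙
    holim (SimplexCategory.Truncated j)

/-! ### Multicosimplicial spaces -/

/-- An `n`-cosimplicial space: a functor from the `n`-fold product `Δ × ⋯ × Δ` to simplicial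
sets. -/
abbrev CosimplicialSpace (n : ℕ) := (Fin n → SimplexCategory) ⥤ SSet.{u}

/-- The functor `(p, (m₁, …, mₙ)) ↦ (p, m₁, …, mₙ)`, in curried form. -/
def consFunctor (n : ℕ) :
    SimplexCategory ⥤ (Fin n → SimplexCategory) ⥤ (Fin (n + 1) → SimplexCategory) where
  obj p :=
    { obj := fun m => Fin.cons p m
      map := fun {m m'} f => fun i =>
        Fin.cases (motive := fun i => (Fin.cons p m : Fin (n + 1) → SimplexCategory) i ⟶
          (Fin.cons p m' : Fin (n + 1) → SimplexCategory) i) (𝟙 p) f i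
      map_id := fun m => by
        funext i
        refine Fin.cases ?_ (fun k => ?_) i <;> rfl
      map_comp := fun f g => by
        funext i
        refine Fin.cases ?_ (fun k => ?_) i
        · exact (Category.id_comp (𝟙 p)).symm
        · rfl }
  map {p p'} g :=
    { app := fun m => fun i =>
        Fin.cases (motive := fun i => (Fin.cons p m : Fin (n + 1) → SimplexCategory) i ⟶
          (Fin.cons p' m : Fin (n + 1) → SimplexCategory) i) g (fun k => 𝟙 (m k)) i
      naturality := fun m m' f => by
        funext i
        refine Fin.cases ?_ (fun k => ?_) i
        · exact (Category.id_comp g).trans (Category.comp_id g).symm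
        · exact (Category.comp_id (f k)).trans (Category.id_comp (f k)).symm }
  map_id p := by
    refine NatTrans.ext (funext fun m => funext fun i => ?_)
    refine Fin.cases ?_ (fun k => ?_) i <;> rfl
  map_comp g h := by
    refine NatTrans.ext (funext fun m => funext fun i => ?_)
    refine Fin.cases ?_ (fun k => ?_) i
    · rfl
    · exact (Category.id_comp (𝟙 (m k))).symm

/-- An `(n + 1)`-cosimplicial space, seen as a cosimplicial object (in the first direction) in
`n`-cosimplicial spaces (in the remaining directions): `Y ↦ (p ↦ Y (p, -))`. -/
def slice (n : ℕ) :
    CosimplicialSpace.{u} (n + 1) ⥤ (SimplexCategory ⥤ CosimplicialSpace.{u} n) :=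
  Functor.whiskeringRight (Fin n → SimplexCategory) _ SSet.{u} ⋙
    (Functor.whiskeringLeft SimplexCategory _ _).obj (consFunctor n)

/-- The iterated partial homotopy limit `holim¹_{Δ ≤ j₁} holim²_{Δ ≤ j₂} ⋯ holimⁿ_{Δ ≤ jₙ} Y`.
The `n`-th direction is the innermost one: for `n + 1` directions this is the homotopy limit over
`p` in `Δ_{≤ j₁}` of the iterated homotopy limits, in the other directions, of `Y (p, -)`.
For `n = 0` it is the space `Y` itself. -/
def iteratedHolim (n : ℕ) (j : Fin n → ℕ) : CosimplicialSpace.{u} n ⥤ SSet.{u} :=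
  match n, j with
  | 0, _ => (evaluation (Fin 0 → SimplexCategory) SSet.{u}).obj (fun i => i.elim0)
  | n + 1, j =>
      slice n ⋙
        (Functor.whiskeringRight SimplexCategory _ _).obj
          (iteratedHolim n (fun i => j i.succ)) ⋙
        holimTrunc (j 0)

/-- The diagonal cosimplicial space `p ↦ Y (p, …, p)`. -/
def diag {n : ℕ} (Y : CosimplicialSpace.{u} n) : SimplexCategory ⥤ SSet.{u} :=
  Functor.pi' (fun _ : Fin n => 𝟭 SimplexCategory) ⋙ Y

/-! ### Coskeleta -/

/-- The multi-indices `m` with `m i ≤ j`: the full subcategory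
`Δ × ⋯ × Δ_{≤ j} × ⋯ × Δ` with the truncation in the `i`-th factor. -/
def truncIn {n : ℕ} (i : Fin n) (j : ℕ) : ObjectProperty (Fin n → SimplexCategory) :=
  fun m => (m i).len ≤ j

/-- The `j`-coskeleton in the `i`-th direction: restrict along the inclusion
`Δ × ⋯ × Δ_{≤ j} × ⋯ × Δ ⥤ Δ × ⋯ × Δ` and take the right Kan extension along it. -/
def coskIn {n : ℕ} (i : Fin n) (j : ℕ) (Y : CosimplicialSpace.{u} n) :
    CosimplicialSpace.{u} n :=
  (truncIn i j).ι.ran.obj ((truncIn i j).ι ⋙ Y)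

/-- The multi-coskeleton `cosk_{j₁, …, jₙ} Y = cosk¹_{j₁} (cosk²_{j₂} (⋯ (coskⁿ_{jₙ} Y)))`. -/
def cosk {n : ℕ} (j : Fin n → ℕ) (Y : CosimplicialSpace.{u} n) : CosimplicialSpace.{u} n :=
  (List.finRange n).foldr (fun i Z => coskIn i (j i) Z) Y

/-! ### Fibrancy -/

/-- A map of `n`-cosimplicial spaces that is a weak equivalence at every multi-index. -/
def IsLevelwiseWeakEquiv {n : ℕ} {Y Z : CosimplicialSpace.{u} n} (f : Y ⟶ Z) : Prop :=
  ∀ m, IsWeakEquiv (f.app m)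

/-- An objectwise fibrant `n`-cosimplicial space. -/
def IsLevelwiseFibrant {n : ℕ} (Y : CosimplicialSpace.{u} n) : Prop :=
  ∀ m, SSet.KanComplex (Y.obj m)

/-- The index category of the matching object at `m`: the arrows `m ⟶ m'` in `Δ × ⋯ × Δ`
which are surjective in every coordinate and are not isomorphisms. -/
def properDegeneracy {n : ℕ} (m : Fin n → SimplexCategory) : ObjectProperty (Under m) :=
  fun a => (∀ i, Epi ((a.hom : m ⟶ a.right) i)) ∧ ¬ IsIso a.hom

/-- The diagram whose limit is the matching object of `Y` at `m`. -/
def matchingDiagram {n : ℕ} (Y : CosimplicialSpace.{u} n) (m : Fin n → SimplexCategory) :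
    (properDegeneracy m).FullSubcategory ⥤ SSet.{u} :=
  (properDegeneracy m).ι ⋙ Under.forget m ⋙ Y

/-- The matching map `Y m ⟶ M_m Y`, induced by the codegeneracies. -/
def matchingMap {n : ℕ} (Y : CosimplicialSpace.{u} n) (m : Fin n → SimplexCategory) :
    Y.obj m ⟶ limit (matchingDiagram Y m) :=
  limit.lift (matchingDiagram Y m)
    { pt := Y.obj m
      π :=
        { app := fun a => Y.map a.obj.hom
          naturality := fun a b f => by
            have h : a.obj.hom ≫ f.hom.right = b.obj.hom := Under.w f.hom
            change 𝟙 _ ≫ Y.map b.obj.hom = Y.map a.obj.hom ≫ Y.map f.hom.right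
            rw [Category.id_comp, ← Y.map_comp, h] } }

/-- An `n`-cosimplicial space is Reedy fibrant if all its matching maps are Kan fibrations, that
is, have the right lifting property with respect to the horn inclusions. -/
def IsReedyFibrant {n : ℕ} (Y : CosimplicialSpace.{u} n) : Prop :=
  ∀ m, SSet.modelCategoryQuillen.J.rlp (matchingMap Y m)

end MultiCosimplicial

end

noncomputable section

namespace MultiCosimplicial

open SSet CartesianMonoidalCategory Opposite
open scoped SSet.modelCategoryQuillen

section


/-! ### Lifting against pushout-products -/

/-! Write `D` for the product of the truncated categories `Δ_{≤ jᵢ}`, and `V`, `W` for two diagrams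
of spaces on `D`. By Fubini (`iteratedHolimIso`) the iterated homotopy limit of `Y'` is the mapping
space from `V` to `Y'|D`, where `V` is the external product of the nerves of the over-categories.
The multi-coskeleton is the right Kan extension of its restriction to `D`
(`nonempty_coskeletonIso`), so by adjunction (`mapSpCommaIso`) the homotopy limit of its diagonal is
the mapping space to `Y''|D` from the diagram `W` that sends `d` to the nerve of the category of
simplices, of dimension at most `J`, of `Δ[d₁] × ⋯ × Δ[dₙ]`.

Both `V` and `W` are objectwise contractible. For `W` this is where `J = ∑ jᵢ` enters: a chain in
`[d₁] × ⋯ × [dₙ]` has at most `∑ dᵢ + 1 ≤ J + 1` elements, so the nondegenerate simplex spanned by a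
chain and the least vertex is always available, and passing to it contracts the category
(`isWeakEquiv_nerve_truncDiag`).

Contractible diagrams need not have the same mapping space into an arbitrary diagram. The small
object argument therefore builds one diagram `M` on `D`, weakly equivalent to `Y'|D` and to `Y''|D`,
which is Reedy fibrant and for which the inclusions of `V`, `W` and the point into the cones on `V`
and `W` induce trivial fibrations of mapping spaces (`exists_common_replacement`). Hence the mapping
spaces from `V` and `W` to `M` are weakly equivalent.

It remains to replace `Y'` and `Y''` by `M`. A weak equivalence of objectwise fibrant diagrams is
replaced by a span of objectwise trivial fibrations through its mapping path object, and homotopy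
limits preserve these (`isTrivialFibration_holim_map`); this handles `Y'`. For `Y''` the Kan
extension has to be crossed as well. Between Reedy fibrant diagrams the two legs of the span are
Reedy trivial fibrations (`isTrivialFibration_relMatch`), and these are preserved by the extension
because the functors `d ↦ (e ⟶ ι d)` are freely generated by surjections
(`isTrivialFibration_familiesMap`).

The homotopy theory of simplicial sets comes from two facts: a Kan fibration between Kan complexes
that is a weak equivalence is a trivial fibration, and a monomorphism that is a weak equivalence
lifts against Kan fibrations between Kan complexes. The class `acyclic` of maps with this last
property is stable under pushout and consists of weak equivalences, which is all the small object
argument requires. -/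

abbrev IsKanFibration {E B : SSet.{u}} (p : E ⟶ B) : Prop := modelCategoryQuillen.J.rlp p

abbrev IsTrivialFibration {E B : SSet.{u}} (p : E ⟶ B) : Prop := modelCategoryQuillen.I.rlp p

lemma IsTrivialFibration.hasLift {E B A L : SSet.{u}} {p : E ⟶ B} (hp : IsTrivialFibration p)
    (j : A ⟶ L) [Mono j] : HasLiftingProperty j p := by
  have : (MorphismProperty.monomorphisms SSet.{u}).rlp p := by rwa [rlp_monomorphisms]
  exact this _ (MorphismProperty.monomorphisms.infer_property j)

lemma isTrivialFibration_of_hasLift {E B : SSet.{u}} {p : E ⟶ B}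
    (h : ∀ {A L : SSet.{u}} (j : A ⟶ L) [Mono j], HasLiftingProperty j p) :
    IsTrivialFibration p := by
  have : (MorphismProperty.monomorphisms SSet.{u}).rlp p := fun _ _ j hj => by
    have : Mono j := hj
    exact h j
  rwa [rlp_monomorphisms] at this

lemma IsTrivialFibration.isKanFibration {E B : SSet.{u}} {p : E ⟶ B}
    (hp : IsTrivialFibration p) : IsKanFibration p := fun _ _ j hj => by
  have : Mono j := modelCategoryQuillen.J_le_monomorphisms _ hj
  exact hp.hasLift j

lemma IsKanFibration.hasLift {E B A L : SSet.{u}} {p : E ⟶ B} (hp : IsKanFibration p)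
    {j : A ⟶ L} (hj : anodyneExtensions j) : HasLiftingProperty j p :=
  hj _ hp

lemma exists_lift {C : Type*} [Category* C] {A L E B : C} {j : A ⟶ L} {p : E ⟶ B}
    (h : HasLiftingProperty j p) (u : A ⟶ E) (v : L ⟶ B) (w : u ≫ p = j ≫ v) :
    ∃ φ : L ⟶ E, j ≫ φ = u ∧ φ ≫ p = v := by
  have sq : CommSq u j p v := ⟨w⟩
  have := h.sq_hasLift sq
  exact ⟨sq.lift, sq.fac_left, sq.fac_right⟩

/-- The pushout-product of two maps of simplicial sets. -/
abbrev leibniz {A L K K' : SSet.{u}} (j : A ⟶ L) (i : K ⟶ K') :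
    (curriedTensor SSet.{u}).PushoutObjObj j i :=
  Functor.PushoutObjObj.ofHasPushout _ _ _

lemma exists_lift_leibniz {A L K K' E B : SSet.{u}} {j : A ⟶ L} {i : K ⟶ K'} {p : E ⟶ B}
    (h : HasLiftingProperty (leibniz j i).ι p)
    (u : A ⊗ K' ⟶ E) (v : L ⊗ K ⟶ E) (w : L ⊗ K' ⟶ B)
    (huv : A ◁ i ≫ u = j ▷ K ≫ v) (hu : u ≫ p = j ▷ K' ≫ w) (hv : v ≫ p = L ◁ i ≫ w) :
    ∃ φ : L ⊗ K' ⟶ E, j ▷ K' ≫ φ = u ∧ L ◁ i ≫ φ = v ∧ φ ≫ p = w := by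
  let sq := leibniz j i
  obtain ⟨φ, h1, h2⟩ := exists_lift h (sq.isPushout.desc v u huv.symm) w (by
    apply sq.hom_ext
    · rw [sq.isPushout.inl_desc_assoc, sq.inl_ι_assoc]; exact hv
    · rw [sq.isPushout.inr_desc_assoc, sq.inr_ι_assoc]; exact hu)
  refine ⟨φ, ?_, ?_, h2⟩
  · have := sq.inr ≫= h1
    rw [sq.isPushout.inr_desc, sq.inr_ι_assoc] at this
    exact this
  · have := sq.inl ≫= h1
    rw [sq.isPushout.inl_desc, sq.inl_ι_assoc] at this
    exact this

/-- The horn of `Δ[1]` with index `1 - k` has `δ k` as its only face, so filling it is lifting along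
this vertex. -/
lemma anodyne_vertex (k : Fin 2) : anodyneExtensions (stdSimplex.{u}.δ (n := 0) k) := by
  intro E B p hp
  have : HomotopicalAlgebra.Fibration p := by
    rwa [HomotopicalAlgebra.fibration_iff]
  refine ⟨fun {a b} sq => ?_⟩
  have hc : horn.IsCompatible (X := E) (i := 1 - k) (fun (l : Fin 2) (_ : l ≠ 1 - k) => a) := by simp
  have key : ∀ k l : Fin 2, l ≠ 1 - k → l = k := by decide
  have key' : ∀ k : Fin 2, k ≠ 1 - k := by decide
  obtain ⟨φ, h1, h2⟩ := hc.exists_lift p b (fun l hl => by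
    obtain rfl := key k l hl
    exact sq.w)
  exact ⟨⟨⟨φ, h1 k (key' k), h2⟩⟩⟩

lemma ι₀_eq (L : SSet.{u}) :
    (ι₀ : L ⟶ L ⊗ Δ[1]) = lift (𝟙 L) (stdSimplex.isTerminalObj₀.from L) ≫
      L ◁ stdSimplex.δ (n := 0) 1 := by
  rw [stdSimplex.δ_one_eq_const]; rfl

lemma ι₁_eq (L : SSet.{u}) :
    (ι₁ : L ⟶ L ⊗ Δ[1]) = lift (𝟙 L) (stdSimplex.isTerminalObj₀.from L) ≫
      L ◁ stdSimplex.δ (n := 0) 0 := by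
  rw [stdSimplex.δ_zero_eq_const]; rfl

lemma fst_ι₀ (L : SSet.{u}) :
    fst L Δ[0] ≫ (ι₀ : L ⟶ L ⊗ Δ[1]) = L ◁ stdSimplex.δ (n := 0) 1 := by
  rw [stdSimplex.δ_one_eq_const]; rfl

lemma fst_ι₁ (L : SSet.{u}) :
    fst L Δ[0] ≫ (ι₁ : L ⟶ L ⊗ Δ[1]) = L ◁ stdSimplex.δ (n := 0) 0 := by
  rw [stdSimplex.δ_zero_eq_const]; rfl

/-- Relative homotopy lifting, with the initial end of the homotopy prescribed. -/
lemma exists_homotopy_lift₀ {A L E B : SSet.{u}} (j : A ⟶ L) {p : E ⟶ B}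
    (h : HasLiftingProperty (leibniz j (stdSimplex.{u}.δ (n := 0) 1)).ι p)
    (u : A ⊗ Δ[1] ⟶ E) (v : L ⟶ E) (w : L ⊗ Δ[1] ⟶ B)
    (huv : ι₀ ≫ u = j ≫ v) (hu : u ≫ p = j ▷ Δ[1] ≫ w) (hv : v ≫ p = ι₀ ≫ w) :
    ∃ φ : L ⊗ Δ[1] ⟶ E, j ▷ Δ[1] ≫ φ = u ∧ ι₀ ≫ φ = v ∧ φ ≫ p = w := by
  obtain ⟨φ, h1, h2, h3⟩ := exists_lift_leibniz h u (fst _ _ ≫ v) w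
    (by rw [← fst_ι₀, Category.assoc, huv]; rfl) hu (by
      rw [Category.assoc, hv, ← fst_ι₀, Category.assoc])
  refine ⟨φ, h1, ?_, h3⟩
  rw [ι₀_eq, Category.assoc, h2, lift_fst_assoc, Category.id_comp]

/-- Relative homotopy lifting, with the terminal end of the homotopy prescribed. -/
lemma exists_homotopy_lift₁ {A L E B : SSet.{u}} (j : A ⟶ L) {p : E ⟶ B}
    (h : HasLiftingProperty (leibniz j (stdSimplex.{u}.δ (n := 0) 0)).ι p)
    (u : A ⊗ Δ[1] ⟶ E) (v : L ⟶ E) (w : L ⊗ Δ[1] ⟶ B)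
    (huv : ι₁ ≫ u = j ≫ v) (hu : u ≫ p = j ▷ Δ[1] ≫ w) (hv : v ≫ p = ι₁ ≫ w) :
    ∃ φ : L ⊗ Δ[1] ⟶ E, j ▷ Δ[1] ≫ φ = u ∧ ι₁ ≫ φ = v ∧ φ ≫ p = w := by
  obtain ⟨φ, h1, h2, h3⟩ := exists_lift_leibniz h u (fst _ _ ≫ v) w
    (by rw [← fst_ι₁, Category.assoc, huv]; rfl) hu (by
      rw [Category.assoc, hv, ← fst_ι₁, Category.assoc])
  refine ⟨φ, h1, ?_, h3⟩
  rw [ι₁_eq, Category.assoc, h2, lift_fst_assoc, Category.id_comp]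

lemma IsKanFibration.hasLift_leibniz {E B : SSet.{u}} {p : E ⟶ B} (hp : IsKanFibration p)
    {A L : SSet.{u}} (j : A ⟶ L) [Mono j] (k : Fin 2) :
    HasLiftingProperty (leibniz j (stdSimplex.{u}.δ (n := 0) k)).ι p :=
  hp.hasLift (anodyneExtensions_pushoutObjObjι _ (anodyne_vertex k))

/-- The two end points of the interval, as a constant simplicial set. -/
def endpoints : SSet.{u} := (Functor.const _).obj (ULift Bool)

def endpointsι : endpoints.{u} ⟶ Δ[1] where
  app k := ↾fun b => (SSet.const (X := Δ[0])
    (stdSimplex.obj₀Equiv.{u}.symm (bif b.down then 1 else 0))).app k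
      (stdSimplex.objEquiv.symm (SimplexCategory.const _ _ 0))

@[simp]
lemma endpointsι_app_apply {k : ℕ} (b : ULift Bool) (i : Fin (k + 1)) :
    (endpointsι.{u}.app (op ⦋k⦌) b : Δ[1] _⦋k⦌) i = bif b.down then 1 else 0 := rfl

instance : Mono endpointsι.{u} := by
  rw [NatTrans.mono_iff_mono_app]
  rintro ⟨k⟩
  induction k using SimplexCategory.rec with | _ k
  rw [mono_iff_injective]
  rintro ⟨a⟩ ⟨b⟩ h
  have h' := DFunLike.congr_fun (F := Δ[1] _⦋k⦌) h 0
  erw [endpointsι_app_apply, endpointsι_app_apply] at h'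
  congr 1
  cases a <;> cases b <;> simp_all

/-- The map out of `X ⊗ endpoints` with given restrictions to the two ends. -/
def endpointsDesc {X Y : SSet.{u}} (f₀ f₁ : X ⟶ Y) : X ⊗ endpoints ⟶ Y where
  app k := ↾fun x => bif x.2.down then f₁.app k x.1 else f₀.app k x.1
  naturality k l φ := by
    ext ⟨x, ⟨b⟩⟩
    cases b
    · exact NatTrans.naturality_apply f₀ φ x
    · exact NatTrans.naturality_apply f₁ φ x

def endpointsIncl (X : SSet.{u}) (b : Bool) : X ⟶ X ⊗ endpoints where
  app k := ↾fun x => (x, ⟨b⟩)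

lemma endpointsIncl_whiskerLeft_false (X : SSet.{u}) :
    endpointsIncl X false ≫ X ◁ endpointsι = ι₀ := rfl

lemma endpointsIncl_whiskerLeft_true (X : SSet.{u}) :
    endpointsIncl X true ≫ X ◁ endpointsι = ι₁ := rfl

lemma endpoints_hom_ext {X Y : SSet.{u}} {f g : X ⊗ endpoints ⟶ Y}
    (h₀ : endpointsIncl X false ≫ f = endpointsIncl X false ≫ g)
    (h₁ : endpointsIncl X true ≫ f = endpointsIncl X true ≫ g) : f = g := by
  ext k ⟨x, ⟨b⟩⟩
  cases b
  · exact ConcreteCategory.congr_hom (NatTrans.congr_app h₀ k) x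
  · exact ConcreteCategory.congr_hom (NatTrans.congr_app h₁ k) x

lemma whiskerLeft_endpointsι_comp {X Y : SSet.{u}} (h : X ⊗ Δ[1] ⟶ Y) :
    X ◁ endpointsι ≫ h = endpointsDesc (ι₀ ≫ h) (ι₁ ≫ h) := by
  apply endpoints_hom_ext <;> rfl

lemma whiskerRight_endpointsDesc {X X' Y : SSet.{u}} (j : X ⟶ X') (f₀ f₁ : X' ⟶ Y) :
    j ▷ endpoints ≫ endpointsDesc f₀ f₁ = endpointsDesc (j ≫ f₀) (j ≫ f₁) := by
  apply endpoints_hom_ext <;> rfl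

lemma endpointsDesc_comp {X Y Z : SSet.{u}} (f₀ f₁ : X ⟶ Y) (g : Y ⟶ Z) :
    endpointsDesc f₀ f₁ ≫ g = endpointsDesc (f₀ ≫ g) (f₁ ≫ g) := by
  apply endpoints_hom_ext <;> rfl

/-- Relative homotopies with both ends prescribed. -/
lemma exists_homotopy_lift {A L E B : SSet.{u}} (j : A ⟶ L) {p : E ⟶ B}
    (h : HasLiftingProperty (leibniz j endpointsι).ι p)
    (u : A ⊗ Δ[1] ⟶ E) (v₀ v₁ : L ⟶ E) (w : L ⊗ Δ[1] ⟶ B)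
    (hu₀ : ι₀ ≫ u = j ≫ v₀) (hu₁ : ι₁ ≫ u = j ≫ v₁) (hu : u ≫ p = j ▷ Δ[1] ≫ w)
    (hv₀ : v₀ ≫ p = ι₀ ≫ w) (hv₁ : v₁ ≫ p = ι₁ ≫ w) :
    ∃ φ : L ⊗ Δ[1] ⟶ E, j ▷ Δ[1] ≫ φ = u ∧ ι₀ ≫ φ = v₀ ∧ ι₁ ≫ φ = v₁ ∧ φ ≫ p = w := by
  obtain ⟨φ, h1, h2, h3⟩ := exists_lift_leibniz h u (endpointsDesc v₀ v₁) w
    (by rw [whiskerLeft_endpointsι_comp, hu₀, hu₁, whiskerRight_endpointsDesc]) hu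
    (by rw [whiskerLeft_endpointsι_comp, endpointsDesc_comp, hv₀, hv₁])
  rw [whiskerLeft_endpointsι_comp] at h2
  exact ⟨φ, h1, endpointsIncl _ false ≫= h2, endpointsIncl _ true ≫= h2, h3⟩

end

section


/-! ### Homotopy relation -/

lemma homotopic_iff {X K : SSet.{u}} (f g : X ⟶ K) :
    Homotopic f g ↔ ∃ h : X ⊗ Δ[1] ⟶ K, ι₀ ≫ h = f ∧ ι₁ ≫ h = g := by
  constructor
  · rintro ⟨H⟩
    exact ⟨H.h, H.h₀, H.h₁⟩
  · rintro ⟨h, h₀, h₁⟩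
    -- The remaining field is the condition relative to a subcomplex, which is empty here.
    refine ⟨⟨h, h₀, h₁, ?_⟩⟩
    ext k ⟨⟨x, hx⟩, t⟩
    exact hx.elim

lemma kanComplex_iff (K : SSet.{u}) : KanComplex K ↔ IsKanFibration (terminal.from K) := by
  exact (HomotopicalAlgebra.isFibrant_iff K).trans (modelCategoryQuillen.fibration_iff _)

lemma KanComplex.of_fibration {E B : SSet.{u}} {p : E ⟶ B} (hp : IsKanFibration p)
    (hB : KanComplex B) : KanComplex E := by
  rw [kanComplex_iff] at hB ⊢
  have : terminal.from E = p ≫ terminal.from B := Subsingleton.elim _ _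
  rw [this]
  exact (modelCategoryQuillen.J.{u}.rlp).comp_mem _ _ hp hB

namespace Homotopic

lemma refl {X K : SSet.{u}} (f : X ⟶ K) : Homotopic f f :=
  (homotopic_iff _ _).2 ⟨fst _ _ ≫ f, rfl, rfl⟩

lemma precomp {X Y K : SSet.{u}} {f g : X ⟶ K} (h : Homotopic f g) (k : Y ⟶ X) :
    Homotopic (k ≫ f) (k ≫ g) := by
  rw [homotopic_iff] at h ⊢
  obtain ⟨H, h₀, h₁⟩ := h
  exact ⟨k ▷ _ ≫ H, by rw [ι₀_comp_assoc, h₀], by rw [ι₁_comp_assoc, h₁]⟩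

lemma postcomp {X K L : SSet.{u}} {f g : X ⟶ K} (h : Homotopic f g) (k : K ⟶ L) :
    Homotopic (f ≫ k) (g ≫ k) := by
  rw [homotopic_iff] at h ⊢
  obtain ⟨H, h₀, h₁⟩ := h
  exact ⟨H ≫ k, by rw [← h₀, Category.assoc], by rw [← h₁, Category.assoc]⟩

end Homotopic

/-- The map out of `(X ⊗ endpoints) ⊗ Z` with given restrictions to the two ends. -/
def endpointsDesc' {X Y Z : SSet.{u}} (f₀ f₁ : X ⊗ Z ⟶ Y) : (X ⊗ endpoints) ⊗ Z ⟶ Y where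
  app k := ↾fun x => bif x.1.2.down then f₁.app k ((x.1.1, x.2) : X.obj k × Z.obj k)
    else f₀.app k ((x.1.1, x.2) : X.obj k × Z.obj k)
  naturality k l φ := by
    ext ⟨⟨x, ⟨b⟩⟩, z⟩
    cases b
    · exact NatTrans.naturality_apply f₀ φ ((x, z) : X.obj k × Z.obj k)
    · exact NatTrans.naturality_apply f₁ φ ((x, z) : X.obj k × Z.obj k)

@[simp]
lemma endpointsIncl_desc'_false {X Y Z : SSet.{u}} (f₀ f₁ : X ⊗ Z ⟶ Y) :
    endpointsIncl X false ▷ Z ≫ endpointsDesc' f₀ f₁ = f₀ := rfl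

@[simp]
lemma endpointsIncl_desc'_true {X Y Z : SSet.{u}} (f₀ f₁ : X ⊗ Z ⟶ Y) :
    endpointsIncl X true ▷ Z ≫ endpointsDesc' f₀ f₁ = f₁ := rfl

lemma endpoints_hom_ext' {X Y Z : SSet.{u}} {f g : (X ⊗ endpoints) ⊗ Z ⟶ Y}
    (h₀ : endpointsIncl X false ▷ Z ≫ f = endpointsIncl X false ▷ Z ≫ g)
    (h₁ : endpointsIncl X true ▷ Z ≫ f = endpointsIncl X true ▷ Z ≫ g) : f = g := by
  ext k ⟨⟨x, ⟨b⟩⟩, z⟩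
  cases b
  · exact ConcreteCategory.congr_hom (NatTrans.congr_app h₀ k) ((x, z) : X.obj k × Z.obj k)
  · exact ConcreteCategory.congr_hom (NatTrans.congr_app h₁ k) ((x, z) : X.obj k × Z.obj k)

instance mono_whiskerLeft {X Y Z : SSet.{u}} (f : Y ⟶ Z) [Mono f] : Mono (X ◁ f) := by
  have h := fun k => (mono_iff_injective (f.app k)).1 inferInstance
  rw [NatTrans.mono_iff_mono_app]
  intro k
  rw [mono_iff_injective]
  rintro ⟨a, b⟩ ⟨a', b'⟩ e
  have e' := Prod.ext_iff.1 e
  exact Prod.ext e'.1 (h k e'.2)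

namespace Homotopic

/-- The two homotopies start at `f`, so together they form a homotopy on `X ⊗ endpoints`. It extends
to `X ⊗ Δ[1]` with initial end constant at `f`, and the terminal end of the extension joins `g` to
`h`. Symmetry and transitivity follow formally from this and reflexivity. -/
lemma euclidean {X K : SSet.{u}} (hK : KanComplex K) {f g h : X ⟶ K} (h₁ : Homotopic f g)
    (h₂ : Homotopic f h) : Homotopic g h := by
  rw [homotopic_iff] at h₁ h₂ ⊢
  obtain ⟨H, h0, h1⟩ := h₁
  obtain ⟨H', h0', h1'⟩ := h₂
  obtain ⟨φ, hφ, -, -⟩ := exists_homotopy_lift₀ (X ◁ endpointsι)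
    (((kanComplex_iff K).1 hK).hasLift_leibniz _ 1) (endpointsDesc' H H') (fst _ _ ≫ f)
    (terminal.from _) (by
      apply endpoints_hom_ext
      · rw [← ι₀_comp_assoc, endpointsIncl_desc'_false, h0]; rfl
      · rw [← ι₀_comp_assoc, endpointsIncl_desc'_true, h0']; rfl) (Subsingleton.elim _ _) (Subsingleton.elim _ _)
  refine ⟨ι₁ ≫ φ, ?_, ?_⟩
  · have := endpointsIncl X false ▷ _ ≫= hφ
    rw [endpointsIncl_desc'_false, ← comp_whiskerRight_assoc, endpointsIncl_whiskerLeft_false] at this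
    rw [← h1, ← this, ι₁_comp_assoc]
  · have := endpointsIncl X true ▷ _ ≫= hφ
    rw [endpointsIncl_desc'_true, ← comp_whiskerRight_assoc, endpointsIncl_whiskerLeft_true] at this
    rw [← h1', ← this, ι₁_comp_assoc]

lemma symm {X K : SSet.{u}} (hK : KanComplex K) {f g : X ⟶ K} (h : Homotopic f g) :
    Homotopic g f := euclidean hK h (refl f)

lemma trans {X K : SSet.{u}} (hK : KanComplex K) {f g h : X ⟶ K} (h₁ : Homotopic f g)
    (h₂ : Homotopic g h) : Homotopic f h := euclidean hK (symm hK h₁) h₂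

end Homotopic

/-! ### Weak equivalences -/

namespace IsWeakEquiv

lemma of_homotopyInverse {X Y : SSet.{u}} (f : X ⟶ Y) (g : Y ⟶ X)
    (h₁ : Homotopic (f ≫ g) (𝟙 X)) (h₂ : Homotopic (g ≫ f) (𝟙 Y)) : IsWeakEquiv f := by
  intro K hK
  refine ⟨fun k => ⟨g ≫ k, ?_⟩, fun h h' H => ?_⟩
  · simpa using h₁.postcomp k
  · have a := h₂.postcomp h
    have b := h₂.postcomp h'
    have c := H.precomp g
    simp only [Category.id_comp, Category.assoc] at a b c
    exact Homotopic.euclidean hK a (c.trans hK b)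

lemma of_isIso {X Y : SSet.{u}} (f : X ⟶ Y) [IsIso f] : IsWeakEquiv f :=
  of_homotopyInverse f (inv f) (by simpa using .refl _) (by simpa using .refl _)

variable {X Y Z : SSet.{u}} {f : X ⟶ Y} {g : Y ⟶ Z}

lemma comp (hf : IsWeakEquiv f) (hg : IsWeakEquiv g) : IsWeakEquiv (f ≫ g) := by
  intro K hK
  refine ⟨fun k => ?_, fun h h' H => ?_⟩
  · obtain ⟨a, ha⟩ := (hf K hK).1 k
    obtain ⟨b, hb⟩ := (hg K hK).1 a
    exact ⟨b, by simpa using (hb.precomp f).trans hK ha⟩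
  · exact (hg K hK).2 _ _ ((hf K hK).2 _ _ (by simpa using H))

lemma of_comp_left (hf : IsWeakEquiv f) (hfg : IsWeakEquiv (f ≫ g)) : IsWeakEquiv g := by
  intro K hK
  refine ⟨fun k => ?_, fun h h' H => ?_⟩
  · obtain ⟨a, ha⟩ := (hfg K hK).1 (f ≫ k)
    exact ⟨a, (hf K hK).2 _ _ (by simpa using ha)⟩
  · exact (hfg K hK).2 _ _ (by simpa using H.precomp f)

lemma of_comp_right (hg : IsWeakEquiv g) (hfg : IsWeakEquiv (f ≫ g)) : IsWeakEquiv f := by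
  intro K hK
  refine ⟨fun k => ?_, fun h h' H => ?_⟩
  · obtain ⟨a, ha⟩ := (hfg K hK).1 k
    exact ⟨g ≫ a, by simpa using ha⟩
  · obtain ⟨a, ha⟩ := (hg K hK).1 h
    obtain ⟨a', ha'⟩ := (hg K hK).1 h'
    have : Homotopic a a' := (hfg K hK).2 _ _ (by
      simpa using (ha.precomp f).trans hK (H.trans hK ((ha'.symm hK).precomp f)))
    exact (ha.symm hK).trans hK ((this.precomp g).trans hK ha')

end IsWeakEquiv

lemma IsTrivialFibration.exists_section {E B : SSet.{u}} {p : E ⟶ B}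
    (hp : IsTrivialFibration p) : ∃ s : B ⟶ E, s ≫ p = 𝟙 B := by
  obtain ⟨s, -, h⟩ := exists_lift (hp.hasLift (⊥ : B.Subcomplex).ι)
    (Subcomplex.isInitialBot.to _) (𝟙 B) (Subcomplex.isInitialBot.hom_ext _ _)
  exact ⟨s, h⟩

lemma IsTrivialFibration.isWeakEquiv {E B : SSet.{u}} {p : E ⟶ B}
    (hp : IsTrivialFibration p) : IsWeakEquiv p := by
  obtain ⟨s, hs⟩ := hp.exists_section
  refine .of_homotopyInverse p s ?_ (by rw [hs]; exact .refl _)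
  obtain ⟨H, hH, -⟩ := exists_lift (hp.hasLift (E ◁ endpointsι)) (endpointsDesc (p ≫ s) (𝟙 E))
    (fst _ _ ≫ p) (by
      rw [endpointsDesc_comp, Category.assoc, hs]
      apply endpoints_hom_ext <;> rfl)
  rw [whiskerLeft_endpointsι_comp] at hH
  exact (homotopic_iff _ _).2
    ⟨H, endpointsIncl _ false ≫= hH, endpointsIncl _ true ≫= hH⟩

lemma anodyne_ι₀ (L : SSet.{u}) : anodyneExtensions (ι₀ : L ⟶ L ⊗ Δ[1]) := by
  have : IsIso (lift (𝟙 L) (stdSimplex.isTerminalObj₀.{u}.from L)) :=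
    ⟨fst _ _, by simp, by ext <;> simp⟩
  rw [ι₀_eq]
  exact MorphismProperty.comp_mem _ _ _ (.of_isIso _) ((anodyne_vertex 1).whiskerLeft L)

lemma anodyne_ι₁ (L : SSet.{u}) : anodyneExtensions (ι₁ : L ⟶ L ⊗ Δ[1]) := by
  have : IsIso (lift (𝟙 L) (stdSimplex.isTerminalObj₀.{u}.from L)) :=
    ⟨fst _ _, by simp, by ext <;> simp⟩
  rw [ι₁_eq]
  exact MorphismProperty.comp_mem _ _ _ (.of_isIso _) ((anodyne_vertex 0).whiskerLeft L)

/-! ### Kan fibrations that are weak equivalences -/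

/-- The minimum `Δ[1] ⊗ Δ[1] ⟶ Δ[1]`. -/
def minMap : (Δ[1] : SSet.{u}) ⊗ Δ[1] ⟶ Δ[1] where
  app k := ↾fun x => stdSimplex.objMk
    ((stdSimplex.asOrderHom x.1) ⊓ (stdSimplex.asOrderHom x.2))

/-- The map `(X ⊗ Δ[1]) ⊗ Δ[1] ⟶ X ⊗ Δ[1]` given by the minimum. -/
def minHomotopy (X : SSet.{u}) : (X ⊗ Δ[1]) ⊗ Δ[1] ⟶ X ⊗ Δ[1] :=
  (α_ _ _ _).hom ≫ X ◁ minMap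

lemma prod_hom_ext {X Y : SSet.{u}} {f g : Y ⟶ X ⊗ Δ[1]}
    (h : ∀ (k : ℕ) (y : Y _⦋k⦌), (f.app _ y).1 = (g.app _ y).1)
    (h' : ∀ (k : ℕ) (y : Y _⦋k⦌) (i : Fin (k + 1)),
      (show Δ[1] _⦋k⦌ from (f.app _ y).2) i = (show Δ[1] _⦋k⦌ from (g.app _ y).2) i) : f = g := by
  ext ⟨k⟩ y
  · induction k using SimplexCategory.rec with | _ k
    exact h k y
  · induction k using SimplexCategory.rec with | _ k
    exact SSet.stdSimplex.ext _ _ (h' k y)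

lemma ι₀_minHomotopy (X : SSet.{u}) : ι₀ ≫ minHomotopy X = fst _ _ ≫ ι₀ :=
  prod_hom_ext (fun _ _ => rfl) (fun _ _ _ => min_eq_right (Fin.zero_le _))

lemma ι₁_minHomotopy (X : SSet.{u}) : ι₁ ≫ minHomotopy X = 𝟙 _ :=
  prod_hom_ext (fun _ _ => rfl) (fun _ _ _ => min_eq_left (Fin.le_last _))

lemma ι₀_whiskerRight_minHomotopy (X : SSet.{u}) :
    ι₀ ▷ Δ[1] ≫ minHomotopy X = fst _ _ ≫ ι₀ :=
  prod_hom_ext (fun _ _ => rfl) (fun _ _ _ => min_eq_left (Fin.zero_le _))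

lemma ι₁_whiskerRight_minHomotopy (X : SSet.{u}) : ι₁ ▷ Δ[1] ≫ minHomotopy X = 𝟙 _ :=
  prod_hom_ext (fun _ _ => rfl) (fun _ _ _ => min_eq_right (Fin.le_last _))

/-- A Kan fibration between Kan complexes that is a weak equivalence is a fibrewise deformation
retraction. -/
lemma exists_fibrewise_deformation {E B : SSet.{u}} {p : E ⟶ B} (hp : IsKanFibration p)
    (hE : KanComplex E) (hB : KanComplex B) (hw : IsWeakEquiv p) :
    ∃ (s : B ⟶ E) (H : E ⊗ Δ[1] ⟶ E), s ≫ p = 𝟙 B ∧ ι₀ ≫ H = 𝟙 E ∧ ι₁ ≫ H = p ≫ s ∧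
      H ≫ p = fst _ _ ≫ p := by
  obtain ⟨h, hh⟩ := (hw E hE).1 (𝟙 E)
  have hhp : Homotopic (h ≫ p) (𝟙 B) :=
    (hw B hB).2 _ _ (by simpa using hh.postcomp p)
  obtain ⟨G, hG₀, hG₁⟩ := (homotopic_iff _ _).1 hhp
  -- `h` is a section only up to homotopy; lifting that homotopy from `h` ends at a strict section
  -- `s`.
  obtain ⟨G', hG'₀, hG'⟩ := exists_lift (hp.hasLift (anodyne_ι₀ B)) h G hG₀.symm
  obtain ⟨s, hs⟩ : ∃ s, s = ι₁ ≫ G' := ⟨_, rfl⟩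
  have hsp : s ≫ p = 𝟙 B := by rw [hs, Category.assoc, hG', hG₁]
  have hps : Homotopic (𝟙 E) (p ≫ s) := by
    refine Homotopic.euclidean hE hh ?_
    exact ((homotopic_iff _ _).2 ⟨G', hG'₀, hs.symm⟩ : Homotopic h s).precomp p
  obtain ⟨H, hH₀, hH₁⟩ := (homotopic_iff _ _).1 hps
  -- `H` joins the identity to `p ≫ s` but need not be fibrewise. Over the square obtained from `H ≫
  -- p` and the minimum, prescribe three sides: `H` on the terminal side of the second variable, the
  -- constant homotopy at the identity on one end of the first variable, and `H ≫ p ≫ s` on the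
  -- other. The fourth side of the lift lies over the constant homotopy at `p`.
  obtain ⟨φ, h1, h2, h3⟩ := exists_homotopy_lift₁ (E ◁ endpointsι) (hp.hasLift_leibniz _ 0)
    (endpointsDesc' (fst _ _) (H ≫ p ≫ s)) H (minHomotopy E ≫ H ≫ p) (by
      apply endpoints_hom_ext
      · rw [← ι₁_comp_assoc, endpointsIncl_desc'_false, ι₁_fst,
          reassoc_of% (endpointsIncl_whiskerLeft_false E), hH₀]
      · rw [← ι₁_comp_assoc, endpointsIncl_desc'_true, reassoc_of% hH₁, reassoc_of% hsp,
          reassoc_of% (endpointsIncl_whiskerLeft_true E), hH₁]) (by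
      apply endpoints_hom_ext'
      · rw [reassoc_of% (endpointsIncl_desc'_false (fst E Δ[1]) (H ≫ p ≫ s)),
          ← comp_whiskerRight_assoc, endpointsIncl_whiskerLeft_false,
          reassoc_of% (ι₀_whiskerRight_minHomotopy E), reassoc_of% hH₀]
      · rw [reassoc_of% (endpointsIncl_desc'_true (fst E Δ[1]) (H ≫ p ≫ s)),
          ← comp_whiskerRight_assoc, endpointsIncl_whiskerLeft_true,
          reassoc_of% (ι₁_whiskerRight_minHomotopy E), hsp, Category.comp_id])
    (by rw [reassoc_of% (ι₁_minHomotopy E)])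
  refine ⟨s, ι₀ ≫ φ, hsp, ?_, ?_, ?_⟩
  · have := ι₀ ≫= endpointsIncl E false ▷ _ ≫= h1
    rwa [endpointsIncl_desc'_false, ← comp_whiskerRight_assoc, endpointsIncl_whiskerLeft_false,
      ι₀_comp_assoc, ι₀_fst] at this
  · have := ι₀ ≫= endpointsIncl E true ▷ _ ≫= h1
    rwa [endpointsIncl_desc'_true, ← comp_whiskerRight_assoc, endpointsIncl_whiskerLeft_true,
      ι₀_comp_assoc, reassoc_of% hH₀] at this
  · rw [Category.assoc, h3, reassoc_of% (ι₀_minHomotopy E), reassoc_of% hH₀]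

/-- In a lifting problem, the bottom map followed by the section makes the lower triangle commute,
and the upper one up to the fibrewise deformation. Lifting this homotopy backwards from its terminal
end, over a constant homotopy of the base, corrects the upper triangle without disturbing the lower
one. -/
theorem IsKanFibration.isTrivialFibration {E B : SSet.{u}} {p : E ⟶ B} (hp : IsKanFibration p)
    (hE : KanComplex E) (hB : KanComplex B) (hw : IsWeakEquiv p) : IsTrivialFibration p := by
  obtain ⟨s, H, hs, h₀, h₁, hH⟩ := exists_fibrewise_deformation hp hE hB hw
  refine isTrivialFibration_of_hasLift fun {A L} j _ => ⟨fun {a b} sq => ?_⟩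
  obtain ⟨φ, e1, e2, e3⟩ := exists_homotopy_lift₁ j (hp.hasLift_leibniz j 0) (a ▷ _ ≫ H) (b ≫ s)
    (fst _ _ ≫ b) (by rw [ι₁_comp_assoc, h₁, sq.w_assoc])
    (by rw [Category.assoc, hH, whiskerRight_fst_assoc, whiskerRight_fst_assoc, sq.w])
    (by rw [Category.assoc, hs, ι₁_fst_assoc, Category.comp_id])
  refine ⟨⟨⟨ι₀ ≫ φ, ?_, ?_⟩⟩⟩
  · rw [← ι₀_comp_assoc, e1, ι₀_comp_assoc, h₀, Category.comp_id]
  · rw [Category.assoc, e3, ι₀_fst_assoc]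

end

section


/-! ### Function complexes and weak equivalences -/

instance kanComplex_terminal : KanComplex (⊤_ SSet.{u}) := by
  rw [kanComplex_iff]
  have : IsIso (terminal.from (⊤_ SSet.{u})) :=
    isIso_of_isTerminal terminalIsTerminal terminalIsTerminal _
  exact (modelCategoryQuillen.J.{u}.rlp).of_isIso _

lemma homotopic_curry_iff {A X K : SSet.{u}} (f g : A ⊗ X ⟶ K) :
    Homotopic (MonoidalClosed.curry f) (MonoidalClosed.curry g) ↔ Homotopic f g := by
  have h₀ : A ◁ (ι₀ : X ⟶ X ⊗ Δ[1]) ≫ (α_ _ _ _).inv = ι₀ := rfl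
  have h₁ : A ◁ (ι₁ : X ⟶ X ⊗ Δ[1]) ≫ (α_ _ _ _).inv = ι₁ := rfl
  rw [homotopic_iff, homotopic_iff]
  constructor
  · rintro ⟨H, e₀, e₁⟩
    refine ⟨(α_ _ _ _).hom ≫ MonoidalClosed.uncurry H, ?_, ?_⟩
    · rw [← h₀, Category.assoc, Iso.inv_hom_id_assoc, ← MonoidalClosed.uncurry_natural_left, e₀,
        MonoidalClosed.uncurry_curry]
    · rw [← h₁, Category.assoc, Iso.inv_hom_id_assoc, ← MonoidalClosed.uncurry_natural_left, e₁,
        MonoidalClosed.uncurry_curry]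
  · rintro ⟨H, e₀, e₁⟩
    refine ⟨MonoidalClosed.curry ((α_ _ _ _).inv ≫ H), ?_, ?_⟩
    · rw [← MonoidalClosed.curry_natural_left, reassoc_of% h₀, e₀]
    · rw [← MonoidalClosed.curry_natural_left, reassoc_of% h₁, e₁]

namespace IsWeakEquiv

/-- Homotopy classes of maps from `L ⊗ X` to `K` are those from `X` to the function complex of maps
`L ⟶ K`, which is again a Kan complex. -/
lemma whiskerLeft {X Y : SSet.{u}} {f : X ⟶ Y} (hf : IsWeakEquiv f) (L : SSet.{u}) :
    IsWeakEquiv (L ◁ f) := by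
  intro K hK
  obtain ⟨h1, h2⟩ := hf ((ihom L).obj K) inferInstance
  refine ⟨fun g => ?_, fun h h' H => ?_⟩
  · obtain ⟨k, hk⟩ := h1 (MonoidalClosed.curry g)
    refine ⟨MonoidalClosed.uncurry k, ?_⟩
    rwa [← homotopic_curry_iff, MonoidalClosed.curry_natural_left, MonoidalClosed.curry_uncurry]
  · rw [← homotopic_curry_iff]
    apply h2
    rwa [← MonoidalClosed.curry_natural_left, ← MonoidalClosed.curry_natural_left,
      homotopic_curry_iff]

lemma whiskerRight {X Y : SSet.{u}} {f : X ⟶ Y} (hf : IsWeakEquiv f) (L : SSet.{u}) :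
    IsWeakEquiv (f ▷ L) := by
  have : f ▷ L = (β_ _ _).hom ≫ L ◁ f ≫ (β_ _ _).hom := by simp
  rw [this]
  exact (of_isIso _).comp ((hf.whiskerLeft L).comp (of_isIso _))

/-- A Yoneda argument: a preimage of the class of the identity of `Q` is a homotopy inverse. -/
lemma of_bijective {P Q : SSet.{u}} (hP : KanComplex P) (hQ : KanComplex Q) (p : P ⟶ Q)
    (h₁ : ∀ (L : SSet.{u}) (g : L ⟶ Q), ∃ h : L ⟶ P, Homotopic (h ≫ p) g)
    (h₂ : ∀ (L : SSet.{u}) (h h' : L ⟶ P), Homotopic (h ≫ p) (h' ≫ p) → Homotopic h h') :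
    IsWeakEquiv p := by
  obtain ⟨s, hs⟩ := h₁ _ (𝟙 Q)
  exact of_homotopyInverse p s (h₂ _ _ _ (by simpa using hs.precomp p)) hs

lemma pre {A B : SSet.{u}} {i : A ⟶ B} (hi : IsWeakEquiv i) (K : SSet.{u}) [hK : KanComplex K] :
    IsWeakEquiv ((MonoidalClosed.pre i).app K) := by
  refine of_bijective inferInstance inferInstance _ (fun L g => ?_) (fun L h h' H => ?_)
  · obtain ⟨k, hk⟩ := (hi.whiskerRight L K hK).1 (MonoidalClosed.uncurry g)
    refine ⟨MonoidalClosed.curry k, ?_⟩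
    rw [← homotopic_curry_iff, MonoidalClosed.curry_uncurry] at hk
    rwa [MonoidalClosed.curry_pre_app]
  · rw [← MonoidalClosed.curry_uncurry h, ← MonoidalClosed.curry_uncurry h',
      MonoidalClosed.curry_pre_app, MonoidalClosed.curry_pre_app, homotopic_curry_iff] at H
    rw [← MonoidalClosed.curry_uncurry h, ← MonoidalClosed.curry_uncurry h', homotopic_curry_iff]
    exact (hi.whiskerRight L K hK).2 _ _ H

end IsWeakEquiv

lemma isTrivialFibration_pre {A B : SSet.{u}} {i : A ⟶ B} [Mono i] (hi : IsWeakEquiv i)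
    (K : SSet.{u}) [KanComplex K] : IsTrivialFibration ((MonoidalClosed.pre i).app K) :=
  IsKanFibration.isTrivialFibration
    ((modelCategoryQuillen.fibration_iff _).1 inferInstance) inferInstance inferInstance
    (hi.pre K)

lemma IsTrivialFibration.of_isPullback {E B E' B' : SSet.{u}} {p : E ⟶ B} {p' : E' ⟶ B'}
    {t : E' ⟶ E} {b : B' ⟶ B} (sq : IsPullback t p' p b) (hp : IsTrivialFibration p) :
    IsTrivialFibration p' :=
  (modelCategoryQuillen.I.{u}.rlp).of_isPullback sq hp

/-- Kan fibrations between Kan complexes. -/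
def kanFibrations : MorphismProperty SSet.{u} :=
  fun E B p => IsKanFibration p ∧ KanComplex E ∧ KanComplex B

/-- The class of maps having the left lifting property with respect to Kan fibrations between
Kan complexes. -/
def acyclic : MorphismProperty SSet.{u} := kanFibrations.llp

instance : acyclic.{u}.IsStableUnderCobaseChange := by unfold acyclic; infer_instance

instance : acyclic.{u}.RespectsIso := by unfold acyclic; infer_instance

/-- The projection from the pullback to the maps `A ⟶ E` is a base change of the trivial fibration
`pre i` on `B'`, and its composite with the map in question is `pre i` on `E`. Two out of three
shows that this Kan fibration is a weak equivalence. -/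
lemma isTrivialFibration_pullbackObjObj {A B E B' : SSet.{u}} {i : A ⟶ B} [Mono i]
    (hi : IsWeakEquiv i) {p : E ⟶ B'} (hp : IsKanFibration p) (hE : KanComplex E)
    (hB : KanComplex B') (sq : MonoidalClosed.internalHom.PullbackObjObj i p) :
    IsTrivialFibration sq.π := by
  have : HomotopicalAlgebra.Fibration p := (modelCategoryQuillen.fibration_iff _).2 hp
  have h1 : IsTrivialFibration sq.fst :=
    .of_isPullback sq.isPullback.flip (isTrivialFibration_pre hi B')
  refine IsKanFibration.isTrivialFibration
    ((modelCategoryQuillen.fibration_iff _).1 (fibration_pullbackObjObjπ sq))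
    (inferInstanceAs (KanComplex ((ihom B).obj E)))
    (KanComplex.of_fibration h1.isKanFibration (inferInstanceAs (KanComplex ((ihom A).obj E)))) ?_
  refine .of_comp_right h1.isWeakEquiv ?_
  rw [sq.π_fst]
  exact hi.pre E

/-- The pushout-product of a monomorphism that is a weak equivalence with a monomorphism. -/
lemma acyclic_pushoutObjObj {A B K L : SSet.{u}} {i : A ⟶ B} [Mono i] (hi : IsWeakEquiv i)
    {j : K ⟶ L} [Mono j] (sq : (curriedTensor SSet.{u}).PushoutObjObj i j) : acyclic sq.ι := by
  rintro E B p ⟨hp, hE, hB⟩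
  rw [MonoidalClosed.internalHomAdjunction₂.hasLiftingProperty_iff sq
    (Functor.PullbackObjObj.ofHasPullback MonoidalClosed.internalHom i p)]
  exact (isTrivialFibration_pullbackObjObj hi hp hE hB _).hasLift j

/-- The pushout-product with the inclusion of the empty simplicial set in the point returns `i`. -/
lemma acyclic_of_mono {A B : SSet.{u}} {i : A ⟶ B} [Mono i] (hi : IsWeakEquiv i) : acyclic i := by
  have h : acyclic (i ▷ 𝟙_ SSet.{u}) := acyclic_pushoutObjObj hi
    (.ofIsInitialRight (curriedTensor _) i (initial.to (𝟙_ _)) initialIsInitial)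
  exact (acyclic.{u}.arrow_mk_iso_iff (Arrow.isoMk (ρ_ A) (ρ_ B))).1 h


lemma acyclic_of_anodyne {A B : SSet.{u}} {i : A ⟶ B} (hi : anodyneExtensions i) : acyclic i :=
  fun _ _ _ hp => hi _ hp.1

/-- Lifting against `K ⟶ *` extends maps. Lifting against the path fibration from maps `Δ[1] ⟶ K` to
maps `endpoints ⟶ K` extends homotopies with both ends prescribed. Both are Kan fibrations between
Kan complexes. -/
lemma acyclic.isWeakEquiv {A B : SSet.{u}} {i : A ⟶ B} (hi : acyclic i) : IsWeakEquiv i := by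
  intro K hK
  have hK' := (kanComplex_iff K).1 hK
  refine ⟨fun g => ?_, fun h h' H => ?_⟩
  · obtain ⟨φ, h1, -⟩ := exists_lift (hi (terminal.from K) ⟨hK', hK, inferInstance⟩) g
      (terminal.from _) (Subsingleton.elim _ _)
    exact ⟨φ, h1 ▸ .refl _⟩
  · obtain ⟨H, h0, h1⟩ := (homotopic_iff _ _).1 H
    have hp := hi ((MonoidalClosed.pre endpointsι).app K)
      ⟨(modelCategoryQuillen.fibration_iff _).1 inferInstance, inferInstance, inferInstance⟩
    have hl : HasLiftingProperty (leibniz i endpointsι).ι (terminal.from K) := by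
      rw [HasLiftingProperty.iff_of_arrow_iso_left
        (show Arrow.mk (leibniz i endpointsι).ι ≅ Arrow.mk (leibniz i endpointsι).flipTensor.ι from
          Arrow.isoMk (Iso.refl _) (β_ _ _)),
        MonoidalClosed.internalHomAdjunction₂.hasLiftingProperty_iff _
          (Functor.PullbackObjObj.ofIsTerminal MonoidalClosed.internalHom endpointsι
            (terminal.from K) terminalIsTerminal)]
      exact hp
    obtain ⟨φ, -, h2, h3, -⟩ := exists_homotopy_lift i hl H h h' (terminal.from _) h0 h1
      (Subsingleton.elim _ _) (Subsingleton.elim _ _) (Subsingleton.elim _ _)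
    exact (homotopic_iff _ _).2 ⟨φ, h2, h3⟩

/-! ### Mapping cylinders of maps of diagrams -/

section Cylinder

variable {E : Type} [SmallCategory E] {A B : E ⥤ SSet.{u}} (h : A ⟶ B)

/-- The cylinder of a diagram of simplicial sets. -/
def diagramCylinder (A : E ⥤ SSet.{u}) : E ⥤ SSet.{u} := A ⋙ tensorRight Δ[1]

def diagramι₀ (A : E ⥤ SSet.{u}) : A ⟶ diagramCylinder A where
  app e := (ι₀ : A.obj e ⟶ A.obj e ⊗ Δ[1])

def diagramι₁ (A : E ⥤ SSet.{u}) : A ⟶ diagramCylinder A where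
  app e := (ι₁ : A.obj e ⟶ A.obj e ⊗ Δ[1])

def diagramFst (A : E ⥤ SSet.{u}) : diagramCylinder A ⟶ A where
  app e := (fst _ _ : A.obj e ⊗ Δ[1] ⟶ A.obj e)

/-- The mapping cylinder of a map of diagrams of simplicial sets. -/
def mappingCylinder : E ⥤ SSet.{u} := pushout (diagramι₁ A) h

namespace mappingCylinder

def inl : A ⟶ mappingCylinder h := diagramι₀ A ≫ pushout.inl _ _

def inr : B ⟶ mappingCylinder h := pushout.inr _ _

def proj : mappingCylinder h ⟶ B :=
  pushout.desc (diagramFst A ≫ h) (𝟙 B) (by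
    ext e : 2
    change ι₁ ≫ fst _ _ ≫ h.app e = h.app e ≫ 𝟙 _
    rw [ι₁_fst_assoc, Category.comp_id])

lemma inr_proj : inr h ≫ proj h = 𝟙 B := pushout.inr_desc _ _ _

lemma inl_proj : inl h ≫ proj h = h := by
  refine (Category.assoc (diagramι₀ A) (pushout.inl (diagramι₁ A) h) (proj h)).trans ?_
  rw [proj, pushout.inl_desc]
  ext e : 2
  exact ι₀_fst_assoc _ _

lemma isPushout_app (e : E) : IsPushout (ι₁ : A.obj e ⟶ A.obj e ⊗ Δ[1]) (h.app e)
    ((pushout.inl (diagramι₁ A) h).app e) ((inr h).app e) :=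
  (IsPushout.of_hasPushout (diagramι₁ A) h).map ((evaluation E SSet.{u}).obj e)

lemma anodyne_inr_app (e : E) : anodyneExtensions ((inr h).app e) :=
  anodyneExtensions.of_isPushout (isPushout_app h e).flip (anodyne_ι₁ _)

instance mono_inr_app (e : E) : Mono ((inr h).app e) :=
  SplitMono.mono ⟨(proj h).app e, by rw [← NatTrans.comp_app, inr_proj]; rfl⟩

lemma isWeakEquiv_inr_app (e : E) : IsWeakEquiv ((inr h).app e) :=
  (acyclic_of_anodyne (anodyne_inr_app h e)).isWeakEquiv

lemma isWeakEquiv_inl_app {e : E} (he : IsWeakEquiv (h.app e)) :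
    IsWeakEquiv ((inl h).app e) := by
  have h1 : IsWeakEquiv ((proj h).app e) := by
    refine (isWeakEquiv_inr_app h e).of_comp_left ?_
    rw [← NatTrans.comp_app, inr_proj]
    exact .of_isIso _
  refine h1.of_comp_right ?_
  rwa [← NatTrans.comp_app, inl_proj]

instance mono_inl_app (e : E) : Mono ((inl h).app e) := by
  have key : ∀ k, Mono (((inl h).app e).app k) := by
    intro k
    have sq := (isPushout_app h e).map ((evaluation _ _).obj k)
    -- The pushout is mapped to `Option A` by remembering points of the initial end of the cylinder
    -- and sending everything else, including `B`, to `none`. This respects the gluing, which only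
    -- involves the terminal end, and it detects equality on the initial end.
    let d : (A.obj e).obj k × (Δ[1] : SSet.{u}).obj k → Option ((A.obj e).obj k) :=
      open Classical in
      fun x => if x.2 = stdSimplex.const 1 0 k then some x.1 else none
    have hd : ∀ a, d ((ι₁ : A.obj e ⟶ A.obj e ⊗ Δ[1]).app k a) = none := by
      intro a
      refine if_neg fun h' => ?_
      have := congr_arg (fun z => (SSet.stdSimplex.objEquiv z).toOrderHom 0) h'
      exact absurd (show (1 : Fin 2) = 0 from this) (by decide)
    rw [mono_iff_injective]
    intro a a' ha
    let D := sq.desc (W := Option ((A.obj e).obj k)) (↾d) (↾fun _ => none) (ConcreteCategory.hom_ext _ _ hd)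
    have h1 : ∀ a, D (((inl h).app e).app k a) = some a := by
      intro a
      have := ConcreteCategory.congr_hom (sq.inl_desc (W := Option ((A.obj e).obj k)) (↾d)
        (↾fun _ => none) (ConcreteCategory.hom_ext _ _ hd)) ((ι₀ : A.obj e ⟶ A.obj e ⊗ Δ[1]).app k a)
      exact this.trans (if_pos rfl)
    exact Option.some_injective _ ((h1 a).symm.trans ((congr_arg D ha).trans (h1 a')))
  exact NatTrans.mono_of_mono_app _

end mappingCylinder

end Cylinder

end

section


/-! ### The small object argument for diagrams of simplicial sets -/

/-- The category of diagrams is equivalent to a category of functors on `u`-small categories with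
values in `Type u`, where every object is presentable. -/
instance isPresentable_diagram {E : Type} [SmallCategory E] (X : E ⥤ SSet.{u}) :
    IsPresentable.{u} X := by
  let S : SSet.{u} ≌ ((AsSmall.{u} SimplexCategory)ᵒᵖ ⥤ Type u) :=
    (AsSmall.equiv (C := SimplexCategory)).op.congrLeft
  let e : (E ⥤ SSet.{u}) ≌
      ((AsSmall.{u} E)ᵒᵖᵒᵖ ⥤ ((AsSmall.{u} SimplexCategory)ᵒᵖ ⥤ Type u)) :=
    ((AsSmall.equiv (C := E)).trans (opOpEquivalence _).symm).congrLeft.trans S.congrRight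
  obtain ⟨κ, _, _⟩ := (inferInstance : IsPresentable.{u} (e.functor.obj X)).exists_cardinal
  have : IsCardinalPresentable X κ :=
    (isCardinalPresentable_iff_of_isEquivalence X κ e.functor).1 ‹_›
  exact ⟨κ, inferInstance, this⟩

lemma hasSmallObjectArgument_ofHoms {E : Type} [SmallCategory E] {ι : Type u}
    {A B : ι → (E ⥤ SSet.{u})} (g : ∀ i, A i ⟶ B i) :
    MorphismProperty.HasSmallObjectArgument.{u} (MorphismProperty.ofHoms g) := by
  have h : ∀ i, ∃ κ : Cardinal.{u}, ∃ _ : Fact κ.IsRegular, IsCardinalPresentable (A i) κ :=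
    fun i => by
      obtain ⟨κ, h1, h2⟩ := (isPresentable_diagram (A i)).exists_cardinal
      exact ⟨κ, h1, h2⟩
  choose κ hκ hA using h
  -- Successors of infinite cardinals are regular, so there is a regular cardinal above all the
  -- ranks of the sources.
  obtain ⟨μ, hμ', hμ⟩ : ∃ μ : Cardinal.{u}, μ.IsRegular ∧ ∀ i, κ i ≤ μ :=
    ⟨Order.succ (max Cardinal.aleph0 (iSup κ)), Cardinal.isRegular_succ (le_max_left _ _),
      fun i => (le_ciSup (Cardinal.bddAbove_of_small) i).trans
        ((le_max_right _ _).trans (Order.le_succ _))⟩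
  have : Fact μ.IsRegular := ⟨hμ'⟩
  have : Nonempty μ.ord.ToType := by simpa using hμ'.ne_zero
  have := WellFoundedLT.toOrderBot μ.ord.ToType
  have hs : MorphismProperty.IsSmall.{u} (MorphismProperty.ofHoms g) :=
    MorphismProperty.isSmall_ofHoms ..
  have hl : LocallySmall.{u} (E ⥤ SSet.{u}) := inferInstance
  exact ⟨μ, inferInstance, inferInstance,
    { preservesColimit := by
        intro _ _ _ _ i hi f hf
        obtain ⟨i⟩ := hi
        have := isCardinalPresentable_of_le (A i) (hμ i)
        have := preservesColimitsOfShape_of_isCardinalPresentable (A i) μ μ.ord.ToType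
        infer_instance }⟩

lemma exists_rlp_replacement {E : Type} [SmallCategory E] {ι : Type u}
    {A B : ι → (E ⥤ SSet.{u})} (g : ∀ i, A i ⟶ B i) (X : E ⥤ SSet.{u}) :
    ∃ (Z : E ⥤ SSet.{u}) (t : X ⟶ Z), (MorphismProperty.ofHoms g).rlp.llp t ∧
      (MorphismProperty.ofHoms g).rlp (terminal.from Z) := by
  have := hasSmallObjectArgument_ofHoms g
  have h := MorphismProperty.factorizationData (MorphismProperty.ofHoms g).rlp.llp
    (MorphismProperty.ofHoms g).rlp (terminal.from X)
  refine ⟨h.Z, h.i, h.hi, ?_⟩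
  have : terminal.from h.Z = h.p := Subsingleton.elim _ _
  rw [this]
  exact h.hp

end

section


/-! ### Cell by cell lifting in categories of set-valued functors -/

section CellLift

universe w w₁ w₂ v' u'

variable {𝓑 : Type u'} [Category.{v'} 𝓑] {P X : 𝓑 ⥤ Type w₁}

/-- The lifting property of `q` with respect to the inclusion in the functor represented by `b`
of a family `S` of arrows with source `b`, expressed in terms of elements. -/
def LiftsAt (q : P ⟶ X) (b : 𝓑) (S : ∀ ⦃e : 𝓑⦄, (b ⟶ e) → Prop) : Prop :=
  ∀ (x : X.obj b) (y : ∀ ⦃e : 𝓑⦄ (f : b ⟶ e), S f → P.obj e),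
    (∀ ⦃e e' : 𝓑⦄ (f : b ⟶ e) (g : e ⟶ e') (hf : S f) (hfg : S (f ≫ g)),
      P.map g (y f hf) = y (f ≫ g) hfg) →
    (∀ ⦃e : 𝓑⦄ (f : b ⟶ e) (hf : S f), q.app e (y f hf) = X.map f x) →
    ∃ z : P.obj b, q.app b z = x ∧ ∀ ⦃e : 𝓑⦄ (f : b ⟶ e) (hf : S f), P.map f z = y f hf

variable {F : 𝓑 ⥤ Type w₂} (q : P ⟶ X) (χ : ∀ ⦃b : 𝓑⦄, F.obj b → X.obj b)

/-- A partially defined lift, seen as a relation. -/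
structure IsPartialLift (R : ∀ b : 𝓑, F.obj b → P.obj b → Prop) : Prop where
  map ⦃b b' : 𝓑⦄ (f : b ⟶ b') (x : F.obj b) (p : P.obj b) :
    R b x p → R b' (F.map f x) (P.map f p)
  fac ⦃b : 𝓑⦄ (x : F.obj b) (p : P.obj b) : R b x p → q.app b p = χ x
  unique ⦃b : 𝓑⦄ (x : F.obj b) (p p' : P.obj b) : R b x p → R b x p' → p = p'

/-- The domain of definition of a relation. -/
def relDom (R : ∀ b : 𝓑, F.obj b → P.obj b → Prop) : ∀ b, Set (F.obj b) :=
  fun b => {x | ∃ p, R b x p}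

variable {q χ}

/-- The lift `z` of `χ x` is propagated along all arrows out of `b`, and the resulting graph is
added to `R`. Where the orbit of `x` already lies in the domain, `z` was chosen to agree with the
old values; elsewhere distinct arrows give distinct elements. So the relation remains single valued.
-/
lemma IsPartialLift.exists_extension {R : ∀ b : 𝓑, F.obj b → P.obj b → Prop}
    (hR : IsPartialLift q χ R)
    (hχ : ∀ ⦃b b' : 𝓑⦄ (f : b ⟶ b') (x : F.obj b), χ (F.map f x) = X.map f (χ x))
    {b : 𝓑} (x : F.obj b)
    (hinj : ∀ ⦃e : 𝓑⦄ (f g : b ⟶ e), F.map f x = F.map g x → F.map f x ∉ relDom R e → f = g)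
    (hlift : LiftsAt q b fun e f => F.map f x ∈ relDom R e) :
    ∃ R' : ∀ b : 𝓑, F.obj b → P.obj b → Prop, IsPartialLift q χ R' ∧ R ≤ R' ∧
      ∀ e, relDom R' e = relDom R e ∪ {y | ∃ f : b ⟶ e, F.map f x = y} := by
  obtain ⟨z, hz, hz'⟩ := hlift (χ x) (fun e f hf => hf.choose)
    (fun e e' f g hf hfg => by
      refine hR.unique _ _ _ ?_ hfg.choose_spec
      have := hR.map g _ _ hf.choose_spec
      rwa [← F.map_comp_apply] at this)
    (fun e f hf => by rw [hR.fac _ _ hf.choose_spec, hχ])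
  have hz'' : ∀ ⦃e : 𝓑⦄ (f : b ⟶ e), F.map f x ∈ relDom R e → R e (F.map f x) (P.map f z) :=
    fun e f hf => by rw [hz' f hf]; exact hf.choose_spec
  refine ⟨fun e y p => R e y p ∨ ∃ f : b ⟶ e, F.map f x = y ∧ P.map f z = p, ⟨?_, ?_, ?_⟩,
    fun e y p h => Or.inl h, fun e => ?_⟩
  · rintro e e' g y p (h | ⟨f, rfl, rfl⟩)
    · exact Or.inl (hR.map g _ _ h)
    · exact Or.inr ⟨f ≫ g, by rw [F.map_comp_apply], by rw [P.map_comp_apply]⟩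
  · rintro e y p (h | ⟨f, rfl, rfl⟩)
    · exact hR.fac _ _ h
    · rw [hχ, ← hz, NatTrans.naturality_apply]
  · rintro e y p p' (h | ⟨f, rfl, rfl⟩) (h' | ⟨f', hf, rfl⟩)
    · exact hR.unique _ _ _ h h'
    · subst hf
      exact hR.unique _ _ _ h (hz'' f' ⟨_, h⟩)
    · exact hR.unique _ _ _ (hz'' f ⟨_, h'⟩) h'
    · by_cases h : F.map f x ∈ relDom R e
      · refine hR.unique _ _ _ (hz'' f h) ?_
        rw [← hf] at h ⊢
        exact hz'' f' h
      · rw [hinj f f' hf.symm h]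
  · ext y
    constructor
    · rintro ⟨p, h | ⟨f, hf, -⟩⟩
      · exact Or.inl ⟨p, h⟩
      · exact Or.inr ⟨f, hf⟩
    · rintro (⟨p, h⟩ | ⟨f, hf⟩)
      · exact ⟨p, Or.inl h⟩
      · exact ⟨_, Or.inr ⟨f, hf, rfl⟩⟩

lemma IsPartialLift.sSup {c : Set (∀ b : 𝓑, F.obj b → P.obj b → Prop)}
    (hc : IsChain (· ≤ ·) c) (h : ∀ R ∈ c, IsPartialLift q χ R) :
    IsPartialLift q χ (fun b x p => ∃ R ∈ c, R b x p) where
  map b b' f x p := fun ⟨R, hR, hx⟩ => ⟨R, hR, (h R hR).map f x p hx⟩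
  fac b x p := fun ⟨R, hR, hx⟩ => (h R hR).fac x p hx
  unique b x p p' := by
    rintro ⟨R, hR, hx⟩ ⟨R', hR', hx'⟩
    rcases hc.total hR hR' with h' | h'
    · exact (h R' hR').unique x p p' (h' _ _ _ hx) hx'
    · exact (h R hR).unique x p p' hx (h' _ _ _ hx')

/-- Partial lifts can be extended to all of `F` if this is possible one cell at a time. -/
theorem exists_lift_of_cells {R₀ : ∀ b : 𝓑, F.obj b → P.obj b → Prop}
    (hR₀ : IsPartialLift q χ R₀)
    (hχ : ∀ ⦃b b' : 𝓑⦄ (f : b ⟶ b') (x : F.obj b), χ (F.map f x) = X.map f (χ x))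
    (adm : (∀ b, Set (F.obj b)) → Prop) (h₀ : adm (relDom R₀))
    (hadm : ∀ c : Set (∀ b, Set (F.obj b)), (∀ Z ∈ c, adm Z) →
      adm (fun b => {x | ∃ Z ∈ c, x ∈ Z b}))
    (step : ∀ Z : ∀ b, Set (F.obj b), adm Z → (∀ b, relDom R₀ b ⊆ Z b) →
      (∀ ⦃b b' : 𝓑⦄ (f : b ⟶ b') (x : F.obj b), x ∈ Z b → F.map f x ∈ Z b') →
      (∃ b x, x ∉ Z b) → ∃ b x, x ∉ Z b ∧
        (∀ ⦃e : 𝓑⦄ (f g : b ⟶ e), F.map f x = F.map g x → F.map f x ∉ Z e → f = g) ∧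
        LiftsAt q b (fun e f => F.map f x ∈ Z e) ∧
        adm (fun e => Z e ∪ {y | ∃ f : b ⟶ e, F.map f x = y})) :
    ∃ ψ : ∀ b, F.obj b → P.obj b,
      (∀ ⦃b b' : 𝓑⦄ (f : b ⟶ b') (x : F.obj b), ψ b' (F.map f x) = P.map f (ψ b x)) ∧
      (∀ b x, q.app b (ψ b x) = χ x) ∧ ∀ b x p, R₀ b x p → ψ b x = p := by
  -- Zorn's lemma for admissible partial lifts containing `R₀`, ordered by inclusion of graphs. A
  -- maximal one is defined everywhere, since otherwise one more orbit could be added.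
  obtain ⟨R, hle, ⟨hR, hRadm⟩, hmax⟩ := zorn_le_nonempty₀
    (setOf fun R : ∀ b : 𝓑, F.obj b → P.obj b → Prop => IsPartialLift q χ R ∧ adm (relDom R))
    (fun c hc hchain _ _ => by
      refine ⟨fun b x p => ∃ R ∈ c, R b x p, ⟨.sSup hchain fun R hR => (hc hR).1, ?_⟩,
        fun R hR b x p h => ⟨R, hR, h⟩⟩
      convert hadm (relDom '' c) (by rintro _ ⟨R, hR, rfl⟩; exact (hc hR).2) using 2 with b
      ext x
      constructor
      · rintro ⟨p, R, hR, h⟩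
        exact ⟨_, ⟨R, hR, rfl⟩, p, h⟩
      · rintro ⟨_, ⟨R, hR, rfl⟩, p, h⟩
        exact ⟨p, R, hR, h⟩) R₀ ⟨hR₀, h₀⟩
  have htop : ∀ b x, x ∈ relDom R b := by
    by_contra hne
    simp only [not_forall] at hne
    obtain ⟨b, x, hx, hinj, hlift, ha⟩ := step (relDom R) hRadm
      (fun b x ⟨p, hp⟩ => ⟨p, hle _ _ _ hp⟩)
      (fun b b' f x ⟨p, hp⟩ => ⟨_, hR.map f x p hp⟩) hne
    obtain ⟨R', hR', hRR', hdom⟩ := hR.exists_extension hχ x hinj hlift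
    refine hx ?_
    have hx' : x ∈ relDom R' b := by
      rw [hdom]
      exact Or.inr ⟨𝟙 b, F.map_id_apply _ _⟩
    obtain ⟨p, hp⟩ := hx'
    refine ⟨p, hmax ⟨hR', ?_⟩ hRR' _ _ _ hp⟩
    convert ha using 1
    exact funext hdom
  choose ψ hψ using htop
  exact ⟨ψ, fun b b' f x => hR.unique _ _ _ (hψ _ _) (hR.map f _ _ (hψ b x)),
    fun b x => hR.fac _ _ (hψ b x), fun b x p hp => hR.unique _ _ _ (hψ b x) (hle _ _ _ hp)⟩

end CellLift

end

section


variable {E : Type} [SmallCategory E]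

/-! ### Pushout-products of maps of diagrams with maps of simplicial sets -/

/-- The pushout-product of a map of diagrams with a map of simplicial sets. -/
abbrev diagLeibniz {A B : E ⥤ SSet.{u}} (a : A ⟶ B) {K L : SSet.{u}} (j : K ⟶ L) :
    (curriedTensor (E ⥤ SSet.{u})).PushoutObjObj a ((Functor.const E).map j) :=
  Functor.PushoutObjObj.ofHasPushout _ _ _

def diagLeibnizApp {A B : E ⥤ SSet.{u}} (a : A ⟶ B) {K L : SSet.{u}} (j : K ⟶ L) (e : E) :
    (curriedTensor SSet.{u}).PushoutObjObj (a.app e) j where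
  pt := (diagLeibniz a j).pt.obj e
  inl := (diagLeibniz a j).inl.app e
  inr := (diagLeibniz a j).inr.app e
  isPushout := (diagLeibniz a j).isPushout.map ((evaluation E SSet.{u}).obj e)
  ι := (diagLeibniz a j).ι.app e
  inl_ι := NatTrans.congr_app (diagLeibniz a j).inl_ι e
  inr_ι := NatTrans.congr_app (diagLeibniz a j).inr_ι e

lemma exists_lift_diagLeibniz {A B P X : E ⥤ SSet.{u}} {a : A ⟶ B} {K L : SSet.{u}} {j : K ⟶ L}
    {q : P ⟶ X} (h : HasLiftingProperty (diagLeibniz a j).ι q)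
    (u : A ⊗ (Functor.const E).obj L ⟶ P) (v : B ⊗ (Functor.const E).obj K ⟶ P)
    (w : B ⊗ (Functor.const E).obj L ⟶ X)
    (huv : A ◁ (Functor.const E).map j ≫ u = a ▷ _ ≫ v) (hu : u ≫ q = a ▷ _ ≫ w)
    (hv : v ≫ q = B ◁ (Functor.const E).map j ≫ w) :
    ∃ φ : B ⊗ (Functor.const E).obj L ⟶ P, a ▷ _ ≫ φ = u ∧
      B ◁ (Functor.const E).map j ≫ φ = v ∧ φ ≫ q = w := by
  let sq := diagLeibniz a j
  obtain ⟨φ, h1, h2⟩ := exists_lift h (sq.isPushout.desc v u huv.symm) w (by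
    apply sq.hom_ext
    · rw [sq.isPushout.inl_desc_assoc, sq.inl_ι_assoc]; exact hv
    · rw [sq.isPushout.inr_desc_assoc, sq.inr_ι_assoc]; exact hu)
  refine ⟨φ, ?_, ?_, h2⟩
  · have := sq.inr ≫= h1
    rw [sq.isPushout.inr_desc, sq.inr_ι_assoc] at this
    exact this
  · have := sq.inl ≫= h1
    rw [sq.isPushout.inl_desc, sq.inl_ι_assoc] at this
    exact this

/-- A replacement of a diagram with strong lifting properties. -/
theorem exists_fibrant_replacement (X : E ⥤ SSet.{u}) {I₁ I₂ : Type} {A B : I₁ → (E ⥤ SSet.{u})}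
    (a : ∀ i, A i ⟶ B i) (ha : ∀ i e, Mono ((a i).app e)) (ha' : ∀ i e, IsWeakEquiv ((a i).app e))
    {C D : I₂ → (E ⥤ SSet.{u})} (c : ∀ i, C i ⟶ D i) (hc : ∀ i e, Mono ((c i).app e)) :
    ∃ (M : E ⥤ SSet.{u}) (t : X ⟶ M), (∀ e, acyclic (t.app e)) ∧
      (∀ i n, HasLiftingProperty (diagLeibniz (a i) ∂Δ[n].ι).ι (terminal.from M)) ∧
      (∀ i n (k : Fin (n + 2)),
        HasLiftingProperty (diagLeibniz (c i) Λ[n + 1, k].ι).ι (terminal.from M)) := by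
  -- The generating maps: boundary inclusions against the `a i`, which must become invisible to `M`,
  -- and horns against the `c i`, which encode fibrancy.
  let J : Type u := ULift.{u} ((I₁ × ℕ) ⊕ (I₂ × Σ n, Fin (n + 2)))
  let G : J → Arrow (E ⥤ SSet.{u}) := fun s => match s with
    | ⟨.inl (i, n)⟩ => Arrow.mk (diagLeibniz (a i) ∂Δ[n].ι).ι
    | ⟨.inr (i, ⟨n, k⟩)⟩ => Arrow.mk (diagLeibniz (c i) Λ[n + 1, k].ι).ι
  have hG : ∀ s e, acyclic ((G s).hom.app e) := by
    rintro ⟨⟨i, n⟩ | ⟨i, ⟨n, k⟩⟩⟩ e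
    · have := ha i e
      exact acyclic_pushoutObjObj (ha' i e) (diagLeibnizApp (a i) ∂Δ[n].ι e)
    · have := hc i e
      exact acyclic_of_anodyne (anodyneExtensions_pushoutObjObjι
        (diagLeibnizApp (c i) Λ[n + 1, k].ι e) (.horn_ι k))
  obtain ⟨M, t, ht, hM⟩ := exists_rlp_replacement (fun s => (G s).hom) X
  refine ⟨M, t, fun e K K' p hp => ?_, fun i n => ?_, fun i n k => ?_⟩
  -- Evaluation at `e` has a right adjoint, so a lifting problem for `t.app e` transposes to one for
  -- `t`, which may be tested on the generating maps, where it transposes back to their values at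
  -- `e`.
  · have adj := evaluationAdjunctionLeft SSet.{u} e
    have := ht ((evaluationRightAdjoint SSet.{u} e).map p) (by
      rintro _ _ _ ⟨s⟩
      exact (adj.hasLiftingProperty_iff _ _).1 (hG s e p hp))
    exact (adj.hasLiftingProperty_iff _ _).2 this
  · exact hM _ ⟨(⟨.inl (i, n)⟩ : J)⟩
  · exact hM _ ⟨(⟨.inr (i, ⟨n, k⟩)⟩ : J)⟩

/-! ### Mapping spaces of diagrams -/

/-- The simplicial mapping space from a diagram of simplicial sets. -/
def mapSp (A : E ⥤ SSet.{u}) : (E ⥤ SSet.{u}) ⥤ SSet.{u} :=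
  yoneda ⋙ (Functor.whiskeringLeft _ _ _).obj
    (SSet.stdSimplex.{u} ⋙ Functor.const E ⋙ tensorLeft A).op

section

variable {A B P X : E ⥤ SSet.{u}} {K L : SSet.{u}}

/-- A simplex of the mapping space, seen as a map of diagrams. -/
def mapSpHom {k : SimplexCategoryᵒᵖ} (s : ((mapSp A).obj X).obj k) :
    A ⊗ (Functor.const E).obj (stdSimplex.{u}.obj k.unop) ⟶ X := s

lemma mapSpHom_map (φ : K ⟶ (mapSp A).obj X) {k k' : SimplexCategoryᵒᵖ} (θ : k ⟶ k')
    (x : K.obj k) : mapSpHom (φ.app k' (K.map θ x)) =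
      A ◁ (Functor.const E).map (SSet.stdSimplex.map θ.unop) ≫ mapSpHom (φ.app k x) :=
  NatTrans.naturality_apply φ θ x

/-- The identity simplex of a standard simplex. -/
abbrev idSimplex (k : SimplexCategoryᵒᵖ) : (stdSimplex.{u}.obj k.unop).obj k :=
  stdSimplex.objEquiv.symm (𝟙 _)

lemma app_naturality (ψ : A ⊗ (Functor.const E).obj K ⟶ X) {e e' : E} (g : e ⟶ e')
    {k : SimplexCategoryᵒᵖ} (a : (A.obj e).obj k) (x : K.obj k) :
    (ψ.app e').app k ((A.map g).app k a, x) = (X.map g).app k ((ψ.app e).app k (a, x)) :=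
  ConcreteCategory.congr_hom (NatTrans.congr_app (ψ.naturality g) k)
    ((a, x) : (A.obj e).obj k × K.obj k)

lemma app_naturality' (ψ : A ⊗ (Functor.const E).obj K ⟶ X) (e : E)
    {k k' : SimplexCategoryᵒᵖ} (θ : k ⟶ k') (a : (A.obj e).obj k) (x : K.obj k) :
    (ψ.app e).app k' ((A.obj e).map θ a, K.map θ x) = (X.obj e).map θ ((ψ.app e).app k (a, x)) :=
  NatTrans.naturality_apply (ψ.app e) θ ((a, x) : (A.obj e).obj k × K.obj k)

lemma diag_hom_ext {ψ ψ' : A ⊗ (Functor.const E).obj K ⟶ X}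
    (h : ∀ (e : E) (k : SimplexCategoryᵒᵖ) (a : (A.obj e).obj k) (x : K.obj k),
      (ψ.app e).app k (a, x) = (ψ'.app e).app k (a, x)) : ψ = ψ' := by
  ext e k ⟨a, x⟩
  exact h e k a x

/-- Construct a map of diagrams from its values. -/
def diagHomMk (f : ∀ (e : E) (k : SimplexCategoryᵒᵖ), (A.obj e).obj k → K.obj k → (X.obj e).obj k)
    (h : ∀ (e : E) {k k' : SimplexCategoryᵒᵖ} (θ : k ⟶ k') (a : (A.obj e).obj k) (x : K.obj k),
      f e k' ((A.obj e).map θ a) (K.map θ x) = (X.obj e).map θ (f e k a x))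
    (h' : ∀ {e e' : E} (g : e ⟶ e') (k : SimplexCategoryᵒᵖ) (a : (A.obj e).obj k) (x : K.obj k),
      f e' k ((A.map g).app k a) x = (X.map g).app k (f e k a x)) :
    A ⊗ (Functor.const E).obj K ⟶ X where
  app e :=
    { app := fun k => ↾fun x => f e k x.1 x.2
      naturality := fun k k' θ => by
        ext ⟨a, x⟩
        exact h e θ a x }
  naturality e e' g := by
    ext k ⟨a, x⟩
    exact h' g k a x

def mapSpDesc (φ : K ⟶ (mapSp A).obj X) : A ⊗ (Functor.const E).obj K ⟶ X :=
  diagHomMk (fun e k a x => ((mapSpHom (φ.app k x)).app e).app k (a, idSimplex k))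
    (fun e k k' θ a x => by
      rw [mapSpHom_map, ← app_naturality']
      rfl)
    (fun g k a x => app_naturality _ g a _)

def mapSpLift (ψ : A ⊗ (Functor.const E).obj K ⟶ X) : K ⟶ (mapSp A).obj X where
  app k := ↾fun x => (show A ⊗ (Functor.const E).obj (stdSimplex.{u}.obj k.unop) ⟶ X from
    A ◁ (Functor.const E).map (yonedaEquiv.symm x) ≫ ψ)
  naturality k k' θ := by
    ext x
    refine diag_hom_ext fun e m a t => ?_
    obtain ⟨t, rfl⟩ := stdSimplex.objEquiv.symm.surjective t
    change (ψ.app e).app m (a, K.map t.op (K.map θ x)) =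
      (ψ.app e).app m (a, K.map (t ≫ θ.unop).op x)
    rw [← K.map_comp_apply]
    rfl

lemma mapSpDesc_app (φ : K ⟶ (mapSp A).obj X) (e : E) (k : SimplexCategoryᵒᵖ)
    (a : (A.obj e).obj k) (x : K.obj k) : ((mapSpDesc φ).app e).app k (a, x) =
      ((mapSpHom (φ.app k x)).app e).app k (a, idSimplex k) := rfl

lemma mapSpHom_lift (ψ : A ⊗ (Functor.const E).obj K ⟶ X) {k : SimplexCategoryᵒᵖ} (x : K.obj k)
    (e : E) {m : SimplexCategoryᵒᵖ} (a : (A.obj e).obj m) (t : m.unop ⟶ k.unop) :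
    ((mapSpHom ((mapSpLift ψ).app k x)).app e).app m (a, stdSimplex.objEquiv.symm t) =
      (ψ.app e).app m (a, K.map t.op x) := rfl

lemma mapSpLift_desc (φ : K ⟶ (mapSp A).obj X) : mapSpLift (mapSpDesc φ) = φ := by
  ext k x
  refine diag_hom_ext fun e m a t => ?_
  obtain ⟨t, rfl⟩ := stdSimplex.objEquiv.symm.surjective t
  refine (mapSpHom_lift _ x e a t).trans ?_
  rw [mapSpDesc_app, mapSpHom_map]
  change ((mapSpHom (φ.app k x)).app e).app m (a, stdSimplex.objEquiv.symm (𝟙 _ ≫ t)) = _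
  rw [Category.id_comp]
  rfl

lemma mapSpDesc_lift (ψ : A ⊗ (Functor.const E).obj K ⟶ X) : mapSpDesc (mapSpLift ψ) = ψ := by
  refine diag_hom_ext fun e k a x => ?_
  rw [mapSpDesc_app, mapSpHom_lift, op_id, K.map_id_apply]

lemma mapSpDesc_injective {φ φ' : K ⟶ (mapSp A).obj X} (h : mapSpDesc φ = mapSpDesc φ') :
    φ = φ' := by
  rw [← mapSpLift_desc φ, h, mapSpLift_desc]

lemma mapSpDesc_comp (f : K ⟶ L) (φ : L ⟶ (mapSp A).obj X) :
    mapSpDesc (f ≫ φ) = A ◁ (Functor.const E).map f ≫ mapSpDesc φ := rfl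

lemma mapSpDesc_comp_map (φ : K ⟶ (mapSp A).obj P) (q : P ⟶ X) :
    mapSpDesc (φ ≫ (mapSp A).map q) = mapSpDesc φ ≫ q := rfl

/-- Mapping spaces are contravariantly functorial in the source. -/
def mapSpPre (a : A ⟶ B) (X : E ⥤ SSet.{u}) : (mapSp B).obj X ⟶ (mapSp A).obj X :=
  mapSpLift (a ▷ _ ≫ mapSpDesc (𝟙 _))

lemma mapSpDesc_comp_pre (a : A ⟶ B) (φ : K ⟶ (mapSp B).obj X) :
    mapSpDesc (φ ≫ mapSpPre a X) = a ▷ _ ≫ mapSpDesc φ := by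
  rw [mapSpDesc_comp, mapSpPre, mapSpDesc_lift, ← Category.comp_id φ, mapSpDesc_comp,
    Category.comp_id]
  rfl

lemma isTrivialFibration_mapSp_map (q : P ⟶ X)
    (h : ∀ n : ℕ, HasLiftingProperty (A ◁ (Functor.const E).map ∂Δ[n].ι) q) :
    IsTrivialFibration ((mapSp A).map q) := by
  rintro _ _ _ ⟨n⟩
  refine ⟨fun {f g} sq => ?_⟩
  obtain ⟨φ, h1, h2⟩ := exists_lift (h n) (mapSpDesc f) (mapSpDesc g) (by
    rw [← mapSpDesc_comp_map, sq.w, mapSpDesc_comp])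
  refine ⟨⟨⟨mapSpLift φ, ?_, ?_⟩⟩⟩
  · apply mapSpDesc_injective
    rw [mapSpDesc_comp, mapSpDesc_lift, h1]
  · apply mapSpDesc_injective
    rw [mapSpDesc_comp_map, mapSpDesc_lift, h2]

lemma isTrivialFibration_mapSpPre (a : A ⟶ B)
    (h : ∀ n : ℕ, HasLiftingProperty (diagLeibniz a ∂Δ[n].ι).ι (terminal.from X)) :
    IsTrivialFibration (mapSpPre a X) := by
  rintro _ _ _ ⟨n⟩
  refine ⟨fun {f g} sq => ?_⟩
  obtain ⟨φ, h1, h2, -⟩ := exists_lift_diagLeibniz (h n) (mapSpDesc g) (mapSpDesc f)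
    (terminal.from _) (by rw [← mapSpDesc_comp, ← sq.w, mapSpDesc_comp_pre])
    (Subsingleton.elim _ _) (Subsingleton.elim _ _)
  refine ⟨⟨⟨mapSpLift φ, ?_, ?_⟩⟩⟩
  · apply mapSpDesc_injective
    rw [mapSpDesc_comp, mapSpDesc_lift, h2]
  · apply mapSpDesc_injective
    rw [mapSpDesc_comp_pre, mapSpDesc_lift, h1]

end

end

section


variable {E : Type} [SmallCategory E]

/-- Up to isomorphism `i` and `j` are inclusions of subcomplexes, and their pushout-product is then
the inclusion of a union of two subcomplexes of a product. -/
instance mono_leibniz {A B K L : SSet.{u}} (i : A ⟶ B) [Mono i] (j : K ⟶ L) [Mono j] :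
    Mono (leibniz i j).ι := by
  let e : Arrow.mk (leibniz i j).ι ≅
      Arrow.mk (leibniz (Subcomplex.range i).ι (Subcomplex.range j).ι).ι :=
    (Functor.PushoutObjObj.ι_iso_of_iso_left (f₁ := Arrow.mk i)
      (f₁' := Arrow.mk (Subcomplex.range i).ι) (f₂ := Arrow.mk j) (leibniz i j)
      (leibniz (Subcomplex.range i).ι j)
      (Arrow.isoMk (asIso (Subcomplex.toRange i)) (Iso.refl _))) ≪≫
    (Functor.PushoutObjObj.ι_iso_of_iso_right (f₁ := Arrow.mk (Subcomplex.range i).ι)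
      (f₂ := Arrow.mk j) (f₂' := Arrow.mk (Subcomplex.range j).ι)
      (leibniz (Subcomplex.range i).ι j)
      (leibniz (Subcomplex.range i).ι (Subcomplex.range j).ι)
      (Arrow.isoMk (asIso (Subcomplex.toRange j)) (Iso.refl _)))
  let e' : Arrow.mk (leibniz (Subcomplex.range i).ι (Subcomplex.range j).ι).ι ≅
      Arrow.mk ((Subcomplex.range i).unionProd (Subcomplex.range j)).ι :=
    Functor.PushoutObjObj.ι_iso_of_iso_left (f₁ := Arrow.mk (Subcomplex.range i).ι)
      (f₁' := Arrow.mk (Subcomplex.range i).ι) (f₂ := Arrow.mk (Subcomplex.range j).ι)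
      (leibniz (Subcomplex.range i).ι (Subcomplex.range j).ι)
      (Subcomplex.unionProd.pushoutObjObj _ _) (Iso.refl _)
  exact ((MorphismProperty.monomorphisms SSet.{u}).arrow_mk_iso_iff (e ≪≫ e')).2
    (MorphismProperty.monomorphisms.infer_property _)

/-! ### Relative matching objects -/

section RelMatching

variable {P X : E ⥤ SSet.{u}} (q : P ⟶ X) (b : E) (S : ∀ ⦃e : E⦄, (b ⟶ e) → Prop)

/-- The relative matching object of a map of diagrams at `b`, with respect to a family `S` of
arrows with source `b`. -/
def relFam : SSet.{u} where
  obj k := { p : (X.obj b).obj k × (∀ ⦃e : E⦄ (f : b ⟶ e), S f → (P.obj e).obj k) //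
    (∀ ⦃e e' : E⦄ (f : b ⟶ e) (g : e ⟶ e') (hf : S f) (hfg : S (f ≫ g)),
      (P.map g).app k (p.2 f hf) = p.2 (f ≫ g) hfg) ∧
    ∀ ⦃e : E⦄ (f : b ⟶ e) (hf : S f), (q.app e).app k (p.2 f hf) = (X.map f).app k p.1 }
  map {k k'} θ := ↾fun p => ⟨((X.obj b).map θ p.1.1, fun e f hf => (P.obj e).map θ (p.1.2 f hf)),
    fun e e' f g hf hfg => (NatTrans.naturality_apply (P.map g) θ _).trans
      (congr_arg ((P.obj e').map θ) (p.2.1 f g hf hfg)),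
    fun e f hf => (NatTrans.naturality_apply (q.app e) θ _).trans
      ((congr_arg ((X.obj e).map θ) (p.2.2 f hf)).trans
        (NatTrans.naturality_apply (X.map f) θ _).symm)⟩
  map_id k := by
    refine ConcreteCategory.hom_ext _ _ fun p => ?_
    refine Subtype.ext (Prod.ext ?_ ?_)
    · exact (X.obj b).map_id_apply _ _
    · funext e f hf
      exact (P.obj e).map_id_apply _ _
  map_comp θ θ' := by
    refine ConcreteCategory.hom_ext _ _ fun p => ?_
    refine Subtype.ext (Prod.ext ?_ ?_)
    · exact (X.obj b).map_comp_apply _ _ _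
    · funext e f hf
      exact (P.obj e).map_comp_apply _ _ _

def relFamBase : relFam q b S ⟶ X.obj b where
  app k := ↾fun p => p.1.1

def relFamProj {e : E} (f : b ⟶ e) (hf : S f) : relFam q b S ⟶ P.obj e where
  app k := ↾fun p => p.1.2 f hf

variable {q b S}

lemma relFamProj_map {e e' : E} (f : b ⟶ e) (g : e ⟶ e') (hf : S f) (hfg : S (f ≫ g)) :
    relFamProj q b S f hf ≫ P.map g = relFamProj q b S (f ≫ g) hfg := by
  ext k p
  exact p.2.1 f g hf hfg

lemma relFamProj_app {e : E} (f : b ⟶ e) (hf : S f) :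
    relFamProj q b S f hf ≫ q.app e = relFamBase q b S ≫ X.map f := by
  ext k p
  exact p.2.2 f hf

lemma relFam_hom_ext {L : SSet.{u}} {φ φ' : L ⟶ relFam q b S}
    (h : φ ≫ relFamBase q b S = φ' ≫ relFamBase q b S)
    (h' : ∀ ⦃e : E⦄ (f : b ⟶ e) (hf : S f),
      φ ≫ relFamProj q b S f hf = φ' ≫ relFamProj q b S f hf) : φ = φ' := by
  ext k x
  refine Subtype.ext (Prod.ext ?_ ?_)
  · exact ConcreteCategory.congr_hom (NatTrans.congr_app h k) x
  · funext e f hf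
    exact ConcreteCategory.congr_hom (NatTrans.congr_app (h' f hf) k) x

def relFamLift {L : SSet.{u}} (x : L ⟶ X.obj b)
    (y : ∀ ⦃e : E⦄ (f : b ⟶ e), S f → (L ⟶ P.obj e))
    (hy : ∀ ⦃e e' : E⦄ (f : b ⟶ e) (g : e ⟶ e') (hf : S f) (hfg : S (f ≫ g)),
      y f hf ≫ P.map g = y (f ≫ g) hfg)
    (hx : ∀ ⦃e : E⦄ (f : b ⟶ e) (hf : S f), y f hf ≫ q.app e = x ≫ X.map f) :
    L ⟶ relFam q b S where
  app k := ↾fun l => ⟨(x.app k l, fun e f hf => (y f hf).app k l),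
    fun e e' f g hf hfg => ConcreteCategory.congr_hom (NatTrans.congr_app (hy f g hf hfg) k) l,
    fun e f hf => ConcreteCategory.congr_hom (NatTrans.congr_app (hx f hf) k) l⟩
  naturality k k' θ := by
    ext l
    refine Subtype.ext (Prod.ext ?_ ?_)
    · exact NatTrans.naturality_apply x θ l
    · funext e f hf
      exact NatTrans.naturality_apply (y f hf) θ l

variable (q b S) in
/-- The relative matching map. -/
def relMatch : P.obj b ⟶ relFam q b S :=
  relFamLift (q.app b) (fun _ f _ => P.map f) (fun _ _ _ _ _ _ => (P.map_comp _ _).symm)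
    (fun _ f _ => q.naturality f)

lemma relMatch_base : relMatch q b S ≫ relFamBase q b S = q.app b := rfl

lemma relMatch_proj {e : E} (f : b ⟶ e) (hf : S f) :
    relMatch q b S ≫ relFamProj q b S f hf = P.map f := rfl

/-- The functor of commutative squares from a fixed map to a map of diagrams. -/
def squares {K L : SSet.{u}} (j : K ⟶ L) (q : P ⟶ X) : E ⥤ Type u where
  obj e := { p : (K ⟶ P.obj e) × (L ⟶ X.obj e) // p.1 ≫ q.app e = j ≫ p.2 }
  map g := ↾fun p => ⟨(p.1.1 ≫ P.map g, p.1.2 ≫ X.map g), by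
    rw [Category.assoc, q.naturality, ← Category.assoc, p.2, Category.assoc]⟩
  map_id e := by
    refine ConcreteCategory.hom_ext _ _ fun p => ?_
    refine Subtype.ext (Prod.ext ?_ ?_)
    · exact (congr_arg _ (P.map_id e)).trans (Category.comp_id _)
    · exact (congr_arg _ (X.map_id e)).trans (Category.comp_id _)
  map_comp g g' := by
    refine ConcreteCategory.hom_ext _ _ fun p => ?_
    refine Subtype.ext (Prod.ext ?_ ?_)
    · exact (congr_arg _ (P.map_comp g g')).trans (Category.assoc _ _ _).symm
    · exact (congr_arg _ (X.map_comp g g')).trans (Category.assoc _ _ _).symm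

def toSquares {K L : SSet.{u}} (j : K ⟶ L) (q : P ⟶ X) :
    P ⋙ coyoneda.obj (op L) ⟶ squares j q where
  app e := ↾fun z => ⟨(j ≫ z, z ≫ q.app e), by rw [Category.assoc]⟩
  naturality e e' g := by
    ext z
    refine Subtype.ext (Prod.ext ?_ ?_)
    · exact (Category.assoc _ _ _).symm
    · change (z ≫ P.map g) ≫ q.app e' = (z ≫ q.app e) ≫ X.map g
      rw [Category.assoc, q.naturality, Category.assoc]

/-- A square at `b` together with compatible solutions along `S` is the same as a square from `j` to
the relative matching map. -/
lemma liftsAt_toSquares {K L : SSet.{u}} {j : K ⟶ L}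
    (h : HasLiftingProperty j (relMatch q b S)) : LiftsAt (toSquares j q) b S := by
  rintro ⟨⟨a, x⟩, w⟩ y hy hx
  obtain ⟨z, h1, h2⟩ := exists_lift h a (relFamLift x y hy
    (fun e f hf => congr_arg (fun p => p.1.2) (hx f hf))) (by
      apply relFam_hom_ext
      · exact w
      · intro e f hf
        exact (congr_arg (fun p => p.1.1) (hx f hf)).symm)
  refine ⟨z, Subtype.ext (Prod.ext h1 ?_), fun e f hf => ?_⟩
  · exact h2 =≫ relFamBase q b S
  · exact h2 =≫ relFamProj q b S f hf

end RelMatching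

/-! ### Spaces of families -/

section Families

/-- The space of natural families of simplices of a diagram indexed by the elements of a
set-valued functor. -/
def families (F : E ⥤ Type) (X : E ⥤ SSet.{u}) : SSet.{u} where
  obj k := { y : ∀ ⦃e : E⦄, F.obj e → (X.obj e).obj k //
    ∀ ⦃e e' : E⦄ (g : e ⟶ e') (t : F.obj e), y (F.map g t) = (X.map g).app k (y t) }
  map {k k'} θ := ↾fun y => ⟨fun e t => (X.obj e).map θ (y.1 t), fun e e' g t =>
    (congr_arg ((X.obj e').map θ) (y.2 g t)).trans (NatTrans.naturality_apply (X.map g) θ _).symm⟩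
  map_id k := by
    refine ConcreteCategory.hom_ext _ _ fun y => Subtype.ext ?_
    funext e t
    exact (X.obj e).map_id_apply _ _
  map_comp θ θ' := by
    refine ConcreteCategory.hom_ext _ _ fun y => Subtype.ext ?_
    funext e t
    exact (X.obj e).map_comp_apply _ _ _

variable (F : E ⥤ Type) (P X : E ⥤ SSet.{u}) {L : SSet.{u}}

def familiesApp ⦃e : E⦄ (t : F.obj e) : families F X ⟶ X.obj e where
  app k := ↾fun y => y.1 t

variable {F P X}

lemma familiesApp_map ⦃e e' : E⦄ (g : e ⟶ e') (t : F.obj e) :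
    familiesApp F X t ≫ X.map g = familiesApp F X (F.map g t) := by
  ext k y
  exact (y.2 g t).symm

lemma families_hom_ext {φ φ' : L ⟶ families F X}
    (h : ∀ ⦃e : E⦄ (t : F.obj e), φ ≫ familiesApp F X t = φ' ≫ familiesApp F X t) : φ = φ' := by
  ext k l
  refine Subtype.ext ?_
  funext e t
  exact ConcreteCategory.congr_hom (NatTrans.congr_app (h t) k) l

def familiesLift (y : ∀ ⦃e⦄, F.obj e → (L ⟶ X.obj e))
    (hy : ∀ ⦃e e'⦄ (g : e ⟶ e') (t : F.obj e), y (F.map g t) = y t ≫ X.map g) :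
    L ⟶ families F X where
  app k := ↾fun l => ⟨fun e t => (y t).app k l, fun e e' g t =>
    ConcreteCategory.congr_hom (NatTrans.congr_app (hy g t) k) l⟩
  naturality k k' θ := by
    refine ConcreteCategory.hom_ext _ _ fun l => Subtype.ext ?_
    funext e t
    exact NatTrans.naturality_apply (y t) θ l

lemma familiesLift_app (y : ∀ ⦃e⦄, F.obj e → (L ⟶ X.obj e))
    (hy : ∀ ⦃e e'⦄ (g : e ⟶ e') (t : F.obj e), y (F.map g t) = y t ≫ X.map g) ⦃e : E⦄
    (t : F.obj e) : familiesLift y hy ≫ familiesApp F X t = y t := rfl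

lemma familiesLift_app_assoc (y : ∀ ⦃e⦄, F.obj e → (L ⟶ X.obj e))
    (hy : ∀ ⦃e e'⦄ (g : e ⟶ e') (t : F.obj e), y (F.map g t) = y t ≫ X.map g) ⦃e : E⦄
    (t : F.obj e) {Z : SSet.{u}} (h : X.obj e ⟶ Z) :
    familiesLift y hy ≫ familiesApp F X t ≫ h = y t ≫ h := rfl

variable (F)

def familiesMap (q : P ⟶ X) : families F P ⟶ families F X :=
  familiesLift (fun e t => familiesApp F P t ≫ q.app e) (fun e e' g t => by
    rw [← familiesApp_map, Category.assoc, Category.assoc, q.naturality])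

lemma familiesMap_app (q : P ⟶ X) ⦃e : E⦄ (t : F.obj e) :
    familiesMap F q ≫ familiesApp F X t = familiesApp F P t ≫ q.app e := rfl

end Families

/-! ### Lifting families -/

section FamilyLift

/-- Maps which are not split monomorphisms. -/
def NotSplitMono {b : E} ⦃e : E⦄ (f : b ⟶ e) : Prop := ¬ IsSplitMono f

/-- A degree function such that every map that is not a split monomorphism factors through an
epimorphism that lowers the degree. -/
def IsReedyDegree (deg : E → ℕ) : Prop :=
  ∀ ⦃e e' : E⦄ (g : e ⟶ e'), NotSplitMono g →
    ∃ (e₀ : E) (p : e ⟶ e₀) (i : e₀ ⟶ e'), p ≫ i = g ∧ Epi p ∧ NotSplitMono p ∧ deg e₀ < deg e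

/-- A set-valued functor is generated by elements of degree less than `N` on which the category
acts freely. -/
def IsGeneratedBelow (deg : E → ℕ) (N : ℕ∞) (F : E ⥤ Type) : Prop :=
  ∀ ⦃e : E⦄ (x : F.obj e), ∃ (e' : E) (i : e' ⟶ e) (x' : F.obj e'), F.map i x' = x ∧
    (deg e' : ℕ∞) < N ∧ ∀ ⦃e'' : E⦄ (f g : e' ⟶ e''), F.map f x' = F.map g x' → f = g

variable {P X : E ⥤ SSet.{u}} {q : P ⟶ X} {K L : SSet.{u}} {j : K ⟶ L}

/-- Lifts are chosen one free generator at a time, in order of increasing degree. The values of the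
lift at a new generator are already prescribed along the arrows that are not split monomorphisms,
and extending them is the lifting problem against `relMatch`. -/
theorem exists_family_lift {deg : E → ℕ} (hdeg : IsReedyDegree deg) {N : ℕ∞} {F : E ⥤ Type}
    (hF : IsGeneratedBelow deg N F)
    (h : ∀ b, (deg b : ℕ∞) < N → HasLiftingProperty j (relMatch q b NotSplitMono))
    (a : ∀ ⦃e⦄, F.obj e → (K ⟶ P.obj e)) (x : ∀ ⦃e⦄, F.obj e → (L ⟶ X.obj e))
    (ha : ∀ ⦃e e'⦄ (g : e ⟶ e') (t : F.obj e), a (F.map g t) = a t ≫ P.map g)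
    (hx : ∀ ⦃e e'⦄ (g : e ⟶ e') (t : F.obj e), x (F.map g t) = x t ≫ X.map g)
    (w : ∀ ⦃e⦄ (t : F.obj e), a t ≫ q.app e = j ≫ x t) :
    ∃ z : ∀ ⦃e⦄, F.obj e → (L ⟶ P.obj e),
      (∀ ⦃e e'⦄ (g : e ⟶ e') (t : F.obj e), z (F.map g t) = z t ≫ P.map g) ∧
      (∀ ⦃e⦄ (t : F.obj e), j ≫ z t = a t) ∧ ∀ ⦃e⦄ (t : F.obj e), z t ≫ q.app e = x t := by
  obtain ⟨ψ, h1, h2, -⟩ := exists_lift_of_cells (q := toSquares j q)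
    (χ := fun e (t : F.obj e) => ⟨(a t, x t), w t⟩) (R₀ := fun _ _ _ => False)
    ⟨fun _ _ _ _ _ h => h.elim, fun _ _ _ h => h.elim, fun _ _ _ _ h => h.elim⟩
    (fun e e' g t => Subtype.ext (Prod.ext (ha g t) (hx g t))) (fun _ => True) trivial
    (fun _ _ => trivial) (by
      rintro Z - - hZ ⟨e₁, x₁, hx₁⟩
      have hex : ∃ d : ℕ, ∃ (e : E) (t : F.obj e), deg e = d ∧ t ∉ Z e ∧ (deg e : ℕ∞) < N ∧
          ∀ ⦃e'' : E⦄ (f g : e ⟶ e''), F.map f t = F.map g t → f = g := by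
        obtain ⟨e, i, t, hi, hN, ht⟩ := hF x₁
        exact ⟨_, e, t, rfl, fun h => hx₁ (hi ▸ hZ i t h), hN, ht⟩
      classical
      obtain ⟨e, t, hd, htZ, hN, ht⟩ := Nat.find_spec hex
      refine ⟨e, t, htZ, fun e' f g hfg _ => ht f g hfg, ?_, trivial⟩
      -- Since `t` is a free element of least degree outside `Z`, the arrows carrying it into `Z`
      -- are exactly those that are not split monomorphisms. A retraction would bring `t` itself
      -- into `Z`. In the other direction, such an arrow factors through an epimorphism lowering the
      -- degree, the image of `t` under which is again free and so lies in `Z` by minimality.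
      have hS : (fun (e' : E) (f : e ⟶ e') => F.map f t ∈ Z e') =
          fun (e' : E) (f : e ⟶ e') => NotSplitMono f := by
        funext e' f
        refine propext ⟨fun hf hs => htZ ?_, fun hf => ?_⟩
        · have := hZ (retraction f) _ hf
          rwa [← F.map_comp_apply, IsSplitMono.id, F.map_id_apply] at this
        · obtain ⟨e₀, p, i, rfl, hp, -, hlt⟩ := hdeg f hf
          rw [F.map_comp_apply]
          apply hZ
          by_contra hne
          refine Nat.find_min hex (m := deg e₀) (hd ▸ hlt) ⟨e₀, F.map p t, rfl, hne,
            lt_trans (by exact_mod_cast hlt) hN, fun e'' f g hfg => ?_⟩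
          rw [← F.map_comp_apply, ← F.map_comp_apply] at hfg
          exact (cancel_epi p).1 (ht _ _ hfg)
      change LiftsAt _ e (fun (e' : E) (f : e ⟶ e') => F.map f t ∈ Z e')
      rw [hS]
      exact liftsAt_toSquares (h e hN))
  exact ⟨fun e t => ψ e t, fun e e' g t => h1 g t,
    fun e t => congr_arg (fun p => p.1.1) (h2 e t), fun e t => congr_arg (fun p => p.1.2) (h2 e t)⟩

/-- A square into `familiesMap F q` is a natural family of squares into `q` indexed by the elements
of `F`, so `exists_family_lift` applies. -/
theorem isTrivialFibration_familiesMap {deg : E → ℕ} (hdeg : IsReedyDegree deg) {N : ℕ∞}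
    {F : E ⥤ Type} (hF : IsGeneratedBelow deg N F)
    (h : ∀ b, (deg b : ℕ∞) < N → IsTrivialFibration (relMatch q b NotSplitMono)) :
    IsTrivialFibration (familiesMap F q) := by
  refine isTrivialFibration_of_hasLift fun {K L} j _ => ⟨fun {a v} sq => ?_⟩
  obtain ⟨z, hz, h1, h2⟩ := exists_family_lift hdeg hF (fun b hb => (h b hb).hasLift j)
    (fun e t => a ≫ familiesApp F P t) (fun e t => v ≫ familiesApp F X t)
    (fun e e' g t => by rw [Category.assoc, familiesApp_map])
    (fun e e' g t => by rw [Category.assoc, familiesApp_map])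
    (fun e t => by rw [Category.assoc, ← familiesMap_app, reassoc_of% sq.w])
  exact ⟨⟨⟨familiesLift z hz, families_hom_ext fun e t => h1 t,
    families_hom_ext fun e t => h2 t⟩⟩⟩

/-- The functor of maps from `b` that are not split monomorphisms. -/
def nonSplit (b : E) : E ⥤ Type where
  obj e := { f : b ⟶ e // NotSplitMono f }
  map g := ↾fun f => ⟨f.1 ≫ g, fun h => f.2 (IsSplitMono.mk' ⟨g ≫ retraction (f.1 ≫ g), by
    rw [← Category.assoc, IsSplitMono.id]⟩)⟩
  map_id e := by
    refine ConcreteCategory.hom_ext _ _ fun f => ?_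
    exact Subtype.ext (Category.comp_id f.1)
  map_comp g g' := by
    refine ConcreteCategory.hom_ext _ _ fun f => ?_
    exact Subtype.ext (Category.assoc f.1 g g').symm

lemma isGeneratedBelow_nonSplit {deg : E → ℕ} (hdeg : IsReedyDegree deg) (b : E) :
    IsGeneratedBelow deg (deg b) (nonSplit b) := by
  rintro e ⟨f, hf⟩
  obtain ⟨e₀, p, i, h, hp, hp', hlt⟩ := hdeg f hf
  exact ⟨e₀, i, ⟨p, hp'⟩, Subtype.ext h, by exact_mod_cast hlt, fun e' g g' hg =>
    (cancel_epi p).1 (congr_arg Subtype.val hg)⟩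

/-- A relative Reedy fibration that is objectwise a trivial fibration is a relative Reedy trivial
fibration. -/
theorem isTrivialFibration_relMatch {deg : E → ℕ} (hdeg : IsReedyDegree deg)
    (hq : ∀ b, IsKanFibration (relMatch q b NotSplitMono))
    (hq' : ∀ b, IsTrivialFibration (q.app b)) (b : E) :
    IsTrivialFibration (relMatch q b NotSplitMono) := by
  obtain ⟨n, hn⟩ : ∃ n, deg b = n := ⟨_, rfl⟩
  induction n using Nat.strong_induction_on generalizing b with | _ n ih
  refine isTrivialFibration_of_hasLift fun {K L} j _ => ⟨fun {a v} sq => ?_⟩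
  -- `z₀` is a lift over `X b`, but its images along the arrows that are not split monomorphisms
  -- need not be the prescribed ones.
  obtain ⟨z₀, h1, h2⟩ := exists_lift ((hq' b).hasLift j) a (v ≫ relFamBase q b _) (by
    rw [← relMatch_base, reassoc_of% sq.w])
  have hqa : a ≫ q.app b = j ≫ v ≫ relFamBase q b _ := by
    rw [← relMatch_base, reassoc_of% sq.w]
  have ha : ∀ ⦃e e'⦄ (g : e ⟶ e') (t : (nonSplit b).obj e),
      a ≫ P.map ((nonSplit b).map g t).1 = (a ≫ P.map t.1) ≫ P.map g := fun e e' g t => by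
    rw [Category.assoc, ← P.map_comp]; rfl
  have hz : ∀ ⦃e e'⦄ (g : e ⟶ e') (t : (nonSplit b).obj e),
      z₀ ≫ P.map ((nonSplit b).map g t).1 = (z₀ ≫ P.map t.1) ≫ P.map g := fun e e' g t => by
    rw [Category.assoc, ← P.map_comp]; rfl
  have hv : ∀ ⦃e e'⦄ (g : e ⟶ e') (t : (nonSplit b).obj e),
      v ≫ relFamBase q b _ ≫ X.map ((nonSplit b).map g t).1 =
        (v ≫ relFamBase q b _ ≫ X.map t.1) ≫ X.map g := fun e e' g t => by
    rw [Category.assoc, Category.assoc, ← X.map_comp]; rfl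
  let y : ∀ ⦃e⦄, (nonSplit b).obj e → (L ⟶ P.obj e) := fun e f => v ≫ relFamProj q b _ f.1 f.2
  have hy : ∀ ⦃e e'⦄ (g : e ⟶ e') (t : (nonSplit b).obj e),
      y ((nonSplit b).map g t) = y t ≫ P.map g := fun e e' g t => by
    simp only [y, Category.assoc]
    rw [relFamProj_map t.1 g t.2 ((nonSplit b).map g t).2]
    rfl
  have hjy : ∀ ⦃e⦄ (t : (nonSplit b).obj e), j ≫ y t = a ≫ P.map t.1 := fun e t => by
    simp only [y]
    rw [← reassoc_of% sq.w, relMatch_proj]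
  have hyq : ∀ ⦃e⦄ (t : (nonSplit b).obj e), y t ≫ q.app e = v ≫ relFamBase q b _ ≫ X.map t.1 :=
    fun e t => by simp only [y, Category.assoc, relFamProj_app]
  -- The generators of `nonSplit b` have degree less than that of `b`, so by induction the space of
  -- families over it maps to `X` by a trivial fibration. The family given by `z₀` and the
  -- prescribed family `y` agree on `K` and over `X`, hence are joined by a homotopy that is
  -- constant on `K` and over `X`.
  obtain ⟨H, H1, H2, H3, H4⟩ := exists_homotopy_lift j
    ((isTrivialFibration_familiesMap hdeg (isGeneratedBelow_nonSplit hdeg b)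
      (fun b' hb' => ih (deg b') (by rw [← hn]; exact_mod_cast hb') b' rfl)).hasLift
      (leibniz j endpointsι.{u}).ι)
    (fst _ _ ≫ familiesLift (fun e f => a ≫ P.map f.1) ha)
    (familiesLift (fun e f => z₀ ≫ P.map f.1) hz) (familiesLift y hy)
    (fst _ _ ≫ familiesLift (fun e f => v ≫ relFamBase q b _ ≫ X.map f.1) hv)
    (by
      rw [ι₀_fst_assoc]
      refine families_hom_ext fun e t => ?_
      simp only [Category.assoc, familiesLift_app, reassoc_of% h1])
    (by
      rw [ι₁_fst_assoc]
      refine families_hom_ext fun e t => ?_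
      simp only [Category.assoc, familiesLift_app, hjy])
    (by
      refine families_hom_ext fun e t => ?_
      simp only [Category.assoc, familiesLift_app, familiesMap_app, familiesLift_app_assoc,
        whiskerRight_fst_assoc, q.naturality, reassoc_of% hqa])
    (by
      rw [ι₀_fst_assoc]
      refine families_hom_ext fun e t => ?_
      simp only [Category.assoc, familiesLift_app, familiesMap_app, familiesLift_app_assoc,
        q.naturality, reassoc_of% h2])
    (by
      rw [ι₁_fst_assoc]
      refine families_hom_ext fun e t => ?_
      simp only [Category.assoc, familiesLift_app, familiesMap_app, familiesLift_app_assoc, hyq])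
  have hH : ∀ ⦃e⦄ (t : (nonSplit b).obj e), H ≫ familiesApp _ _ t ≫ q.app e =
      fst _ _ ≫ v ≫ relFamBase q b _ ≫ X.map t.1 := fun e t => by
    have := H4 =≫ familiesApp _ _ t
    simpa only [Category.assoc, familiesMap_app, familiesLift_app] using this
  -- Lifting this homotopy through the Kan fibration `relMatch`, starting at `z₀`, yields at its
  -- terminal end a lift with the prescribed values.
  obtain ⟨φ, e1, e2, e3⟩ := exists_homotopy_lift₀ j ((hq b).hasLift_leibniz j 1)
    (fst _ _ ≫ a) z₀ (relFamLift (q := q) (fst L Δ[1] ≫ v ≫ relFamBase q b _)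
      (fun e f hf => H ≫ familiesApp (nonSplit b) P ⟨f, hf⟩)
      (fun e e' f g hf hfg => by
        rw [Category.assoc]
        exact congr_arg (H ≫ ·)
          (familiesApp_map (F := nonSplit b) (X := P) g (⟨f, hf⟩ : (nonSplit b).obj e)))
      (fun e f hf => by
        simp only [Category.assoc]
        exact hH ⟨f, hf⟩))
    (by rw [ι₀_fst_assoc, h1]) (by
      apply relFam_hom_ext
      · simp only [Category.assoc, relMatch_base, hqa]
        rfl
      · intro e f hf
        have := H1 =≫ familiesApp _ _ (⟨f, hf⟩ : (nonSplit b).obj e)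
        simp only [Category.assoc, familiesLift_app] at this
        simp only [Category.assoc, relMatch_proj]
        exact this.symm) (by
      apply relFam_hom_ext
      · simp only [Category.assoc, relMatch_base, h2]
        rfl
      · intro e f hf
        have := H2 =≫ familiesApp _ _ (⟨f, hf⟩ : (nonSplit b).obj e)
        simp only [Category.assoc, familiesLift_app] at this
        simp only [Category.assoc, relMatch_proj]
        exact this.symm)
  refine ⟨⟨⟨ι₁ ≫ φ, ?_, ?_⟩⟩⟩
  · rw [← ι₁_comp_assoc, e1, ι₁_fst_assoc]
  · rw [Category.assoc, e3]
    apply relFam_hom_ext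
    · rfl
    · intro e f hf
      have := H3 =≫ familiesApp _ _ (⟨f, hf⟩ : (nonSplit b).obj e)
      simp only [Category.assoc, familiesLift_app] at this
      exact this

end FamilyLift

end

section


variable {E : Type} [SmallCategory E]

/-! ### Path objects of maps of diagrams -/

section Path

/-- The map to the path space corresponding to a homotopy. -/
def toPath {L Z : SSet.{u}} (H : L ⊗ Δ[1] ⟶ Z) : L ⟶ (ihom Δ[1]).obj Z :=
  MonoidalClosed.curry ((β_ _ _).hom ≫ H)

def fromPath {L Z : SSet.{u}} (φ : L ⟶ (ihom Δ[1]).obj Z) : L ⊗ Δ[1] ⟶ Z :=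
  (β_ _ _).hom ≫ MonoidalClosed.uncurry φ

lemma fromPath_toPath {L Z : SSet.{u}} (H : L ⊗ Δ[1] ⟶ Z) : fromPath (toPath H) = H := by
  simp [fromPath, toPath]

lemma toPath_fromPath {L Z : SSet.{u}} (φ : L ⟶ (ihom Δ[1]).obj Z) :
    toPath (fromPath φ) = φ := by
  simp [fromPath, toPath]

lemma fromPath_comp {K L Z : SSet.{u}} (j : K ⟶ L) (φ : L ⟶ (ihom Δ[1]).obj Z) :
    fromPath (j ≫ φ) = j ▷ _ ≫ fromPath φ := by
  simp [fromPath, MonoidalClosed.uncurry_natural_left]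

lemma fromPath_map {L Z Z' : SSet.{u}} (φ : L ⟶ (ihom Δ[1]).obj Z) (g : Z ⟶ Z') :
    fromPath (φ ≫ (ihom Δ[1]).map g) = fromPath φ ≫ g := by
  simp [fromPath, MonoidalClosed.uncurry_natural_right]

variable {X Y : E ⥤ SSet.{u}} (f : Y ⟶ X)

def pathStart (X : E ⥤ SSet.{u}) : X ⋙ ihom Δ[1] ⟶ X where
  app e := ι₀ ≫ fromPath (𝟙 _)
  naturality e e' g := by
    change (ihom Δ[1]).map (X.map g) ≫ _ = _
    rw [Category.assoc, ← fromPath_map, Category.id_comp, ← ι₀_comp_assoc, ← fromPath_comp]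
    exact congr_arg (fun φ => ι₀ ≫ fromPath φ) (Category.comp_id _)

def pathEnd (X : E ⥤ SSet.{u}) : X ⋙ ihom Δ[1] ⟶ X where
  app e := ι₁ ≫ fromPath (𝟙 _)
  naturality e e' g := by
    change (ihom Δ[1]).map (X.map g) ≫ _ = _
    rw [Category.assoc, ← fromPath_map, Category.id_comp, ← ι₁_comp_assoc, ← fromPath_comp]
    exact congr_arg (fun φ => ι₁ ≫ fromPath φ) (Category.comp_id _)

lemma comp_pathStart_app {L : SSet.{u}} {e : E} (φ : L ⟶ (ihom Δ[1]).obj (X.obj e)) :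
    φ ≫ (pathStart X).app e = ι₀ ≫ fromPath φ := by
  change φ ≫ ι₀ ≫ fromPath (𝟙 _) = _
  rw [← ι₀_comp_assoc, ← fromPath_comp, Category.comp_id]

lemma comp_pathEnd_app {L : SSet.{u}} {e : E} (φ : L ⟶ (ihom Δ[1]).obj (X.obj e)) :
    φ ≫ (pathEnd X).app e = ι₁ ≫ fromPath φ := by
  change φ ≫ ι₁ ≫ fromPath (𝟙 _) = _
  rw [← ι₁_comp_assoc, ← fromPath_comp, Category.comp_id]

/-- The mapping path object. -/
def mappingPath : E ⥤ SSet.{u} := pullback f (pathStart X)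

namespace mappingPath

def fst : mappingPath f ⟶ Y := pullback.fst _ _

def snd : mappingPath f ⟶ X ⋙ ihom Δ[1] := pullback.snd _ _

def endpoint : mappingPath f ⟶ X := snd f ≫ pathEnd X

variable {f} {K L : SSet.{u}} {e e' : E}

/-- The homotopy given by a map to the mapping path object. -/
def homotopy (φ : L ⟶ (mappingPath f).obj e) : L ⊗ Δ[1] ⟶ X.obj e := fromPath (φ ≫ (snd f).app e)

lemma ι₀_homotopy (φ : L ⟶ (mappingPath f).obj e) :
    ι₀ ≫ homotopy φ = φ ≫ (fst f).app e ≫ f.app e := by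
  rw [homotopy, ← comp_pathStart_app, Category.assoc, ← NatTrans.comp_app, ← NatTrans.comp_app]
  exact congr_arg (fun h => φ ≫ NatTrans.app h e) pullback.condition.symm

lemma ι₁_homotopy (φ : L ⟶ (mappingPath f).obj e) :
    ι₁ ≫ homotopy φ = φ ≫ (endpoint f).app e := by
  rw [homotopy, ← comp_pathEnd_app, Category.assoc]
  rfl

lemma homotopy_comp (j : K ⟶ L) (φ : L ⟶ (mappingPath f).obj e) :
    homotopy (j ≫ φ) = j ▷ _ ≫ homotopy φ := by
  rw [homotopy, Category.assoc, fromPath_comp, homotopy]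

lemma homotopy_map (φ : L ⟶ (mappingPath f).obj e) (g : e ⟶ e') :
    homotopy (φ ≫ (mappingPath f).map g) = homotopy φ ≫ X.map g := by
  rw [homotopy, homotopy, Category.assoc, (snd f).naturality, ← fromPath_map, Category.assoc]
  rfl

lemma isPullback_app (e : E) : IsPullback ((fst f).app e) ((snd f).app e) (f.app e)
    ((pathStart X).app e) :=
  (IsPullback.of_hasPullback f (pathStart X)).map ((evaluation E SSet.{u}).obj e)

lemma hom_ext {φ φ' : L ⟶ (mappingPath f).obj e} (h : φ ≫ (fst f).app e = φ' ≫ (fst f).app e)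
    (h' : homotopy φ = homotopy φ') : φ = φ' := by
  refine (isPullback_app e).hom_ext h ?_
  rw [← toPath_fromPath (φ ≫ _), ← toPath_fromPath (φ' ≫ _)]
  exact congr_arg toPath h'

def lift (y : L ⟶ Y.obj e) (H : L ⊗ Δ[1] ⟶ X.obj e) (h : ι₀ ≫ H = y ≫ f.app e) :
    L ⟶ (mappingPath f).obj e :=
  (isPullback_app e).lift y (toPath H) (by rw [comp_pathStart_app, fromPath_toPath, h])

lemma lift_fst (y : L ⟶ Y.obj e) (H : L ⊗ Δ[1] ⟶ X.obj e) (h : ι₀ ≫ H = y ≫ f.app e) :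
    lift y H h ≫ (fst f).app e = y := (isPullback_app e).lift_fst _ _ _

lemma homotopy_lift (y : L ⟶ Y.obj e) (H : L ⊗ Δ[1] ⟶ X.obj e) (h : ι₀ ≫ H = y ≫ f.app e) :
    homotopy (lift y H h) = H := by
  rw [homotopy, lift, (isPullback_app e).lift_snd, fromPath_toPath]

variable {b : E} {S : ∀ ⦃e : E⦄, (b ⟶ e) → Prop}

/-- The map to an absolute matching object with given components. -/
def absLift (y : ∀ ⦃e : E⦄ (g : b ⟶ e), S g → (L ⟶ X.obj e))
    (hy : ∀ ⦃e e' : E⦄ (g : b ⟶ e) (h : e ⟶ e') (hg : S g) (hgh : S (g ≫ h)),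
      y g hg ≫ X.map h = y (g ≫ h) hgh) : L ⟶ relFam (terminal.from X) b S :=
  relFamLift ((terminal.from ((Functor.const E).obj L)).app b) y hy
    (fun e g hg => by
      have h₁ : ∀ {Z : SSet.{u}} (a a' : Z ⟶ (⊤_ (E ⥤ SSet.{u})).obj e), a = a' := fun a a' =>
        (IsTerminal.isTerminalObj ((evaluation E SSet.{u}).obj e) _ terminalIsTerminal).hom_ext a a'
      exact h₁ _ _)

lemma abs_hom_ext {φ φ' : L ⟶ relFam (terminal.from X) b S}
    (h : ∀ ⦃e : E⦄ (g : b ⟶ e) (hg : S g),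
      φ ≫ relFamProj _ b S g hg = φ' ≫ relFamProj _ b S g hg) : φ = φ' :=
  relFam_hom_ext ((IsTerminal.isTerminalObj ((evaluation E SSet.{u}).obj b) _
    terminalIsTerminal).hom_ext _ _) h

lemma absLift_proj (y : ∀ ⦃e : E⦄ (g : b ⟶ e), S g → (L ⟶ X.obj e))
    (hy : ∀ ⦃e e' : E⦄ (g : b ⟶ e) (h : e ⟶ e') (hg : S g) (hgh : S (g ≫ h)),
      y g hg ≫ X.map h = y (g ≫ h) hgh) ⦃e : E⦄ (g : b ⟶ e) (hg : S g) :
    absLift y hy ≫ relFamProj _ b S g hg = y g hg := rfl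

/-- A point of the mapping path object is a point of `Y` and a path in `X` starting at its image.
The former is prescribed by the square; the path extends because a Kan fibration lifts homotopies
with prescribed initial end. -/
theorem isTrivialFibration_relMatch_fst (hX : IsKanFibration (relMatch (terminal.from X) b S)) :
    IsTrivialFibration (relMatch (fst f) b S) := by
  refine isTrivialFibration_of_hasLift fun {K L} j _ => ⟨fun {a v} sq => ?_⟩
  have w : a ≫ (fst f).app b = j ≫ v ≫ relFamBase _ b S := by
    rw [← reassoc_of% sq.w, relMatch_base]
  obtain ⟨H, H1, H2, H3⟩ := exists_homotopy_lift₀ j (hX.hasLift_leibniz j 1)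
    (homotopy a) (v ≫ relFamBase _ b S ≫ f.app b)
    (absLift (fun e g hg => homotopy (v ≫ relFamProj _ b S g hg))
      (fun e e' g h hg hgh => by
        rw [← homotopy_map, Category.assoc, relFamProj_map g h hg hgh]))
    (by rw [ι₀_homotopy, reassoc_of% w]) (by
      refine abs_hom_ext fun e g hg => ?_
      rw [Category.assoc, Category.assoc, absLift_proj, relMatch_proj, ← homotopy_map,
        ← homotopy_comp, ← reassoc_of% sq.w, relMatch_proj]) (by
      refine abs_hom_ext fun e g hg => ?_
      simp only [Category.assoc, absLift_proj, relMatch_proj, ι₀_homotopy]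
      rw [← f.naturality, reassoc_of% (relFamProj_app (q := fst f) g hg)])
  refine ⟨⟨⟨lift (v ≫ relFamBase _ b S) H (by rw [H2, Category.assoc]), ?_, ?_⟩⟩⟩
  · apply hom_ext
    · rw [Category.assoc, lift_fst, w]
    · rw [homotopy_comp, homotopy_lift, H1]
  · apply relFam_hom_ext
    · rw [Category.assoc, relMatch_base, lift_fst]
    · intro e g hg
      rw [Category.assoc, relMatch_proj]
      apply hom_ext
      · rw [Category.assoc, (fst f).naturality, ← Category.assoc, lift_fst, Category.assoc,
          Category.assoc, relFamProj_app]
      · rw [homotopy_map, homotopy_lift]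
        have := H3 =≫ relFamProj _ b S g hg
        rwa [Category.assoc, relMatch_proj] at this

/-- The component in `Y` is lifted first, by fibrancy of `Y`. Then both ends of the path are known,
the initial one from `Y` and the terminal one from the base, and the path exists because the
pushout-product of a horn with the end points of `Δ[1]` is anodyne. -/
theorem isKanFibration_relMatch_endpoint (hX : IsKanFibration (relMatch (terminal.from X) b S))
    (hY : IsKanFibration (relMatch (terminal.from Y) b S)) :
    IsKanFibration (relMatch (endpoint f) b S) := by
  intro K L j hj
  have : Mono j := modelCategoryQuillen.J_le_monomorphisms _ hj
  refine ⟨fun {a v} sq => ?_⟩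
  have w : a ≫ (endpoint f).app b = j ≫ v ≫ relFamBase _ b S := by
    rw [← reassoc_of% sq.w, relMatch_base]
  obtain ⟨y, y1, y2⟩ := exists_lift (hY j hj) (a ≫ (fst f).app b)
    (absLift (fun e g hg => v ≫ relFamProj _ b S g hg ≫ (fst f).app e)
      (fun e e' g h hg hgh => by
        rw [Category.assoc, Category.assoc, ← (fst f).naturality,
          ← relFamProj_map g h hg hgh, Category.assoc]))
    (by
      refine abs_hom_ext fun e g hg => ?_
      rw [Category.assoc, Category.assoc, Category.assoc, absLift_proj, relMatch_proj,
        ← (fst f).naturality, ← reassoc_of% sq.w, reassoc_of% (relMatch_proj (q := endpoint f) g hg)])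
  have hy : ∀ ⦃e : E⦄ (g : b ⟶ e) (hg : S g),
      y ≫ Y.map g = v ≫ relFamProj _ b S g hg ≫ (fst f).app e := fun e g hg => by
    have := y2 =≫ relFamProj _ b S g hg
    rwa [Category.assoc, relMatch_proj] at this
  obtain ⟨H, H1, H2, H3, H4⟩ := exists_homotopy_lift j
    (hX.hasLift (anodyneExtensions_pushoutObjObjι' (leibniz j endpointsι)
      (MorphismProperty.le_llp_rlp _ _ hj)))
    (homotopy a) (y ≫ f.app b) (v ≫ relFamBase _ b S)
    (absLift (fun e g hg => homotopy (v ≫ relFamProj _ b S g hg))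
      (fun e e' g h hg hgh => by
        rw [← homotopy_map, Category.assoc, relFamProj_map g h hg hgh]))
    (by rw [ι₀_homotopy, reassoc_of% y1]) (by rw [ι₁_homotopy, w]) (by
      refine abs_hom_ext fun e g hg => ?_
      rw [Category.assoc, Category.assoc, absLift_proj, relMatch_proj, ← homotopy_map,
        ← homotopy_comp, ← reassoc_of% sq.w, relMatch_proj]) (by
      refine abs_hom_ext fun e g hg => ?_
      simp only [Category.assoc, absLift_proj, relMatch_proj, ι₀_homotopy]
      rw [← f.naturality, reassoc_of% (hy g hg)]) (by
      refine abs_hom_ext fun e g hg => ?_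
      simp only [Category.assoc, absLift_proj, relMatch_proj, ι₁_homotopy, relFamProj_app])
  refine ⟨⟨⟨lift y H H2, ?_, ?_⟩⟩⟩
  · apply hom_ext
    · rw [Category.assoc, lift_fst, y1]
    · rw [homotopy_comp, homotopy_lift, H1]
  · apply relFam_hom_ext
    · rw [Category.assoc, relMatch_base, ← ι₁_homotopy, homotopy_lift, H3]
    · intro e g hg
      rw [Category.assoc, relMatch_proj]
      apply hom_ext
      · rw [Category.assoc, (fst f).naturality, ← Category.assoc, lift_fst, hy g hg, Category.assoc]
      · rw [homotopy_map, homotopy_lift]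
        have := H4 =≫ relFamProj _ b S g hg
        rwa [Category.assoc, relMatch_proj] at this

end mappingPath

end Path

end

/-! ### Mapping path objects of objectwise fibrant diagrams -/

section


variable {E : Type} [SmallCategory E]

lemma isKanFibration_terminal_app_iff (X : E ⥤ SSet.{u}) (b : E) :
    IsKanFibration ((terminal.from X).app b) ↔ KanComplex (X.obj b) := by
  have hT : IsTerminal ((⊤_ (E ⥤ SSet.{u})).obj b) :=
    IsTerminal.isTerminalObj ((evaluation E SSet.{u}).obj b) _ terminalIsTerminal
  rw [kanComplex_iff]
  exact modelCategoryQuillen.J.{u}.rlp.arrow_mk_iso_iff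
    (Arrow.isoMk (Iso.refl _) (hT.uniqueUpToIso terminalIsTerminal) (terminalIsTerminal.hom_ext _ _))

lemma isIso_relFamBase {P X : E ⥤ SSet.{u}} (q : P ⟶ X) (b : E) :
    IsIso (relFamBase q b (fun _ _ => False)) := by
  refine ⟨relFamLift (𝟙 _) (fun _ _ h => h.elim) (fun _ _ _ _ h => h.elim) (fun _ _ h => h.elim),
    ?_, rfl⟩
  exact relFam_hom_ext rfl (fun _ _ h => h.elim)

/-- The relative matching map for the empty family of arrows. -/
def relMatchBotIso {P X : E ⥤ SSet.{u}} (q : P ⟶ X) (b : E) :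
    Arrow.mk (relMatch q b (fun _ _ => False)) ≅ Arrow.mk (q.app b) :=
  have := isIso_relFamBase q b
  Arrow.isoMk (Iso.refl _) (asIso (relFamBase q b _)) (by
    change 𝟙 _ ≫ q.app b = relMatch _ _ _ ≫ relFamBase q b _
    rw [Category.id_comp, relMatch_base])

namespace mappingPath

variable {X Y : E ⥤ SSet.{u}} {f : Y ⟶ X}

/-- This is the relative statement for the empty family of arrows, where the matching map is the map
itself. -/
lemma isTrivialFibration_fst_app {b : E} (hX : KanComplex (X.obj b)) :
    IsTrivialFibration ((fst f).app b) := by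
  have := isTrivialFibration_relMatch_fst (f := f) (b := b) (S := fun _ _ => False)
    ((modelCategoryQuillen.J.{u}.rlp.arrow_mk_iso_iff (relMatchBotIso _ _)).2
      ((isKanFibration_terminal_app_iff X b).2 hX))
  exact (modelCategoryQuillen.I.{u}.rlp.arrow_mk_iso_iff (relMatchBotIso _ _)).1 this

/-- The constant paths give a section of the first projection, whose composite with the end point
map is `f`. Two out of three makes the end point map a weak equivalence, and it is a Kan fibration
by the case of the empty family. -/
lemma isTrivialFibration_endpoint_app {b : E} (hX : KanComplex (X.obj b)) (hY : KanComplex (Y.obj b))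
    (hf : IsWeakEquiv (f.app b)) : IsTrivialFibration ((endpoint f).app b) := by
  have h := isKanFibration_relMatch_endpoint (f := f) (b := b) (S := fun _ _ => False)
    ((modelCategoryQuillen.J.{u}.rlp.arrow_mk_iso_iff (relMatchBotIso _ _)).2
      ((isKanFibration_terminal_app_iff X b).2 hX))
    ((modelCategoryQuillen.J.{u}.rlp.arrow_mk_iso_iff (relMatchBotIso _ _)).2
      ((isKanFibration_terminal_app_iff Y b).2 hY))
  have h1 := isTrivialFibration_fst_app (f := f) hX
  refine IsKanFibration.isTrivialFibration
    ((modelCategoryQuillen.J.{u}.rlp.arrow_mk_iso_iff (relMatchBotIso _ _)).1 h)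
    (KanComplex.of_fibration h1.isKanFibration hY) hX ?_
  have hs : lift (f := f) (𝟙 (Y.obj b)) (CartesianMonoidalCategory.fst _ _ ≫ f.app b)
      (by rw [ι₀_fst_assoc, Category.id_comp]) ≫ (fst f).app b = 𝟙 _ := lift_fst _ _ _
  have hs' : lift (f := f) (𝟙 (Y.obj b)) (CartesianMonoidalCategory.fst _ _ ≫ f.app b)
      (by rw [ι₀_fst_assoc, Category.id_comp]) ≫ (endpoint f).app b = f.app b := by
    rw [← ι₁_homotopy, homotopy_lift, ι₁_fst_assoc]
  refine IsWeakEquiv.of_comp_left (f := lift (f := f) (𝟙 (Y.obj b))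
    (CartesianMonoidalCategory.fst _ _ ≫ f.app b)
      (by rw [ι₀_fst_assoc, Category.id_comp])) ?_ (by rwa [hs'])
  exact IsWeakEquiv.of_comp_right h1.isWeakEquiv (by rw [hs]; exact .of_isIso _)

end mappingPath

end

section


/-! ### Chains in over-categories -/

section Chains

variable {C : Type} [SmallCategory C]

/-- Functors to an over-category with the same underlying diagram differ only in their structure
maps, so equality can be tested without transport along equalities of objects. -/
lemma over_functor_ext {J : Type} [Category* J] {c : C} {F : J ⥤ C}
    {X Y : ∀ i, F.obj i ⟶ c} (hX : ∀ {i i'} (f : i ⟶ i'), F.map f ≫ X i' = X i)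
    (hY : ∀ {i i'} (f : i ⟶ i'), F.map f ≫ Y i' = Y i) (h : ∀ i, X i = Y i)
    {G H : J ⥤ Over c} (hG : G = F.toOver c X hX) (hH : H = F.toOver c Y hY) : G = H := by
  obtain rfl : X = Y := funext h
  rw [hG, hH]

/-- The chain in the over-category given by a chain and a map from its last object. -/
def overFunctor {m : ℕ} (F : Fin (m + 1) ⥤ C) {c : C} (h : F.obj (Fin.last m) ⟶ c) :
    Fin (m + 1) ⥤ Over c where
  obj i := Over.mk (F.map (homOfLE (Fin.le_last i)) ≫ h)
  map {i i'} f := Over.homMk (F.map f) (by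
    dsimp
    rw [← Category.assoc, ← F.map_comp]
    rfl)

lemma overFunctor_whiskerLeft {m m' : ℕ} (F : Fin (m + 1) ⥤ C) {c : C}
    (h : F.obj (Fin.last m) ⟶ c) (θ : Fin (m' + 1) ⥤ Fin (m + 1)) :
    θ ⋙ overFunctor F h =
      overFunctor (θ ⋙ F) (F.map (homOfLE (Fin.le_last (θ.obj (Fin.last _)))) ≫ h) := by
  refine over_functor_ext (F := θ ⋙ F) (X := fun i => ((θ ⋙ overFunctor F h).obj i).hom)
    (Y := fun i => ((overFunctor (θ ⋙ F)
      (F.map (homOfLE (Fin.le_last (θ.obj (Fin.last _)))) ≫ h)).obj i).hom)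
    (fun f => Over.w ((θ ⋙ overFunctor F h).map f))
    (fun f => Over.w ((overFunctor (θ ⋙ F) _).map f)) (fun i => ?_) rfl rfl
  dsimp [overFunctor]
  rw [← Category.assoc, ← F.map_comp]
  rfl

lemma overFunctor_postcomp {m : ℕ} (F : Fin (m + 1) ⥤ C) {c c' : C}
    (h : F.obj (Fin.last m) ⟶ c) (g : c ⟶ c') :
    overFunctor F h ⋙ Over.map g = overFunctor F (h ≫ g) := by
  exact over_functor_ext (F := F) (X := fun i => ((overFunctor F h ⋙ Over.map g).obj i).hom)
    (Y := fun i => ((overFunctor F (h ≫ g)).obj i).hom)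
    (fun f => Over.w ((overFunctor F h ⋙ Over.map g).map f))
    (fun f => Over.w ((overFunctor F (h ≫ g)).map f))
    (fun i => Category.assoc _ _ _) rfl rfl

lemma overFunctor_forget {m : ℕ} {c : C} (F : Fin (m + 1) ⥤ Over c) :
    overFunctor (F ⋙ Over.forget c) (F.obj (Fin.last m)).hom = F := by
  exact over_functor_ext (F := F ⋙ Over.forget c)
    (X := fun i => ((overFunctor (F ⋙ Over.forget c) (F.obj (Fin.last m)).hom).obj i).hom)
    (Y := fun i => (F.obj i).hom)
    (fun f => Over.w ((overFunctor (F ⋙ Over.forget c) _).map f))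
    (fun f => Over.w (F.map f)) (fun i => Over.w (F.map _)) rfl rfl

variable {k l : SimplexCategoryᵒᵖ}

/-- The last object of a chain. -/
def chainLast (σ : (nerve C).obj k) : C := ComposableArrows.right (n := k.unop.len) σ

def chainLastHom (θ : k ⟶ l) (σ : (nerve C).obj k) :
    chainLast ((nerve C).map θ σ) ⟶ chainLast σ :=
  CategoryTheory.Functor.map (C := Fin (k.unop.len + 1)) σ (homOfLE (Fin.le_last _))

lemma chainLastHom_id (σ : (nerve C).obj k) : chainLastHom (𝟙 k) σ = 𝟙 (chainLast σ) :=
  CategoryTheory.Functor.map_id (C := Fin (k.unop.len + 1)) σ _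

lemma chainLastHom_comp {m : SimplexCategoryᵒᵖ} (θ : k ⟶ l) (η : l ⟶ m) (σ : (nerve C).obj k) :
    chainLastHom (θ ≫ η) σ = chainLastHom η ((nerve C).map θ σ) ≫ chainLastHom θ σ :=
  CategoryTheory.Functor.map_comp (C := Fin (k.unop.len + 1)) σ (homOfLE _) (homOfLE _)

/-- A simplex of the nerve of an over-category, given by a chain and a map from its last
object. -/
def overSimplex {c : C} (σ : (nerve C).obj k) (h : chainLast σ ⟶ c) :
    ((overNerve.{u} C).obj c).obj k :=
  ⟨overFunctor (m := k.unop.len) σ h⟩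

lemma overSimplex_map {c : C} (θ : k ⟶ l) (σ : (nerve C).obj k) (h : chainLast σ ⟶ c) :
    ((overNerve.{u} C).obj c).map θ (overSimplex σ h) =
      overSimplex ((nerve C).map θ σ) (chainLastHom θ σ ≫ h) :=
  congr_arg ULift.up (overFunctor_whiskerLeft _ _ _)

lemma overSimplex_postcomp {c c' : C} (σ : (nerve C).obj k) (h : chainLast σ ⟶ c) (g : c ⟶ c') :
    ((overNerve.{u} C).map g).app k (overSimplex σ h) = overSimplex σ (h ≫ g) :=
  congr_arg ULift.up (overFunctor_postcomp _ _ _)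

/-- The chain underlying a chain in an over-category. -/
def underChain {c : C} (τ : ((overNerve.{u} C).obj c).obj k) : (nerve C).obj k :=
  (nerveMap (Over.forget c)).app k τ.down

def underChainHom {c : C} (τ : ((overNerve.{u} C).obj c).obj k) : chainLast (underChain τ) ⟶ c :=
  (chainLast τ.down).hom

lemma overSimplex_underChain {c : C} (τ : ((overNerve.{u} C).obj c).obj k) :
    overSimplex (underChain τ) (underChainHom τ) = τ :=
  congr_arg ULift.up (overFunctor_forget _)

lemma underChainHom_map {c : C} (θ : k ⟶ l) (τ : ((overNerve.{u} C).obj c).obj k) :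
    underChainHom (((overNerve.{u} C).obj c).map θ τ) =
      chainLastHom θ (underChain τ) ≫ underChainHom τ :=
  (Over.w (chainLastHom θ τ.down)).symm

/-! ### Compatible families over a chain -/

/-- The compatible families of simplices of `P`, one for each face of a chain. -/
def ChainSections (P : C ⥤ SSet.{u}) (σ : (nerve C).obj k) : Type u :=
  { p : ∀ ⦃l : SimplexCategoryᵒᵖ⦄ (θ : k ⟶ l), (P.obj (chainLast ((nerve C).map θ σ))).obj l //
    ∀ ⦃l l' : SimplexCategoryᵒᵖ⦄ (θ : k ⟶ l) (η : l ⟶ l'),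
      (P.map (chainLastHom η ((nerve C).map θ σ))).app l' (p (θ ≫ η)) =
        (P.obj (chainLast ((nerve C).map θ σ))).map η (p θ) }

/-- The simplicial set over the nerve of `C` whose simplices are the chains with a compatible
family. -/
def totalSpace (P : C ⥤ SSet.{u}) : SSet.{u} where
  obj k := Σ σ : (nerve C).obj k, ChainSections P σ
  map {k k'} θ := ↾fun p => ⟨(nerve C).map θ p.1, ⟨fun l η => p.2.1 (θ ≫ η),
    fun l l' η ζ => p.2.2 (θ ≫ η) ζ⟩⟩
  map_id k := by
    refine ConcreteCategory.hom_ext _ _ fun p => ?_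
    obtain ⟨σ, p, hp⟩ := p
    refine Sigma.ext rfl (heq_of_eq (Subtype.ext ?_))
    funext l θ
    -- The type of `p θ` depends on `θ`, so the values are first compared heterogeneously; the two
    -- types agree definitionally.
    have : ∀ θ' (_ : θ' = θ), HEq (p θ') (p θ) := by
      rintro _ rfl
      rfl
    exact eq_of_heq (this _ (Category.id_comp θ))
  map_comp f g := by
    refine ConcreteCategory.hom_ext _ _ fun p => ?_
    obtain ⟨σ, p, hp⟩ := p
    refine Sigma.ext rfl (heq_of_eq (Subtype.ext ?_))
    funext l θ
    have : ∀ θ' (_ : θ' = f ≫ g ≫ θ), HEq (p θ') (p (f ≫ g ≫ θ)) := by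
      rintro _ rfl
      rfl
    exact eq_of_heq (this _ (Category.assoc f g θ))

/-- The chain underlying a simplex of the total space. -/
def totalChain {P : C ⥤ SSet.{u}} (t : (totalSpace P).obj k) : (nerve C).obj k := Sigma.fst t

def totalFamily {P : C ⥤ SSet.{u}} (t : (totalSpace P).obj k) :
    ChainSections P (totalChain t) := Sigma.snd t

variable {P X : C ⥤ SSet.{u}}

def ChainSections.map (q : P ⟶ X) {σ : (nerve C).obj k} (p : ChainSections P σ) :
    ChainSections X σ :=
  ⟨fun l θ => (q.app _).app l (p.1 θ), fun l l' θ η => by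
    rw [← NatTrans.naturality_apply, ← p.2]
    exact (ConcreteCategory.congr_hom (NatTrans.congr_app (q.naturality _) l') _).symm⟩

def totalSpaceMap (q : P ⟶ X) : totalSpace P ⟶ totalSpace X where
  app k := ↾fun p => (⟨totalChain p, (totalFamily p).map q⟩ : Σ σ : (nerve C).obj k, ChainSections X σ)
  naturality k k' θ := rfl

/-- The value of a compatible family at the chain itself. -/
def totalValue (t : (totalSpace P).obj k) (σ : (nerve C).obj k) (h : totalChain t = σ) :
    (P.obj (chainLast σ)).obj k :=
  (P.map (eqToHom (by subst h; rfl))).app k ((totalFamily t).1 (𝟙 k))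

lemma totalValue_rfl (t : (totalSpace P).obj k) : totalValue t (totalChain t) rfl = (totalFamily t).1 (𝟙 k) := by
  exact (ConcreteCategory.congr_hom (NatTrans.congr_app (P.map_id _) k) _)

lemma totalValue_map (t : (totalSpace P).obj k) (σ : (nerve C).obj k) (h : totalChain t = σ) (θ : k ⟶ l)
    (h' : totalChain ((totalSpace P).map θ t) = (nerve C).map θ σ) :
    (P.map (chainLastHom θ σ)).app l (totalValue ((totalSpace P).map θ t) _ h') =
      (P.obj (chainLast σ)).map θ (totalValue t σ h) := by
  subst h
  rw [totalValue_rfl]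
  erw [totalValue_rfl ((totalSpace P).map θ t)]
  exact (totalFamily t).2 (𝟙 k) θ

lemma totalValue_totalSpaceMap (q : P ⟶ X) (t : (totalSpace P).obj k) (σ : (nerve C).obj k)
    (h : totalChain t = σ) (h' : totalChain ((totalSpaceMap q).app k t) = σ) :
    totalValue ((totalSpaceMap q).app k t) σ h' = (q.app _).app k (totalValue t σ h) := by
  subst h
  rw [totalValue_rfl]
  erw [totalValue_rfl ((totalSpaceMap q).app k t)]
  rfl

end Chains

end

/-! ### Trivial fibrations between total spaces -/

section


section Chains

variable {C : Type} [SmallCategory C] {k l : SimplexCategoryᵒᵖ} {P X : C ⥤ SSet.{u}}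

lemma totalChain_map (t : (totalSpace P).obj k) (θ : k ⟶ l) :
    totalChain ((totalSpace P).map θ t) = (nerve C).map θ (totalChain t) := rfl

lemma totalChain_totalSpaceMap (q : P ⟶ X) (t : (totalSpace P).obj k) :
    totalChain ((totalSpaceMap q).app k t) = totalChain t := rfl

/-- Construct a simplex of the total space from its values. -/
def totalMk (σ : (nerve C).obj k) (p : ChainSections P σ) : (totalSpace P).obj k :=
  (⟨σ, p⟩ : Σ σ : (nerve C).obj k, ChainSections P σ)

lemma totalValue_map_mk (σ : (nerve C).obj k) (p : ChainSections P σ) (θ : k ⟶ l)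
    (h : totalChain ((totalSpace P).map θ (totalMk σ p)) = (nerve C).map θ σ) :
    totalValue ((totalSpace P).map θ (totalMk σ p)) ((nerve C).map θ σ) h = p.1 θ := by
  erw [totalValue_rfl ((totalSpace P).map θ (totalMk σ p))]
  have : ∀ θ' (_ : θ' = θ), HEq (p.1 θ') (p.1 θ) := by
    rintro _ rfl
    rfl
  exact eq_of_heq (this _ (Category.comp_id θ))

lemma totalValue_mk (σ : (nerve C).obj k) (p : ChainSections P σ)
    (h : totalChain (totalMk σ p) = σ) :
    totalValue (totalMk σ p) σ h = p.1 (𝟙 k) :=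
  totalValue_rfl (totalMk σ p)

lemma total_ext (t : (totalSpace P).obj k) (σ : (nerve C).obj k) (p : ChainSections P σ)
    (h : totalChain t = σ) (h' : ∀ ⦃l : SimplexCategoryᵒᵖ⦄ (θ : k ⟶ l),
      totalValue ((totalSpace P).map θ t) ((nerve C).map θ σ)
        ((totalChain_map t θ).trans (congr_arg _ h)) = p.1 θ) :
    t = totalMk σ p := by
  subst h
  refine Sigma.ext rfl (heq_of_eq (Subtype.ext ?_))
  funext l θ
  exact (totalValue_map_mk (totalChain t) (totalFamily t) θ rfl).symm.trans (h' θ)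

lemma totalValue_congr {t t' : (totalSpace P).obj k} (h : t = t') (σ : (nerve C).obj k)
    (ht : totalChain t = σ) (ht' : totalChain t' = σ) : totalValue t σ ht = totalValue t' σ ht' := by
  subst h
  rfl

lemma total_eq_map_mk (t : (totalSpace P).obj l) (σ : (nerve C).obj k) (p : ChainSections P σ)
    (θ : k ⟶ l) (h : totalChain t = (nerve C).map θ σ)
    (h' : ∀ ⦃l' : SimplexCategoryᵒᵖ⦄ (η : l ⟶ l'),
      totalValue ((totalSpace P).map η t) ((nerve C).map (θ ≫ η) σ)
        ((totalChain_map t η).trans (congr_arg _ h)) = p.1 (θ ≫ η)) :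
    t = (totalSpace P).map θ (totalMk σ p) :=
  total_ext t ((nerve C).map θ σ) ⟨fun _ η => p.1 (θ ≫ η), fun _ _ η ζ => p.2 (θ ≫ η) ζ⟩ h h'

/-- A surjective monotone map reaches the last vertex, so the inequality underlying `chainLastHom`
also holds in the other direction. -/
lemma isIso_chainLastHom (θ : k ⟶ l) (σ : (nerve C).obj k)
    (h : Function.Surjective θ.unop.toOrderHom) : IsIso (chainLastHom θ σ) := by
  have hlast : Fin.last k.unop.len ≤ θ.unop.toOrderHom (Fin.last _) := by
    obtain ⟨i, hi⟩ := h (Fin.last _)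
    rw [← hi]
    exact θ.unop.toOrderHom.monotone (Fin.le_last i)
  refine ⟨CategoryTheory.Functor.map (C := Fin (k.unop.len + 1)) σ (homOfLE hlast), ?_, ?_⟩
  · exact (CategoryTheory.Functor.map_comp (C := Fin (k.unop.len + 1)) σ (homOfLE _)
      (homOfLE _)).symm.trans (CategoryTheory.Functor.map_id (C := Fin (k.unop.len + 1)) σ _)
  · exact (CategoryTheory.Functor.map_comp (C := Fin (k.unop.len + 1)) σ (homOfLE _)
      (homOfLE _)).symm.trans (CategoryTheory.Functor.map_id (C := Fin (k.unop.len + 1)) σ _)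

lemma map_injective_of_isIso (P : C ⥤ SSet.{u}) {c c' : C} (f : c ⟶ c') [IsIso f]
    (l : SimplexCategoryᵒᵖ) : Function.Injective ((P.map f).app l) := by
  intro a b h
  have := congr_arg ((P.map (inv f)).app l) h
  have e : P.map f ≫ P.map (inv f) = 𝟙 _ := by rw [← P.map_comp, IsIso.hom_inv_id, P.map_id]
  have e' := fun x => ConcreteCategory.congr_hom (NatTrans.congr_app e l) x
  exact (e' a).symm.trans (this.trans (e' b))

lemma map_chainLastHom_comp (P : C ⥤ SSet.{u}) {m : SimplexCategoryᵒᵖ} (θ : k ⟶ l) (η : l ⟶ m)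
    (σ : (nerve C).obj k) (r : SimplexCategoryᵒᵖ)
    (y : (P.obj (chainLast ((nerve C).map (θ ≫ η) σ))).obj r) :
    (P.map (chainLastHom (θ ≫ η) σ)).app r y = (P.map (chainLastHom θ σ)).app r
      ((P.map (chainLastHom η ((nerve C).map θ σ))).app r y) := by
  rw [chainLastHom_comp]
  exact ConcreteCategory.congr_hom (NatTrans.congr_app (P.map_comp _ _) r) y

lemma totalValue_app_map {K : SSet.{u}} (f : K ⟶ totalSpace P) (s : K.obj k) (η : k ⟶ l)
    (σ : (nerve C).obj k) (h : totalChain (f.app k s) = σ)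
    (h' : totalChain (f.app l (K.map η s)) = (nerve C).map η σ) :
    (P.map (chainLastHom η σ)).app l (totalValue (f.app l (K.map η s)) _ h') =
      (P.obj (chainLast σ)).map η (totalValue (f.app k s) σ h) := by
  have h'' : totalChain ((totalSpace P).map η (f.app k s)) = (nerve C).map η σ :=
    (totalChain_map _ _).trans (congr_arg _ h)
  rw [← totalValue_map _ σ h η h'', totalValue_congr (NatTrans.naturality_apply f η s) _ h' h'']

/-- The map `l ⟶ m` given by a simplex of the boundary. -/
def boundaryArrow {m : ℕ} (s : (∂Δ[m] : SSet.{u}).obj l) : op ⦋m⦌ ⟶ l :=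
  (stdSimplex.objEquiv s.1).op

lemma boundaryArrow_map {m : ℕ} (s : (∂Δ[m] : SSet.{u}).obj k) (η : k ⟶ l) :
    boundaryArrow ((∂Δ[m] : SSet.{u}).map η s) = boundaryArrow s ≫ η := rfl

set_option maxHeartbeats 1600000 in
lemma ι_yonedaEquiv_symm_app {Y : SSet.{u}} {m : ℕ} (y : Y.obj (op ⦋m⦌))
    (s : (∂Δ[m] : SSet.{u}).obj l) :
    (∂Δ[m].ι ≫ yonedaEquiv.symm y).app l s = Y.map (boundaryArrow s) y := rfl

lemma app_map_app (q : P ⟶ X) {c c' : C} (g : c ⟶ c') (l : SimplexCategoryᵒᵖ)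
    (a : (P.obj c).obj l) :
    (q.app c').app l ((P.map g).app l a) = (X.map g).app l ((q.app c).app l a) :=
  ConcreteCategory.congr_hom (NatTrans.congr_app (q.naturality g) l) a

lemma app_totalValue_boundary (q : P ⟶ X) {m : ℕ}
    (f : (∂Δ[m] : SSet.{u}) ⟶ totalSpace P) (x : (totalSpace X).obj (op ⦋m⦌))
    (hf : ∀ ⦃l : SimplexCategoryᵒᵖ⦄ (s : (∂Δ[m] : SSet.{u}).obj l),
      (totalSpaceMap q).app l (f.app l s) = (totalSpace X).map (boundaryArrow s) x)
    (hσ : ∀ ⦃l : SimplexCategoryᵒᵖ⦄ (s : (∂Δ[m] : SSet.{u}).obj l),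
      totalChain (f.app l s) = (nerve C).map (boundaryArrow s) (totalChain x))
    ⦃l : SimplexCategoryᵒᵖ⦄ (s : (∂Δ[m] : SSet.{u}).obj l) :
    (q.app _).app l (totalValue (f.app l s) _ (hσ s)) =
      totalValue ((totalSpace X).map (boundaryArrow s) x) _ (totalChain_map x _) := by
  rw [← totalValue_totalSpaceMap q (f.app l s) _ (hσ s) (hσ s)]
  exact totalValue_congr (hf s) _ _ _

/-- The simplices outside the boundary are the surjective operators, and these do not change the
last object of the chain. So a compatible family is determined by its boundary values and one value
at the last object. -/
lemma boundaryArrow_or_isIso {m : ℕ} (σ : (nerve C).obj (op ⦋m⦌)) (θ : op ⦋m⦌ ⟶ l) :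
    (∃ s : (∂Δ[m] : SSet.{u}).obj l, boundaryArrow s = θ) ∨ IsIso (chainLastHom θ σ) := by
  by_cases hθ : Function.Surjective θ.unop.toOrderHom
  · exact Or.inr (isIso_chainLastHom θ σ hθ)
  · exact Or.inl ⟨⟨stdSimplex.objEquiv.symm θ.unop, hθ⟩, rfl⟩

/-- Pushed forward to the last object of the chain, the boundary values form a map from `∂Δ[m]` to
the value of `P` there. The trivial fibration `q` at this single object extends it to a simplex `z`
over the given one. -/
lemma exists_last_value_extension (q : P ⟶ X) (hq : ∀ c, IsTrivialFibration (q.app c)) {m : ℕ}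
    (f : (∂Δ[m] : SSet.{u}) ⟶ totalSpace P) (x : (totalSpace X).obj (op ⦋m⦌))
    (hf : ∀ ⦃l : SimplexCategoryᵒᵖ⦄ (s : (∂Δ[m] : SSet.{u}).obj l),
      (totalSpaceMap q).app l (f.app l s) = (totalSpace X).map (boundaryArrow s) x)
    (hσ : ∀ ⦃l : SimplexCategoryᵒᵖ⦄ (s : (∂Δ[m] : SSet.{u}).obj l),
      totalChain (f.app l s) = (nerve C).map (boundaryArrow s) (totalChain x)) :
    ∃ z : (P.obj (chainLast (totalChain x))).obj (op ⦋m⦌),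
      (q.app _).app _ z = totalValue x (totalChain x) rfl ∧
      ∀ ⦃l : SimplexCategoryᵒᵖ⦄ (s : (∂Δ[m] : SSet.{u}).obj l),
        (P.map (chainLastHom (boundaryArrow s) (totalChain x))).app l
          (totalValue (f.app l s) _ (hσ s)) =
        (P.obj (chainLast (totalChain x))).map (boundaryArrow s) z := by
  have hb : ∀ ⦃l l' : SimplexCategoryᵒᵖ⦄ (s : (∂Δ[m] : SSet.{u}).obj l) (η : l ⟶ l'),
      (P.map (chainLastHom (boundaryArrow s ≫ η) (totalChain x))).app l'
        (totalValue (f.app l' ((∂Δ[m] : SSet.{u}).map η s)) _ (hσ _)) =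
      (P.obj (chainLast (totalChain x))).map η ((P.map (chainLastHom (boundaryArrow s) (totalChain x))).app l
        (totalValue (f.app l s) _ (hσ s))) := fun l l' s η => by
    rw [map_chainLastHom_comp, ← NatTrans.naturality_apply]
    exact congr_arg _ (totalValue_app_map f s η _ (hσ s) (hσ _))
  let b : (∂Δ[m] : SSet.{u}) ⟶ P.obj (chainLast (totalChain x)) :=
    { app l := ↾fun s => (P.map (chainLastHom (boundaryArrow s) (totalChain x))).app l
        (totalValue (f.app l s) _ (hσ s))
      naturality l l' η := by
        refine ConcreteCategory.hom_ext _ _ fun s => ?_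
        exact hb s η }
  obtain ⟨φ, hφ, hφ'⟩ := exists_lift (hq (chainLast (totalChain x)) _ ⟨m⟩) b
    (yonedaEquiv.symm (totalValue x (totalChain x) rfl)) (by
      refine NatTrans.ext (funext fun l => ConcreteCategory.hom_ext _ _ fun s => ?_)
      refine (app_map_app q _ l _).trans ?_
      rw [app_totalValue_boundary q f x hf hσ, totalValue_map x _ rfl]
      exact (ι_yonedaEquiv_symm_app _ s).symm)
  obtain ⟨z, rfl⟩ := yonedaEquiv.symm.surjective φ
  have hz' : (q.app _).app _ z = totalValue x (totalChain x) rfl := by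
    have := congr_arg yonedaEquiv hφ'
    rwa [yonedaEquiv_comp, Equiv.apply_symm_apply, Equiv.apply_symm_apply] at this
  refine ⟨z, hz', fun l s => ?_⟩
  rw [← ι_yonedaEquiv_symm_app, hφ]
  rfl

/-- On the boundary the value is dictated by `f`. Otherwise the map to the last object is
invertible, and the value is the image of `z` under `θ` carried back along it. -/
lemma exists_value_extension (q : P ⟶ X) {m : ℕ}
    (f : (∂Δ[m] : SSet.{u}) ⟶ totalSpace P) (x : (totalSpace X).obj (op ⦋m⦌))
    (hf : ∀ ⦃l : SimplexCategoryᵒᵖ⦄ (s : (∂Δ[m] : SSet.{u}).obj l),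
      (totalSpaceMap q).app l (f.app l s) = (totalSpace X).map (boundaryArrow s) x)
    (hσ : ∀ ⦃l : SimplexCategoryᵒᵖ⦄ (s : (∂Δ[m] : SSet.{u}).obj l),
      totalChain (f.app l s) = (nerve C).map (boundaryArrow s) (totalChain x))
    (z : (P.obj (chainLast (totalChain x))).obj (op ⦋m⦌))
    (hz' : (q.app _).app _ z = totalValue x (totalChain x) rfl)
    (hz : ∀ ⦃l : SimplexCategoryᵒᵖ⦄ (s : (∂Δ[m] : SSet.{u}).obj l),
        (P.map (chainLastHom (boundaryArrow s) (totalChain x))).app l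
          (totalValue (f.app l s) _ (hσ s)) =
        (P.obj (chainLast (totalChain x))).map (boundaryArrow s) z)
    ⦃l : SimplexCategoryᵒᵖ⦄ (θ : op ⦋m⦌ ⟶ l) :
      ∃ y : (P.obj (chainLast ((nerve C).map θ (totalChain x)))).obj l,
        (P.map (chainLastHom θ (totalChain x))).app l y = (P.obj (chainLast (totalChain x))).map θ z ∧
        (q.app _).app l y = totalValue ((totalSpace X).map θ x) _ (totalChain_map x θ) ∧
        ∀ (s : (∂Δ[m] : SSet.{u}).obj l) (h : boundaryArrow s = θ),
          totalValue (f.app l s) _ ((hσ s).trans (by rw [h])) = y := by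
  by_cases h : ∃ s : (∂Δ[m] : SSet.{u}).obj l, boundaryArrow s = θ
  · obtain ⟨s, rfl⟩ := h
    refine ⟨totalValue (f.app l s) _ (hσ s), hz s, app_totalValue_boundary q f x hf hσ s, fun s' hs' => ?_⟩
    obtain rfl : s' = s := by
      refine Subtype.ext (stdSimplex.objEquiv.injective (Quiver.Hom.op_inj hs'))
    rfl
  · have := (boundaryArrow_or_isIso (totalChain x) θ).resolve_left h
    have hinv : (P.map (chainLastHom θ (totalChain x))).app l ((P.map (inv (chainLastHom θ (totalChain x)))).app l
        ((P.obj (chainLast (totalChain x))).map θ z)) = (P.obj (chainLast (totalChain x))).map θ z := by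
      have e : P.map (inv (chainLastHom θ (totalChain x))) ≫ P.map (chainLastHom θ (totalChain x)) = 𝟙 _ := by
        rw [← P.map_comp, IsIso.inv_hom_id, P.map_id]
      exact ConcreteCategory.congr_hom (NatTrans.congr_app e l) _
    refine ⟨_, hinv, map_injective_of_isIso X (chainLastHom θ (totalChain x)) l ?_,
      fun s hs => (h ⟨s, hs⟩).elim⟩
    rw [← app_map_app, hinv, totalValue_map x _ rfl, NatTrans.naturality_apply, hz']

theorem exists_totalSpace_extension (q : P ⟶ X) (hq : ∀ c, IsTrivialFibration (q.app c)) {m : ℕ}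
    (f : (∂Δ[m] : SSet.{u}) ⟶ totalSpace P) (x : (totalSpace X).obj (op ⦋m⦌))
    (w : f ≫ totalSpaceMap q = ∂Δ[m].ι ≫ yonedaEquiv.symm x) :
    ∃ y : (totalSpace P).obj (op ⦋m⦌), (totalSpaceMap q).app _ y = x ∧
      ∀ ⦃l : SimplexCategoryᵒᵖ⦄ (s : (∂Δ[m] : SSet.{u}).obj l),
        (totalSpace P).map (boundaryArrow s) y = f.app l s := by
  have hf : ∀ ⦃l : SimplexCategoryᵒᵖ⦄ (s : (∂Δ[m] : SSet.{u}).obj l),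
      (totalSpaceMap q).app l (f.app l s) = (totalSpace X).map (boundaryArrow s) x :=
    fun l s => by
      have := ConcreteCategory.congr_hom (NatTrans.congr_app w l) s
      rwa [ι_yonedaEquiv_symm_app] at this
  have hσ : ∀ ⦃l : SimplexCategoryᵒᵖ⦄ (s : (∂Δ[m] : SSet.{u}).obj l),
      totalChain (f.app l s) = (nerve C).map (boundaryArrow s) (totalChain x) := fun l s =>
    congr_arg totalChain (hf s)
  obtain ⟨z, hz', hz⟩ := exists_last_value_extension q hq f x hf hσ
  choose y hy₁ hy₂ hy₃ using exists_value_extension q f x hf hσ z hz' hz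
  let p : ChainSections P (totalChain x) := ⟨y, fun l l' θ η => by
    rcases boundaryArrow_or_isIso (totalChain x) θ with ⟨s, rfl⟩ | h
    · rw [← hy₃ _ s rfl, ← hy₃ _ ((∂Δ[m] : SSet.{u}).map η s) (boundaryArrow_map s η)]
      exact totalValue_app_map f s η _ (hσ s) _
    · refine map_injective_of_isIso P (chainLastHom θ (totalChain x)) l' ?_
      rw [← map_chainLastHom_comp, hy₁, NatTrans.naturality_apply, hy₁, FunctorToTypes.map_comp_apply]⟩
  refine ⟨totalMk (totalChain x) p, ?_, fun l s => ?_⟩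
  · symm
    refine total_ext x (totalChain x) (p.map q) rfl fun l θ => (hy₂ θ).symm
  · symm
    refine total_eq_map_mk (f.app l s) (totalChain x) p (boundaryArrow s) (hσ s) fun l' η => ?_
    have e : f.app l' ((∂Δ[m] : SSet.{u}).map η s) = (totalSpace P).map η (f.app l s) :=
      NatTrans.naturality_apply f η s
    rw [← totalValue_congr e _ ((hσ _).trans (by rw [boundaryArrow_map]))]
    exact hy₃ (boundaryArrow s ≫ η) ((∂Δ[m] : SSet.{u}).map η s) (boundaryArrow_map s η)

theorem isTrivialFibration_totalSpaceMap (q : P ⟶ X) (hq : ∀ c, IsTrivialFibration (q.app c)) :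
    IsTrivialFibration (totalSpaceMap q) := by
  rintro _ _ _ ⟨m⟩
  refine ⟨fun {f g} sq => ?_⟩
  obtain ⟨x, rfl⟩ := yonedaEquiv.symm.surjective g
  obtain ⟨y, hy, hy'⟩ := exists_totalSpace_extension q hq f x sq.w
  refine ⟨⟨⟨yonedaEquiv.symm y, ?_, ?_⟩⟩⟩
  · refine NatTrans.ext (funext fun l => ConcreteCategory.hom_ext _ _ fun s => ?_)
    exact (ι_yonedaEquiv_symm_app y s).trans (hy' s)
  · apply yonedaEquiv.injective
    rw [yonedaEquiv_comp, Equiv.apply_symm_apply, Equiv.apply_symm_apply]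
    exact hy

end Chains

end

section


/-! ### Maps of diagrams on simplices -/

section DiagApp

variable {E : Type} [SmallCategory E] {A B X Y : E ⥤ SSet.{u}} {K L : SSet.{u}}
  {k l : SimplexCategoryᵒᵖ} {e e' : E}

/-- The value of a map of diagrams on a pair of simplices. -/
def diagApp (ψ : A ⊗ (Functor.const E).obj K ⟶ X) (a : (A.obj e).obj k) (x : K.obj k) :
    (X.obj e).obj k := (ψ.app e).app k (a, x)

lemma map_diagApp (ψ : A ⊗ (Functor.const E).obj K ⟶ X) (g : e ⟶ e') (a : (A.obj e).obj k)
    (x : K.obj k) : (X.map g).app k (diagApp ψ a x) = diagApp ψ ((A.map g).app k a) x :=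
  (app_naturality ψ g a x).symm

lemma map_diagApp' (ψ : A ⊗ (Functor.const E).obj K ⟶ X) (θ : k ⟶ l) (a : (A.obj e).obj k)
    (x : K.obj k) :
    (X.obj e).map θ (diagApp ψ a x) = diagApp ψ ((A.obj e).map θ a) (K.map θ x) :=
  (app_naturality' ψ e θ a x).symm

lemma diagApp_comp (ψ : A ⊗ (Functor.const E).obj K ⟶ X) (q : X ⟶ Y) (a : (A.obj e).obj k)
    (x : K.obj k) : diagApp (ψ ≫ q) a x = (q.app e).app k (diagApp ψ a x) := rfl

lemma diagApp_whiskerLeft (j : K ⟶ L) (ψ : A ⊗ (Functor.const E).obj L ⟶ X)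
    (a : (A.obj e).obj k) (x : K.obj k) :
    diagApp (A ◁ (Functor.const E).map j ≫ ψ) a x = diagApp ψ a (j.app k x) := rfl

lemma diagApp_ext {ψ ψ' : A ⊗ (Functor.const E).obj K ⟶ X}
    (h : ∀ (e : E) (k : SimplexCategoryᵒᵖ) (a : (A.obj e).obj k) (x : K.obj k),
      diagApp ψ a x = diagApp ψ' a x) : ψ = ψ' := diag_hom_ext h

end DiagApp

section Chains

variable {C : Type} [SmallCategory C] {k l : SimplexCategoryᵒᵖ} {P X : C ⥤ SSet.{u}}
  {K L : SSet.{u}}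

lemma overSimplex_map_id (θ : k ⟶ l) (σ : (nerve C).obj k) :
    ((overNerve.{u} C).map (chainLastHom θ σ)).app l (overSimplex ((nerve C).map θ σ) (𝟙 _)) =
      ((overNerve.{u} C).obj _).map θ (overSimplex σ (𝟙 _)) := by
  rw [overSimplex_map, overSimplex_postcomp, Category.id_comp, Category.comp_id]

/-- The section over a chain given by a map of diagrams. -/
def chainSectionsOfHom (ψ : overNerve.{u} C ⊗ (Functor.const C).obj K ⟶ P) (σ : (nerve C).obj k)
    (x : K.obj k) : ChainSections P σ :=
  ⟨fun l θ => diagApp ψ (overSimplex ((nerve C).map θ σ) (𝟙 _)) (K.map θ x),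
    fun l l' θ η => by
      dsimp only
      rw [map_diagApp', ← overSimplex_map_id, ← K.map_comp_apply]
      exact map_diagApp ψ (chainLastHom η ((nerve C).map θ σ))
        (overSimplex ((nerve C).map η ((nerve C).map θ σ)) (𝟙 _)) (K.map (θ ≫ η) x)⟩

/-- The value of a map to the total space on a pair of simplices. -/
def totalApp (φ : uliftFunctor.{u}.obj (nerve C) ⊗ K ⟶ totalSpace P) (σ : (nerve C).obj k)
    (x : K.obj k) : (totalSpace P).obj k :=
  φ.app k ((⟨σ⟩, x) : ULift.{u} ((nerve C).obj k) × K.obj k)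

lemma map_totalApp (φ : uliftFunctor.{u}.obj (nerve C) ⊗ K ⟶ totalSpace P)
    (σ : (nerve C).obj k) (x : K.obj k) (θ : k ⟶ l) :
    totalApp φ ((nerve C).map θ σ) (K.map θ x) = (totalSpace P).map θ (totalApp φ σ x) :=
  NatTrans.naturality_apply φ θ ((⟨σ⟩, x) : (uliftFunctor.{u}.obj (nerve C)).obj k × K.obj k)

lemma totalApp_comp (φ : uliftFunctor.{u}.obj (nerve C) ⊗ K ⟶ totalSpace P) (q : P ⟶ X)
    (σ : (nerve C).obj k) (x : K.obj k) :
    totalApp (φ ≫ totalSpaceMap q) σ x = (totalSpaceMap q).app k (totalApp φ σ x) := rfl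

lemma totalApp_whiskerLeft (φ : uliftFunctor.{u}.obj (nerve C) ⊗ L ⟶ totalSpace P) (j : K ⟶ L)
    (σ : (nerve C).obj k) (x : K.obj k) :
    totalApp (_ ◁ j ≫ φ) σ x = totalApp φ σ (j.app k x) := rfl

lemma totalApp_ext {φ φ' : uliftFunctor.{u}.obj (nerve C) ⊗ K ⟶ totalSpace P}
    (h : ∀ (k : SimplexCategoryᵒᵖ) (σ : (nerve C).obj k) (x : K.obj k),
      totalApp φ σ x = totalApp φ' σ x) : φ = φ' :=
  NatTrans.ext (funext fun k => ConcreteCategory.hom_ext _ _ fun a => h k a.1.down a.2)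

/-- The map to the total space given by a map of diagrams. -/
def toTotalSpace (ψ : overNerve.{u} C ⊗ (Functor.const C).obj K ⟶ P) :
    uliftFunctor.{u}.obj (nerve C) ⊗ K ⟶ totalSpace P where
  app k := ↾fun a => totalMk a.1.down (chainSectionsOfHom ψ a.1.down a.2)
  naturality k k' θ := by
    refine ConcreteCategory.hom_ext _ _ fun a => ?_
    refine total_eq_map_mk _ a.1.down _ θ rfl fun l η => ?_
    refine (totalValue_map_mk ((nerve C).map θ a.1.down)
      (chainSectionsOfHom ψ ((nerve C).map θ a.1.down) (K.map θ a.2)) η rfl).trans ?_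
    exact congr_arg (diagApp ψ (overSimplex ((nerve C).map (θ ≫ η) a.1.down) (𝟙 _)))
      (K.map_comp_apply _ _ _).symm

lemma totalApp_toTotalSpace (ψ : overNerve.{u} C ⊗ (Functor.const C).obj K ⟶ P)
    (σ : (nerve C).obj k) (x : K.obj k) :
    totalApp (toTotalSpace ψ) σ x = totalMk σ (chainSectionsOfHom ψ σ x) := rfl

lemma totalChain_toTotalSpace (ψ : overNerve.{u} C ⊗ (Functor.const C).obj K ⟶ P)
    (σ : (nerve C).obj k) (x : K.obj k) : totalChain (totalApp (toTotalSpace ψ) σ x) = σ := rfl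

lemma totalValue_toTotalSpace (ψ : overNerve.{u} C ⊗ (Functor.const C).obj K ⟶ P)
    (σ : (nerve C).obj k) (x : K.obj k) (h : totalChain (totalApp (toTotalSpace ψ) σ x) = σ) :
    totalValue (totalApp (toTotalSpace ψ) σ x) σ h = diagApp ψ (overSimplex σ (𝟙 _)) x := by
  refine (totalValue_mk σ (chainSectionsOfHom ψ σ x) h).trans ?_
  exact congr_arg (diagApp ψ (overSimplex σ (𝟙 _))) (K.map_id_apply _ _)

lemma toTotalSpace_comp (ψ : overNerve.{u} C ⊗ (Functor.const C).obj K ⟶ P) (q : P ⟶ X) :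
    toTotalSpace (ψ ≫ q) = toTotalSpace ψ ≫ totalSpaceMap q := rfl

lemma toTotalSpace_whisker (j : K ⟶ L) (ω : overNerve.{u} C ⊗ (Functor.const C).obj L ⟶ X) :
    toTotalSpace (overNerve.{u} C ◁ (Functor.const C).map j ≫ ω) = _ ◁ j ≫ toTotalSpace ω := by
  refine totalApp_ext fun k σ x => ?_
  rw [totalApp_whiskerLeft, totalApp_toTotalSpace, totalApp_toTotalSpace]
  refine congr_arg (totalMk σ) (Subtype.ext ?_)
  funext l θ
  exact congr_arg (diagApp ω (overSimplex ((nerve C).map θ σ) (𝟙 _)))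
    (NatTrans.naturality_apply j θ x)

/-- The map of diagrams given by a map to the total space. -/
def ofTotalSpace (φ : uliftFunctor.{u}.obj (nerve C) ⊗ K ⟶ totalSpace P)
    (hφ : ∀ ⦃k : SimplexCategoryᵒᵖ⦄ (σ : (nerve C).obj k) (x : K.obj k),
      totalChain (totalApp φ σ x) = σ) : overNerve.{u} C ⊗ (Functor.const C).obj K ⟶ P :=
  diagHomMk (fun c k τ x => (P.map (underChainHom τ)).app k
      (totalValue (totalApp φ (underChain τ) x) _ (hφ _ x)))
    (fun c k k' θ τ x => by
      have h : totalChain ((totalSpace P).map θ (totalApp φ (underChain τ) x)) =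
        (nerve C).map θ (underChain τ) := (totalChain_map _ _).trans (congr_arg _ (hφ _ x))
      rw [underChainHom_map, ← NatTrans.naturality_apply, ← totalValue_map _ _ (hφ _ x) θ h,
        ← totalValue_congr (map_totalApp φ _ x θ) _ (hφ _ _) h]
      exact ConcreteCategory.congr_hom (NatTrans.congr_app (P.map_comp _ _) k') _)
    (fun {c c'} g k τ x => ConcreteCategory.congr_hom (NatTrans.congr_app (P.map_comp _ _) k) _)

lemma diagApp_ofTotalSpace (φ : uliftFunctor.{u}.obj (nerve C) ⊗ K ⟶ totalSpace P)
    (hφ : ∀ ⦃k : SimplexCategoryᵒᵖ⦄ (σ : (nerve C).obj k) (x : K.obj k),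
      totalChain (totalApp φ σ x) = σ) {c : C} (τ : ((overNerve.{u} C).obj c).obj k) (x : K.obj k) :
    diagApp (ofTotalSpace φ hφ) τ x = (P.map (underChainHom τ)).app k
      (totalValue (totalApp φ (underChain τ) x) _ (hφ _ x)) := rfl

/-- Maps from `overNerve C ⊗ K` to `P` correspond to maps from `nerve C ⊗ K` to the total space of
`P` over `nerve C`, because by naturality they are determined by chains lying over their own last
object. The lifting problem thus becomes one for a monomorphism against the trivial fibration
`totalSpaceMap q`; this is the cofibrancy of the diagram of over-categories. -/
lemma hasLiftingProperty_overNerve_whisker (q : P ⟶ X) (hq : ∀ c, IsTrivialFibration (q.app c))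
    (j : K ⟶ L) [Mono j] :
    HasLiftingProperty (overNerve.{u} C ◁ (Functor.const C).map j) q := by
  refine ⟨fun {ψ ω} sq => ?_⟩
  obtain ⟨φ, h₁, h₂⟩ := exists_lift ((isTrivialFibration_totalSpaceMap q hq).hasLift
    (uliftFunctor.{u}.obj (nerve C) ◁ j)) (toTotalSpace ψ) (toTotalSpace ω) (by
      rw [← toTotalSpace_comp, sq.w, toTotalSpace_whisker])
  have h₂' : ∀ ⦃k : SimplexCategoryᵒᵖ⦄ (σ : (nerve C).obj k) (x : L.obj k),
      (totalSpaceMap q).app k (totalApp φ σ x) = totalApp (toTotalSpace ω) σ x :=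
    fun k σ x => by rw [← h₂, totalApp_comp]
  have h₁' : ∀ ⦃k : SimplexCategoryᵒᵖ⦄ (σ : (nerve C).obj k) (x : K.obj k),
      totalApp φ σ (j.app k x) = totalApp (toTotalSpace ψ) σ x := fun k σ x => by
    rw [← h₁, totalApp_whiskerLeft]
  -- The lift automatically lies over `nerve C`, since its image in the total space of `X` does.
  have hφ : ∀ ⦃k : SimplexCategoryᵒᵖ⦄ (σ : (nerve C).obj k) (x : L.obj k),
      totalChain (totalApp φ σ x) = σ := fun k σ x => by
    rw [← totalChain_totalSpaceMap q, h₂']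
    rfl
  refine ⟨⟨⟨ofTotalSpace φ hφ, ?_, ?_⟩⟩⟩
  · refine diagApp_ext fun c k τ x => ?_
    rw [diagApp_whiskerLeft, diagApp_ofTotalSpace, totalValue_congr (h₁' _ x) _ (hφ _ _) (totalChain_toTotalSpace _ _ _),
      totalValue_toTotalSpace, map_diagApp, overSimplex_postcomp, Category.id_comp,
      overSimplex_underChain]
  · refine diagApp_ext fun c k τ x => ?_
    rw [diagApp_comp, diagApp_ofTotalSpace, app_map_app,
      ← totalValue_totalSpaceMap q _ _ (hφ _ x) (hφ _ x),
      totalValue_congr (h₂' _ x) _ (hφ _ x) (totalChain_toTotalSpace _ _ _), totalValue_toTotalSpace, map_diagApp,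
      overSimplex_postcomp, Category.id_comp, overSimplex_underChain]

/-- Homotopy limits preserve objectwise trivial fibrations. -/
theorem isTrivialFibration_holim_map (q : P ⟶ X) (hq : ∀ c, IsTrivialFibration (q.app c)) :
    IsTrivialFibration ((holim C).map q) :=
  isTrivialFibration_mapSp_map q fun _ => hasLiftingProperty_overNerve_whisker q hq _

end Chains

end

section


/-! ### Homotopy limits of right Kan extensions -/

section Extension

variable {C D 𝓔 : Type} [SmallCategory C] [SmallCategory D] [SmallCategory 𝓔]
  (G : C ⥤ 𝓔) (ι : D ⥤ 𝓔) {X Y : D ⥤ SSet.{u}} {K L : SSet.{u}} {k l : SimplexCategoryᵒᵖ}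

/-- The functor `d ↦ (e ⟶ ι d)`. -/
abbrev homsTo (e : 𝓔) : D ⥤ Type := ι ⋙ coyoneda.obj (op e)

variable (X) in
/-- The right Kan extension of a diagram of simplicial sets along `ι`. -/
def extend : 𝓔 ⥤ SSet.{u} where
  obj e := families (homsTo ι e) X
  map {e e'} g := familiesLift (F := homsTo ι e')
    (fun _ t => familiesApp (homsTo ι e) X (g ≫ t)) (fun d d' h t => by
      rw [familiesApp_map]
      exact congr_arg (fun s : e ⟶ ι.obj d' => familiesApp (homsTo ι e) X s)
        (Category.assoc g t (ι.map h)).symm)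
  map_id e := families_hom_ext fun d t => by
    rw [familiesLift_app, Category.id_comp, Category.id_comp]
  map_comp g h := families_hom_ext fun d t => by
    rw [familiesLift_app, Category.assoc g h t]
    rfl

def extendMap (q : X ⟶ Y) : extend ι X ⟶ extend ι Y where
  app e := familiesMap (homsTo ι e) q
  naturality e e' g := rfl

lemma extend_ext {e : 𝓔} {y y' : ((extend ι X).obj e).obj k}
    (h : ∀ ⦃d : D⦄ (t : e ⟶ ι.obj d), y.1 t = y'.1 t) : y = y' :=
  Subtype.ext (funext fun d => funext fun t => h t)

lemma map_chainLastHom_id_comp (σ : (nerve C).obj k) {e : 𝓔} (h : G.obj (chainLast σ) ⟶ e) :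
    G.map (chainLastHom (𝟙 k) σ) ≫ h = h :=
  (congr_arg (fun t : chainLast σ ⟶ chainLast σ => G.map t ≫ h) (chainLastHom_id σ)).trans
    (by rw [G.map_id, Category.id_comp])

lemma map_chainLastHom_comp_comp {m : SimplexCategoryᵒᵖ} (θ : k ⟶ l) (η : l ⟶ m)
    (σ : (nerve C).obj k) {e : 𝓔} (h : G.obj (chainLast σ) ⟶ e) :
    G.map (chainLastHom (θ ≫ η) σ) ≫ h =
      G.map (chainLastHom η ((nerve C).map θ σ)) ≫ G.map (chainLastHom θ σ) ≫ h :=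
  (congr_arg (fun t : chainLast ((nerve C).map η ((nerve C).map θ σ)) ⟶ chainLast σ =>
    G.map t ≫ h) (chainLastHom_comp θ η σ)).trans (by rw [G.map_comp, Category.assoc])

/-- The diagram of the nerves of the comma categories of `G` over the objects `ι d`. -/
def commaNerve : D ⥤ SSet.{u} where
  obj d :=
    { obj k := ULift.{u} (Σ σ : (nerve C).obj k, (G.obj (chainLast σ) ⟶ ι.obj d))
      map θ := ↾fun a => ⟨(nerve C).map θ a.down.1, G.map (chainLastHom θ a.down.1) ≫ a.down.2⟩
      map_id k := by
        refine ConcreteCategory.hom_ext _ _ fun ⟨a⟩ => ?_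
        refine congr_arg ULift.up (Sigma.ext rfl (heq_of_eq ?_))
        exact map_chainLastHom_id_comp G a.1 a.2
      map_comp θ η := by
        refine ConcreteCategory.hom_ext _ _ fun ⟨a⟩ => ?_
        refine congr_arg ULift.up (Sigma.ext rfl (heq_of_eq ?_))
        exact map_chainLastHom_comp_comp G θ η a.1 a.2 }
  map g := { app := fun k => ↾fun a => ⟨a.down.1, a.down.2 ≫ ι.map g⟩
             naturality := fun k k' θ => by
              refine ConcreteCategory.hom_ext _ _ fun ⟨a⟩ => ?_
              exact congr_arg ULift.up (Sigma.ext rfl (heq_of_eq (Category.assoc _ _ _))) }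
  map_id d := by
    refine NatTrans.ext (funext fun k => ConcreteCategory.hom_ext _ _ fun ⟨a⟩ => ?_)
    refine congr_arg ULift.up (Sigma.ext rfl (heq_of_eq ?_))
    dsimp only
    rw [ι.map_id]
    exact Category.comp_id _
  map_comp g h := by
    refine NatTrans.ext (funext fun k => ConcreteCategory.hom_ext _ _ fun ⟨a⟩ => ?_)
    refine congr_arg ULift.up (Sigma.ext rfl (heq_of_eq ?_))
    dsimp only
    rw [ι.map_comp]
    exact (Category.assoc _ _ _).symm

variable {G ι}

def commaSimplex {d : D} (σ : (nerve C).obj k) (h : G.obj (chainLast σ) ⟶ ι.obj d) :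
    ((commaNerve.{u} G ι).obj d).obj k := ⟨⟨σ, h⟩⟩

lemma commaSimplex_map {d : D} (σ : (nerve C).obj k) (h : G.obj (chainLast σ) ⟶ ι.obj d)
    (θ : k ⟶ l) : ((commaNerve.{u} G ι).obj d).map θ (commaSimplex σ h) =
      commaSimplex ((nerve C).map θ σ) (G.map (chainLastHom θ σ) ≫ h) := rfl

lemma commaSimplex_postcomp {d d' : D} (σ : (nerve C).obj k) (h : G.obj (chainLast σ) ⟶ ι.obj d)
    (g : d ⟶ d') : ((commaNerve.{u} G ι).map g).app k (commaSimplex σ h) =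
      commaSimplex σ (h ≫ ι.map g) := rfl

def familyOfHom (ψ : commaNerve.{u} G ι ⊗ (Functor.const D).obj K ⟶ X) {c : C}
    (τ : ((overNerve.{u} C).obj c).obj k) (x : K.obj k) :
    ((extend ι X).obj (G.obj c)).obj k :=
  ⟨fun _ t => diagApp ψ (commaSimplex (underChain τ) (G.map (underChainHom τ) ≫ t)) x,
    fun d d' g t => by
      refine Eq.trans ?_ (map_diagApp ψ g _ x).symm
      rw [commaSimplex_postcomp, Category.assoc]
      rfl⟩

/-- A chain in `C / c` and an arrow `G c ⟶ ι d` compose to a simplex of the comma category of `G`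
over `ι d`. The inverse `ofExtend` evaluates at chains over their own last object. -/
def toExtend (ψ : commaNerve.{u} G ι ⊗ (Functor.const D).obj K ⟶ X) :
    overNerve.{u} C ⊗ (Functor.const C).obj K ⟶ G ⋙ extend ι X :=
  diagHomMk (X := G ⋙ extend ι X) (fun _ _ τ x => familyOfHom ψ τ x)
    (fun c k k' θ τ x => by
      refine extend_ext ι fun d t => Eq.trans ?_ (map_diagApp' ψ θ _ x).symm
      rw [commaSimplex_map, ← Category.assoc, ← G.map_comp, ← underChainHom_map]
      rfl)
    (fun {c c'} g k τ x => by
      refine extend_ext ι fun d t => ?_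
      change diagApp ψ (commaSimplex (underChain τ) (G.map (underChainHom τ ≫ g) ≫ t)) x =
        diagApp ψ (commaSimplex (underChain τ) (G.map (underChainHom τ) ≫ G.map g ≫ t)) x
      rw [G.map_comp, Category.assoc])

lemma diagApp_toExtend (ψ : commaNerve.{u} G ι ⊗ (Functor.const D).obj K ⟶ X) {c : C}
    (τ : ((overNerve.{u} C).obj c).obj k) (x : K.obj k) :
    diagApp (toExtend ψ) τ x = familyOfHom ψ τ x := rfl

/-- The components of a map to a diagram obtained by right Kan extension. -/
def extendApp (φ : overNerve.{u} C ⊗ (Functor.const C).obj K ⟶ G ⋙ extend ι X) {c : C} {d : D}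
    (τ : ((overNerve.{u} C).obj c).obj k) (h : G.obj c ⟶ ι.obj d) (x : K.obj k) :
    (X.obj d).obj k :=
  (show ((extend ι X).obj (G.obj c)).obj k from diagApp (X := G ⋙ extend ι X) φ τ x).1 h

lemma map_extendApp (φ : overNerve.{u} C ⊗ (Functor.const C).obj K ⟶ G ⋙ extend ι X) {c : C}
    {d d' : D} (τ : ((overNerve.{u} C).obj c).obj k) (h : G.obj c ⟶ ι.obj d) (x : K.obj k)
    (g : d ⟶ d') : (X.map g).app k (extendApp φ τ h x) = extendApp φ τ (h ≫ ι.map g) x :=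
  ((show ((extend ι X).obj (G.obj c)).obj k from diagApp (X := G ⋙ extend ι X) φ τ x).2 g h).symm

lemma map_extendApp' (φ : overNerve.{u} C ⊗ (Functor.const C).obj K ⟶ G ⋙ extend ι X) {c : C}
    {d : D} (τ : ((overNerve.{u} C).obj c).obj k) (h : G.obj c ⟶ ι.obj d) (x : K.obj k)
    (θ : k ⟶ l) : (X.obj d).map θ (extendApp φ τ h x) =
      extendApp φ (((overNerve.{u} C).obj c).map θ τ) h (K.map θ x) := by
  have := map_diagApp' φ θ τ x
  exact congr_arg (fun y : ((extend ι X).obj (G.obj c)).obj l => y.1 h) this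

lemma extendApp_precomp (φ : overNerve.{u} C ⊗ (Functor.const C).obj K ⟶ G ⋙ extend ι X) {c c' : C}
    {d : D} (g : c ⟶ c') (τ : ((overNerve.{u} C).obj c).obj k) (h : G.obj c' ⟶ ι.obj d)
    (x : K.obj k) : extendApp φ (((overNerve.{u} C).map g).app k τ) h x =
      extendApp φ τ (G.map g ≫ h) x := by
  have := map_diagApp φ g τ x
  exact (congr_arg (fun y : ((extend ι X).obj (G.obj c')).obj k => y.1 h) this).symm

def ofExtend (φ : overNerve.{u} C ⊗ (Functor.const C).obj K ⟶ G ⋙ extend ι X) :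
    commaNerve.{u} G ι ⊗ (Functor.const D).obj K ⟶ X :=
  diagHomMk (fun d k a x => extendApp φ (overSimplex a.down.1 (𝟙 _)) a.down.2 x)
    (fun d k k' θ a x => by
      rw [map_extendApp', ← overSimplex_map_id, extendApp_precomp]
      rfl)
    (fun {d d'} g k a x => by
      rw [map_extendApp]
      rfl)

lemma diagApp_ofExtend (φ : overNerve.{u} C ⊗ (Functor.const C).obj K ⟶ G ⋙ extend ι X)
    {d : D} (σ : (nerve C).obj k) (h : G.obj (chainLast σ) ⟶ ι.obj d) (x : K.obj k) :
    diagApp (ofExtend φ) (commaSimplex σ h) x = extendApp φ (overSimplex σ (𝟙 _)) h x := rfl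

lemma ofExtend_toExtend (ψ : commaNerve.{u} G ι ⊗ (Functor.const D).obj K ⟶ X) :
    ofExtend (toExtend ψ) = ψ := by
  refine diagApp_ext fun d k a x => ?_
  obtain ⟨σ, h⟩ := a
  refine (diagApp_ofExtend (toExtend ψ) σ h x).trans ?_
  have h1 : underChain (overSimplex.{u} σ (𝟙 _)) = σ := rfl
  have h2 : underChainHom (overSimplex.{u} σ (𝟙 _)) = 𝟙 (chainLast σ) := by
    exact (Category.comp_id _).trans
      (CategoryTheory.Functor.map_id (C := Fin (k.unop.len + 1)) σ _)
  change diagApp ψ (commaSimplex σ (G.map (underChainHom (overSimplex.{u} σ (𝟙 _))) ≫ h)) x = _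
  rw [h2, G.map_id]
  exact congr_arg (fun t => diagApp ψ (commaSimplex σ t) x) (Category.id_comp h)

lemma toExtend_ofExtend (φ : overNerve.{u} C ⊗ (Functor.const C).obj K ⟶ G ⋙ extend ι X) :
    toExtend (ofExtend φ) = φ := by
  refine diagApp_ext fun c k τ x => ?_
  rw [diagApp_toExtend]
  refine extend_ext ι fun d t => ?_
  change extendApp φ (overSimplex (underChain τ) (𝟙 _)) (G.map (underChainHom τ) ≫ t) x =
    extendApp φ τ t x
  rw [← extendApp_precomp, overSimplex_postcomp, Category.id_comp, overSimplex_underChain]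

lemma toExtend_whiskerLeft (j : K ⟶ L) (ψ : commaNerve.{u} G ι ⊗ (Functor.const D).obj L ⟶ X) :
    toExtend (commaNerve.{u} G ι ◁ (Functor.const D).map j ≫ ψ) =
      overNerve.{u} C ◁ (Functor.const C).map j ≫ toExtend ψ := rfl

variable (G ι X) in
/-- The homotopy limit of a right Kan extension is a mapping space from the nerves of the comma
categories. -/
def mapSpCommaIso : (mapSp (commaNerve.{u} G ι)).obj X ≅ (holim C).obj (G ⋙ extend ι X) :=
  NatIso.ofComponents (fun k => Equiv.toIso
    { toFun := fun ψ => toExtend (mapSpHom ψ)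
      invFun := fun φ => ofExtend (show overNerve.{u} C ⊗ (Functor.const C).obj _ ⟶ _ from φ)
      left_inv := fun ψ => ofExtend_toExtend (mapSpHom ψ)
      right_inv := fun φ => toExtend_ofExtend _ }) (fun {k k'} θ => by
    refine ConcreteCategory.hom_ext _ _ fun ψ => ?_
    exact toExtend_whiskerLeft (SSet.stdSimplex.map θ.unop) (mapSpHom ψ))

end Extension

end

section


/-! ### Contractible nerves -/

section Contractible

/-- As `X` need not be a Kan complex, the two homotopies to `F` cannot be joined in `X`. After
mapping to a Kan complex they can be reversed and composed, which suffices. -/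
lemma IsWeakEquiv.of_contraction {X T : SSet.{u}} (hT : IsTerminal T) (p : X ⟶ T) (z : T ⟶ X)
    (F : X ⟶ X) (h₁ : Homotopic (𝟙 X) F) (h₂ : Homotopic (p ≫ z) F) : IsWeakEquiv p := by
  intro K hK
  refine ⟨fun g => ⟨z ≫ g, ?_⟩, fun h h' H => ?_⟩
  · have a := h₁.postcomp g
    have b := h₂.postcomp g
    rw [Category.id_comp] at a
    rw [Category.assoc] at b
    exact b.trans hK (a.symm hK)
  · have a := H.precomp z
    have e : z ≫ p = 𝟙 T := hT.hom_ext _ _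
    rwa [reassoc_of% e, reassoc_of% e] at a

variable {A B : Type} [SmallCategory A] [SmallCategory B]

/-- The functor given by an order preserving map. -/
def chainFunctor {k : SimplexCategoryᵒᵖ} (t : (Δ[1] : SSet.{u}).obj k) :
    Fin (k.unop.len + 1) ⥤ Fin 2 :=
  (stdSimplex.objEquiv t).toOrderHom.monotone.functor

/-- The homotopy between maps of nerves given by a natural transformation. -/
def nerveHomotopy {F G : A ⥤ B} (α : F ⟶ G) :
    uliftFunctor.{u}.obj (nerve A) ⊗ Δ[1] ⟶ uliftFunctor.{u}.obj (nerve B) where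
  app k := ↾fun x => (⟨(chainFunctor x.2).prod' (show Fin (k.unop.len + 1) ⥤ A from x.1.down) ⋙
    CategoryTheory.Functor.uncurry.obj (ComposableArrows.mk₁ α)⟩ : ULift.{u} ((nerve B).obj k))
  naturality k k' θ := rfl

/-- The map of nerves given by a functor. -/
def uliftNerveMap (F : A ⥤ B) :
    uliftFunctor.{u}.obj (nerve A) ⟶ uliftFunctor.{u}.obj (nerve B) :=
  uliftFunctor.{u}.map (nerveMap F)

lemma ι₀_nerveHomotopy {F G : A ⥤ B} (α : F ⟶ G) :
    ι₀ ≫ nerveHomotopy.{u} α = uliftNerveMap F := by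
  refine NatTrans.ext (funext fun k => ConcreteCategory.hom_ext _ _ fun ⟨τ⟩ => ?_)
  refine congr_arg ULift.up (CategoryTheory.Functor.ext (fun i => rfl) (fun i i' f => ?_))
  refine (Category.id_comp (F.map (CategoryTheory.Functor.map (C := Fin (k.unop.len + 1))
    τ f))).trans ?_
  exact ((Category.id_comp _).trans (Category.comp_id _)).symm

lemma ι₁_nerveHomotopy {F G : A ⥤ B} (α : F ⟶ G) :
    ι₁ ≫ nerveHomotopy.{u} α = uliftNerveMap G := by
  refine NatTrans.ext (funext fun k => ConcreteCategory.hom_ext _ _ fun ⟨τ⟩ => ?_)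
  refine congr_arg ULift.up (CategoryTheory.Functor.ext (fun i => rfl) (fun i i' f => ?_))
  refine (Category.id_comp (G.map (CategoryTheory.Functor.map (C := Fin (k.unop.len + 1))
    τ f))).trans ?_
  exact ((Category.id_comp _).trans (Category.comp_id _)).symm

lemma homotopic_uliftNerveMap {F G : A ⥤ B} (α : F ⟶ G) :
    Homotopic (uliftNerveMap.{u} F) (uliftNerveMap G) :=
  (homotopic_iff _ _).2 ⟨nerveHomotopy α, ι₀_nerveHomotopy α, ι₁_nerveHomotopy α⟩

/-- A category with a system of subobjects through which all objects map compatibly to a zigzag has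
contractible nerve. -/
theorem isWeakEquiv_nerve_of_contraction (F : A → A) (hF : ∀ a b, Subsingleton (a ⟶ F b))
    (η : ∀ a, Nonempty (a ⟶ F a)) (hm : ∀ ⦃a b⦄ (_ : a ⟶ b), Nonempty (F a ⟶ F b)) (z : A)
    (hz : ∀ a, Nonempty (z ⟶ F a)) {T : SSet.{u}} (hT : IsTerminal T)
    (p : uliftFunctor.{u}.obj (nerve A) ⟶ T) : IsWeakEquiv p := by
  -- There is at most one arrow into any value of `F`, so arbitrary choices are functorial and
  -- natural.
  let Φ : A ⥤ A :=
    { obj := F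
      map f := (hm f).some
      map_id a := (hF _ _).elim _ _
      map_comp f g := (hF _ _).elim _ _ }
  let α : 𝟭 A ⟶ Φ := { app a := (η a).some, naturality _ _ _ := (hF _ _).elim _ _ }
  let β : (Functor.const A).obj z ⟶ Φ :=
    { app a := (hz a).some, naturality _ _ _ := (hF _ _).elim _ _ }
  have h₁ := homotopic_uliftNerveMap.{u} α
  have h₂ := homotopic_uliftNerveMap.{u} β
  let zc : ∀ k : SimplexCategoryᵒᵖ, (nerve A).obj k := fun k =>
    (Functor.const (Fin (k.unop.len + 1))).obj z
  let ζ : T ⟶ uliftFunctor.{u}.obj (nerve A) :=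
    { app k := ↾fun _ => (⟨zc k⟩ : ULift.{u} ((nerve A).obj k))
      naturality _ _ _ := rfl }
  exact IsWeakEquiv.of_contraction hT p ζ (uliftNerveMap Φ) h₁ h₂

variable {C D 𝓔 : Type} [SmallCategory C] [SmallCategory D] [SmallCategory 𝓔]

lemma isWeakEquiv_overNerve (c : C) {T : SSet.{u}} (hT : IsTerminal T)
    (p : (overNerve.{u} C).obj c ⟶ T) : IsWeakEquiv p := by
  have h : ∀ a : Over c, Nonempty (a ⟶ Over.mk (𝟙 c)) := fun a => ⟨Over.homMk a.hom (by simp)⟩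
  refine isWeakEquiv_nerve_of_contraction (A := Over c) (fun _ => Over.mk (𝟙 c))
    (fun a b => ⟨fun f g => ?_⟩) h (fun a b f => ⟨𝟙 _⟩) (Over.mk (𝟙 c)) (fun a => ⟨𝟙 _⟩) hT p
  ext
  have hf := Over.w f
  have hg := Over.w g
  simp only [Over.mk_hom, Over.mk_left, Category.comp_id] at hf hg
  exact hf.trans hg.symm

variable (G : C ⥤ 𝓔) (ι : D ⥤ 𝓔) (d : D)

lemma costructuredArrow_functor_ext {J : Type} [Category* J] {e : 𝓔} {F : J ⥤ C}
    {X Y : ∀ i, G.obj (F.obj i) ⟶ e} (hX : ∀ {i i'} (f : i ⟶ i'), G.map (F.map f) ≫ X i' = X i)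
    (hY : ∀ {i i'} (f : i ⟶ i'), G.map (F.map f) ≫ Y i' = Y i) (h : ∀ i, X i = Y i)
    {H H' : J ⥤ CostructuredArrow G e} (hH : H = F.toCostructuredArrow G e X hX)
    (hH' : H' = F.toCostructuredArrow G e Y hY) : H = H' := by
  obtain rfl : X = Y := funext h
  rw [hH, hH']

/-- The chain in a comma category given by a chain and a map from its last object. -/
def commaFunctor {m : ℕ} (F : Fin (m + 1) ⥤ C) {e : 𝓔} (h : G.obj (F.obj (Fin.last m)) ⟶ e) :
    Fin (m + 1) ⥤ CostructuredArrow G e :=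
  F.toCostructuredArrow G e (fun i => G.map (F.map (homOfLE (Fin.le_last i))) ≫ h)
    (fun {i i'} f => by
      rw [← Category.assoc, ← G.map_comp, ← F.map_comp]
      rfl)

lemma commaFunctor_whiskerLeft {m m' : ℕ} (F : Fin (m + 1) ⥤ C) {e : 𝓔}
    (h : G.obj (F.obj (Fin.last m)) ⟶ e) (θ : Fin (m' + 1) ⥤ Fin (m + 1)) :
    θ ⋙ commaFunctor G F h = commaFunctor G (θ ⋙ F)
      (G.map (F.map (homOfLE (Fin.le_last (θ.obj (Fin.last _))))) ≫ h) := by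
  refine costructuredArrow_functor_ext G (F := θ ⋙ F)
    (X := fun i => ((θ ⋙ commaFunctor G F h).obj i).hom)
    (Y := fun i => ((commaFunctor G (θ ⋙ F)
      (G.map (F.map (homOfLE (Fin.le_last (θ.obj (Fin.last _))))) ≫ h)).obj i).hom)
    (fun f => CostructuredArrow.w ((θ ⋙ commaFunctor G F h).map f))
    (fun f => CostructuredArrow.w ((commaFunctor G (θ ⋙ F) _).map f)) (fun i => ?_) rfl rfl
  change G.map (F.map (homOfLE _)) ≫ h =
    G.map (F.map (θ.map (homOfLE _))) ≫ G.map (F.map (homOfLE _)) ≫ h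
  rw [← Category.assoc, ← G.map_comp, ← F.map_comp]
  rfl

lemma commaFunctor_proj {m : ℕ} {e : 𝓔} (F : Fin (m + 1) ⥤ CostructuredArrow G e) :
    commaFunctor G (F ⋙ CostructuredArrow.proj G e) (F.obj (Fin.last m)).hom = F :=
  costructuredArrow_functor_ext G (F := F ⋙ CostructuredArrow.proj G e)
    (X := fun i => ((commaFunctor G (F ⋙ CostructuredArrow.proj G e)
      (F.obj (Fin.last m)).hom).obj i).hom)
    (Y := fun i => (F.obj i).hom)
    (fun f => CostructuredArrow.w ((commaFunctor G (F ⋙ CostructuredArrow.proj G e)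
      (F.obj (Fin.last m)).hom).map f))
    (fun f => CostructuredArrow.w (F.map f)) (fun i => CostructuredArrow.w (F.map _)) rfl rfl

/-- The nerves of comma categories. -/
def commaNerveIso : (commaNerve.{u} G ι).obj d ≅
    uliftFunctor.{u}.obj (nerve (CostructuredArrow G (ι.obj d))) :=
  NatIso.ofComponents (fun k => Equiv.toIso
    { toFun := fun a => (⟨commaFunctor G (m := k.unop.len) a.down.1 a.down.2⟩ :
        ULift.{u} ((nerve (CostructuredArrow G (ι.obj d))).obj k))
      invFun := fun τ => commaSimplex
        ((nerveMap (CostructuredArrow.proj G (ι.obj d))).app k τ.down) (chainLast τ.down).hom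
      left_inv := fun a => by
        refine congr_arg ULift.up (Sigma.ext rfl (heq_of_eq ?_))
        exact map_chainLastHom_id_comp G a.down.1 a.down.2
      right_inv := fun τ => congr_arg ULift.up (commaFunctor_proj G _) })
    (fun {k k'} θ => by
      refine ConcreteCategory.hom_ext _ _ fun a => ?_
      exact congr_arg ULift.up (commaFunctor_whiskerLeft G _ _ _).symm)

lemma isWeakEquiv_commaNerve
    (h : ∀ {T : SSet.{u}} (_ : IsTerminal T)
      (p : uliftFunctor.{u}.obj (nerve (CostructuredArrow G (ι.obj d))) ⟶ T), IsWeakEquiv p)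
    {T : SSet.{u}} (hT : IsTerminal T) (p : (commaNerve.{u} G ι).obj d ⟶ T) : IsWeakEquiv p := by
  rw [← (commaNerveIso G ι d).hom_inv_id_assoc p]
  exact (IsWeakEquiv.of_isIso _).comp (h hT _)

end Contractible

end

section


/-! ### The comma categories of the diagonal -/

section Diagonal

variable {n J : ℕ} {e : Fin n → SimplexCategory}

/-- The truncated diagonal `p ↦ (p, …, p)`. -/
abbrev truncDiag (n J : ℕ) : SimplexCategory.Truncated J ⥤ (Fin n → SimplexCategory) :=
  SimplexCategory.Truncated.inclusion J ⋙ Functor.pi' (fun _ : Fin n => 𝟭 SimplexCategory)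

/-- The vertices of a simplex of a product of standard simplices. -/
def vertices (a : CostructuredArrow (truncDiag n J) e) :
    Fin (a.left.obj.len + 1) →o (∀ i, Fin ((e i).len + 1)) where
  toFun x i := (show a.left.obj ⟶ e i from a.hom i).toOrderHom x
  monotone' _ _ h i := (show a.left.obj ⟶ e i from a.hom i).toOrderHom.monotone h

def costructuredArrowHomMk {a b : CostructuredArrow (truncDiag n J) e}
    (θ : Fin (a.left.obj.len + 1) →o Fin (b.left.obj.len + 1))
    (h : ∀ x, vertices b (θ x) = vertices a x) : a ⟶ b :=
  CostructuredArrow.homMk (ObjectProperty.homMk (SimplexCategory.Hom.mk θ)) (by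
    funext i
    apply SimplexCategory.Hom.ext
    ext x : 2
    exact congr_fun (h x) i)

lemma vertices_hom {a b : CostructuredArrow (truncDiag n J) e} (f : a ⟶ b)
    (x : Fin (a.left.obj.len + 1)) :
    vertices b (f.left.hom.toOrderHom x) = vertices a x := by
  funext i
  have := congr_fun (CostructuredArrow.w f) i
  exact congr_arg (fun t : a.left.obj ⟶ e i => t.toOrderHom x) this

lemma subsingleton_hom {a b : CostructuredArrow (truncDiag n J) e}
    (hb : Function.Injective (vertices b)) : Subsingleton (a ⟶ b) := by
  refine ⟨fun f g => ?_⟩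
  ext : 2
  ext x : 2
  exact hb ((vertices_hom f x).trans (vertices_hom g x).symm)

/-- As `b` reflects the order of vertices, locating the vertices of `a` among those of `b` is
automatically monotone. -/
lemma nonempty_hom {a b : CostructuredArrow (truncDiag n J) e}
    (hb : ∀ x y, vertices b x ≤ vertices b y → x ≤ y)
    (h : Set.range (vertices a) ⊆ Set.range (vertices b)) : Nonempty (a ⟶ b) := by
  choose θ hθ using fun x => h ⟨x, rfl⟩
  refine ⟨costructuredArrowHomMk ⟨θ, fun x y hxy => hb _ _ ?_⟩ hθ⟩
  rw [hθ, hθ]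
  exact (vertices a).monotone hxy

/-- The sum of the coordinates is strictly increasing along a chain, and takes values between `0`
and `∑ m i`. -/
lemma card_le_of_isChain {ι : Type*} [Fintype ι] {m : ι → ℕ} (R : Finset (∀ i, Fin (m i + 1)))
    (hR : IsChain (· ≤ ·) (R : Set (∀ i, Fin (m i + 1)))) : R.card ≤ ∑ i, m i + 1 := by
  have := Finset.card_le_card_of_injOn (s := R) (t := Finset.range (∑ i, m i + 1))
    (fun x => ∑ i, (x i : ℕ)) (fun x _ => by
      simp only [Finset.coe_range, Set.mem_Iio]
      exact Nat.lt_succ_of_le (Finset.sum_le_sum fun i _ => Fin.is_le (x i))) (by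
      intro x hx y hy hxy
      by_contra hne
      have key : ∀ x y : (∀ i, Fin (m i + 1)), x ≤ y → x ≠ y →
          ∑ i, (x i : ℕ) < ∑ i, (y i : ℕ) := fun x y h hne => by
        obtain ⟨i, hi⟩ := Function.ne_iff.1 hne
        exact Finset.sum_lt_sum (fun i _ => h i) ⟨i, Finset.mem_univ i, lt_of_le_of_ne (h i)
          (fun h => hi (Fin.ext h))⟩
      rcases hR hx hy hne with h | h
      · exact absurd hxy (key x y h hne).ne
      · exact absurd hxy (key y x h (Ne.symm hne)).ne')
  simpa using this

lemma exists_orderEmbedding_range {P : Type*} [PartialOrder P] (R : Finset P) (hne : R.Nonempty)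
    (hR : IsChain (· ≤ ·) (R : Set P)) :
    ∃ (q : ℕ) (γ : Fin (q + 1) ↪o P), q + 1 = R.card ∧ Set.range γ = R := by
  classical
  letI : LinearOrder R :=
    { (inferInstance : PartialOrder R) with
      le_total := fun x y => hR.total x.2 y.2
      toDecidableLE := Classical.decRel _ }
  obtain ⟨q, hq⟩ : ∃ q, R.card = q + 1 := ⟨R.card - 1, (Nat.sub_add_cancel hne.card_pos).symm⟩
  let E : Fin (q + 1) ≃o R := Fintype.orderIsoFinOfCardEq R (by simpa using hq)
  refine ⟨q, E.toOrderEmbedding.trans (OrderEmbedding.subtype (· ∈ R)), hq.symm, ?_⟩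
  ext x
  constructor
  · rintro ⟨i, rfl⟩
    exact (E i).2
  · intro hx
    exact ⟨E.symm ⟨x, hx⟩, by simp⟩

variable (e) in
-- The nondegenerate simplex with vertex set `R` has dimension `R.card - 1`, which is at most `J` by
-- the bound on chains, so the truncation does not exclude it.
lemma exists_costructuredArrow (hJ : ∑ i, (e i).len ≤ J)
    (R : Finset (∀ i, Fin ((e i).len + 1))) (hne : R.Nonempty)
    (hR : IsChain (· ≤ ·) (R : Set (∀ i, Fin ((e i).len + 1)))) :
    ∃ b : CostructuredArrow (truncDiag n J) e,
      (∀ x y, vertices b x ≤ vertices b y → x ≤ y) ∧ Set.range (vertices b) = R := by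
  obtain ⟨q, γ, hq, hγ⟩ := exists_orderEmbedding_range R hne hR
  have hqJ : q ≤ J := by
    have := card_le_of_isChain R hR
    omega
  let p : SimplexCategory.Truncated J := ⟨SimplexCategory.mk q, hqJ⟩
  let b : CostructuredArrow (truncDiag n J) e := CostructuredArrow.mk (Y := p)
    (fun i => (SimplexCategory.Hom.mk ⟨fun x => γ x i, fun x y h => γ.monotone h i⟩ :
      SimplexCategory.mk q ⟶ e i))
  exact ⟨b, fun x y h => γ.le_iff_le.1 h, hγ⟩

/-- Let `F a` be the nondegenerate simplex whose vertices are those of `a` together with the least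
vertex `0`, which is comparable with every vertex. The maps from `a` and from the vertex `0` to `F
a` are a zigzag between the identity and a constant functor. -/
theorem isWeakEquiv_nerve_truncDiag (hJ : ∑ i, (e i).len ≤ J) {T : SSet.{u}} (hT : IsTerminal T)
    (p : uliftFunctor.{u}.obj (nerve (CostructuredArrow (truncDiag n J) e)) ⟶ T) :
    IsWeakEquiv p := by
  classical
  let R : CostructuredArrow (truncDiag n J) e → Finset (∀ i, Fin ((e i).len + 1)) := fun a =>
    insert 0 (Finset.univ.image (vertices a))
  have hR : ∀ a, IsChain (· ≤ ·) (R a : Set (∀ i, Fin ((e i).len + 1))) := fun a => by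
    have h : IsChain (· ≤ ·) (Set.range (vertices a)) := by
      rintro _ ⟨x, rfl⟩ _ ⟨y, rfl⟩ _
      rcases le_total x y with h | h
      · exact Or.inl ((vertices a).monotone h)
      · exact Or.inr ((vertices a).monotone h)
    simp only [R, Finset.coe_insert, Finset.coe_image, Finset.coe_univ, Set.image_univ]
    exact h.insert fun b _ _ => Or.inl fun i => Fin.zero_le _
  choose F hF hF' using fun a => exists_costructuredArrow e hJ (R a) ⟨0, by simp [R]⟩ (hR a)
  obtain ⟨z, hz, hz'⟩ := exists_costructuredArrow (J := J) e hJ {0} ⟨0, by simp⟩ (by simp)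
  refine isWeakEquiv_nerve_of_contraction F
    (fun a b => subsingleton_hom fun x y h => le_antisymm (hF b x y h.le) (hF b y x h.ge))
    (fun a => nonempty_hom (hF a) ?_) (fun a b f => nonempty_hom (hF b) ?_) z
    (fun a => nonempty_hom (hF a) ?_) hT p
  · rw [hF']
    simp [R]
  · rw [hF', hF']
    simp only [R, Finset.coe_insert, Finset.coe_image, Finset.coe_univ, Set.image_univ]
    refine Set.insert_subset_insert ?_
    rintro _ ⟨x, rfl⟩
    exact ⟨_, vertices_hom f x⟩
  · rw [hF', hz']
    simp [R]

end Diagonal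

end

section


/-! ### Truncated multi-indices -/

section Truncated

variable {n : ℕ} {j : Fin n → ℕ}

/-- The category `Δ_{≤ j₁} × ⋯ × Δ_{≤ jₙ}`. -/
abbrev TruncIndex (j : Fin n → ℕ) : Type := ∀ i, SimplexCategory.Truncated (j i)

abbrev truncInclusion (j : Fin n → ℕ) : TruncIndex j ⥤ (Fin n → SimplexCategory) :=
  CategoryTheory.Functor.pi fun i => SimplexCategory.Truncated.inclusion (j i)

/-- The sum of the dimensions. -/
def totalDegree (d : TruncIndex j) : ℕ := ∑ i, (d i).obj.len

lemma totalDegree_le (d : TruncIndex j) : totalDegree d ≤ ∑ i, j i :=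
  Finset.sum_le_sum fun i _ => (d i).property

/-- Maps of truncated multi-indices are maps of multi-indices. -/
def truncIndexHom {d d' : TruncIndex j}
    (f : (truncInclusion j).obj d ⟶ (truncInclusion j).obj d') : d ⟶ d' :=
  fun i => ObjectProperty.homMk (f i)

lemma map_truncIndexHom {d d' : TruncIndex j}
    (f : (truncInclusion j).obj d ⟶ (truncInclusion j).obj d') :
    (truncInclusion j).map (truncIndexHom f) = f := rfl

lemma truncInclusion_map_injective {d d' : TruncIndex j} {f g : d ⟶ d'}
    (h : (truncInclusion j).map f = (truncInclusion j).map g) : f = g := by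
  funext i
  exact ObjectProperty.hom_ext _ (congr_fun h i)

lemma simplexCategory_exists_retraction {a b : SimplexCategory} (f : a ⟶ b) [Mono f] :
    ∃ r : b ⟶ a, f ≫ r = 𝟙 a := by
  classical
  -- `r y` is the largest `x` with `f x ≤ y`; if there is none, the empty supremum gives `0`.
  let r : Fin (b.len + 1) →o Fin (a.len + 1) :=
    ⟨fun y => (Finset.univ.filter fun x => f.toOrderHom x ≤ y).sup id, fun y y' h =>
      Finset.sup_mono fun x hx => by
        simp only [Finset.mem_filter, Finset.mem_univ, true_and] at hx ⊢
        exact hx.trans h⟩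
  have hf : Function.Injective f.toOrderHom := SimplexCategory.mono_iff_injective.1 inferInstance
  have hf' : StrictMono f.toOrderHom := f.toOrderHom.monotone.strictMono_of_injective hf
  have key : ∀ x, r (f.toOrderHom x) = x := fun x => by
    change (Finset.univ.filter fun x' => f.toOrderHom x' ≤ f.toOrderHom x).sup id = x
    refine le_antisymm (Finset.sup_le fun x' hx' => ?_) ?_
    · simpa [hf'.le_iff_le] using hx'
    · exact Finset.le_sup (f := id) (Finset.mem_filter.2 ⟨Finset.mem_univ x, le_rfl⟩)
  refine ⟨SimplexCategory.Hom.mk r, ?_⟩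
  ext x : 3
  exact key x

/-- Images are taken coordinatewise. They embed in the coordinates of `d`, hence respect the
truncation, and embeddings of simplices split. -/
lemma exists_factorization {e : Fin n → SimplexCategory} {d : TruncIndex j}
    (x : e ⟶ (truncInclusion j).obj d) :
    ∃ (d₀ : TruncIndex j) (p : e ⟶ (truncInclusion j).obj d₀) (m : d₀ ⟶ d),
      p ≫ (truncInclusion j).map m = x ∧ (∀ i, Epi (p i)) ∧ IsSplitMono m := by
  have hlen : ∀ i, (image (x i)).len ≤ j i := fun i =>
    (SimplexCategory.len_le_of_mono (image.ι (x i))).trans (d i).property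
  let m : ∀ i, (⟨image (x i), hlen i⟩ : SimplexCategory.Truncated (j i)) ⟶ d i :=
    fun i => ObjectProperty.homMk (image.ι (x i))
  refine ⟨fun i => ⟨image (x i), hlen i⟩, fun i => factorThruImage (x i), m, ?_,
    fun i => inferInstanceAs (Epi (factorThruImage (x i))), ?_⟩
  · funext i
    exact image.fac (x i)
  · choose r hr using fun i => simplexCategory_exists_retraction (image.ι (x i))
    refine IsSplitMono.mk' ⟨fun i => ObjectProperty.homMk (r i), ?_⟩
    funext i
    exact ObjectProperty.hom_ext _ (hr i)

lemma epi_of_forall_epi {e e' : Fin n → SimplexCategory} {p : e ⟶ e'} (hp : ∀ i, Epi (p i)) :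
    Epi p where
  left_cancellation g h hgh := by
    funext i
    exact (cancel_epi (p i)).1 (congr_fun hgh i)

lemma exists_factorization' {d d' : TruncIndex j} (g : d ⟶ d') :
    ∃ (d₀ : TruncIndex j) (p : d ⟶ d₀) (m : d₀ ⟶ d'),
      p ≫ m = g ∧ (∀ i, Epi (p i).hom) ∧ IsSplitMono m := by
  obtain ⟨d₀, p, m, h, hp, hm⟩ := exists_factorization ((truncInclusion j).map g)
  refine ⟨d₀, truncIndexHom p, m, truncInclusion_map_injective ?_, hp, hm⟩
  rw [Functor.map_comp, map_truncIndexHom, h]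

lemma truncIndex_epi {d d' : TruncIndex j} {p : d ⟶ d'} (hp : ∀ i, Epi (p i).hom) : Epi p where
  left_cancellation g h hgh := by
    have := epi_of_forall_epi (p := (truncInclusion j).map p) hp
    refine truncInclusion_map_injective ((cancel_epi ((truncInclusion j).map p)).1 ?_)
    rw [← Functor.map_comp, ← Functor.map_comp, hgh]

lemma NotSplitMono.of_comp {E : Type} [SmallCategory E] {a b c : E} {p : a ⟶ b} {m : b ⟶ c}
    [hm : IsSplitMono m] (h : NotSplitMono (p ≫ m)) : NotSplitMono p := fun hp =>
  h (IsSplitMono.mk' ⟨retraction m ≫ retraction p, by simp⟩)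

/-- If no coordinate dropped, each coordinate of the epimorphic part would be a surjection between
simplices of equal dimension, hence an isomorphism, and the whole map would split. -/
lemma isReedyDegree_totalDegree : IsReedyDegree (totalDegree (j := j)) := by
  intro d d' g hg
  obtain ⟨d₀, p, m, rfl, hp, hm⟩ := exists_factorization' g
  have hp' := hg.of_comp
  refine ⟨d₀, p, m, rfl, truncIndex_epi hp, hp', ?_⟩
  have hle : ∀ i, (d₀ i).obj.len ≤ (d i).obj.len := fun i =>
    have := hp i
    SimplexCategory.len_le_of_epi (p i).hom
  refine Finset.sum_lt_sum (fun i _ => hle i) ?_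
  by_contra hne
  push Not at hne
  have hiso : ∀ i, IsIso (p i).hom := fun i => by
    have := hp i
    have hlen : (d i).obj.len = (d₀ i).obj.len := le_antisymm (hne i (Finset.mem_univ i)) (hle i)
    have hsurj := SimplexCategory.epi_iff_surjective.1 (hp i)
    refine SimplexCategory.isIso_of_bijective ?_
    exact (Fintype.bijective_iff_surjective_and_card _).2 ⟨hsurj, by simp [hlen]⟩
  refine hp' (IsSplitMono.mk' ⟨fun i => ObjectProperty.homMk (inv (p i).hom), ?_⟩)
  funext i
  exact ObjectProperty.hom_ext _ (IsIso.hom_inv_id (p i).hom)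

/-- Every arrow to `ι d` comes from a coordinatewise epimorphism, and epimorphisms are free elements
because they can be cancelled. -/
lemma isGeneratedBelow_homsTo (e : Fin n → SimplexCategory) :
    IsGeneratedBelow (totalDegree (j := j)) ⊤ (homsTo (truncInclusion j) e) := by
  intro d x
  obtain ⟨d₀, p, m, h, hp, -⟩ := exists_factorization (show e ⟶ (truncInclusion j).obj d from x)
  refine ⟨d₀, m, p, h, ENat.natCast_lt_top _, fun d' f g hfg => ?_⟩
  have := epi_of_forall_epi hp
  exact truncInclusion_map_injective ((cancel_epi p).1 hfg)

/-- Reedy fibrant multicosimplicial spaces have fibrant truncated matching maps. -/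
theorem isKanFibration_relMatch_of_isReedyFibrant {Y : CosimplicialSpace.{u} n}
    (hY : IsReedyFibrant Y) (d : TruncIndex j) :
    IsKanFibration (relMatch (terminal.from (truncInclusion j ⋙ Y)) d NotSplitMono) := by
  intro K L i hi
  refine ⟨fun {a v} sq => ?_⟩
  let X := truncInclusion j ⋙ Y
  have hlen : ∀ t : (properDegeneracy ((truncInclusion j).obj d)).FullSubcategory,
      ∀ i, (t.obj.right i).len ≤ j i := fun t i =>
    have := t.property.1 i
    (SimplexCategory.len_le_of_epi
      ((show (truncInclusion j).obj d ⟶ t.obj.right from t.obj.hom) i)).trans (d i).property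
  let tgt : (properDegeneracy ((truncInclusion j).obj d)).FullSubcategory → TruncIndex j :=
    fun t i => ⟨t.obj.right i, hlen t i⟩
  let arr : ∀ t, d ⟶ tgt t := fun t => truncIndexHom (d' := tgt t) t.obj.hom
  have harr : ∀ t, NotSplitMono (arr t) := fun t h => t.property.2 (by
    have h1 : IsSplitMono ((truncInclusion j).map (arr t)) := inferInstance
    have h2 : Epi ((truncInclusion j).map (arr t)) := epi_of_forall_epi t.property.1
    exact isIso_of_epi_of_isSplitMono ((truncInclusion j).map (arr t)))
  -- A proper surjection is not a split monomorphism, so the given values along such arrows restrict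
  -- to a cone over the matching diagram.
  let c : Cone (matchingDiagram Y ((truncInclusion j).obj d)) :=
    { pt := L
      π :=
        { app t := v ≫ relFamProj (terminal.from X) d NotSplitMono (arr t) (harr t)
          naturality t t' f := by
            let g : tgt t ⟶ tgt t' := truncIndexHom (d := tgt t) (d' := tgt t') f.hom.right
            have hg : arr t ≫ g = arr t' := truncInclusion_map_injective (Under.w f.hom)
            have key : ∀ (s : d ⟶ tgt t') (_ : s = arr t') (hs : NotSplitMono s),
                relFamProj (terminal.from X) d NotSplitMono s hs =
                  relFamProj (terminal.from X) d NotSplitMono (arr t') (harr t') := by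
              rintro _ rfl _
              rfl
            have h2 := relFamProj_map (q := terminal.from X) (S := NotSplitMono) (arr t) g (harr t)
              (by rw [hg]; exact harr t')
            rw [key _ hg] at h2
            refine (Category.id_comp _).trans ?_
            rw [← h2]
            exact (Category.assoc _ _ _).symm } }
  obtain ⟨z, hz, hz'⟩ := exists_lift (hY _ i hi) a
    (limit.lift (matchingDiagram Y ((truncInclusion j).obj d)) c) (by
      refine limit.hom_ext fun t => ?_
      rw [matchingMap, Category.assoc, limit.lift_π, Category.assoc, limit.lift_π]
      have := sq.w =≫ relFamProj (terminal.from X) d NotSplitMono (arr t) (harr t)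
      rw [Category.assoc, relMatch_proj, Category.assoc] at this
      exact this)
  have hzt : ∀ t, z ≫ X.map (arr t) =
      v ≫ relFamProj (terminal.from X) d NotSplitMono (arr t) (harr t) := fun t => by
    have := hz' =≫ limit.π _ t
    rw [matchingMap, Category.assoc, limit.lift_π, limit.lift_π] at this
    exact this
  refine ⟨⟨⟨z, hz, mappingPath.abs_hom_ext fun d' g hg => ?_⟩⟩⟩
  rw [Category.assoc, relMatch_proj]
  -- Any arrow that is not a split monomorphism factors through a proper surjection, where the lift
  -- is already known to be correct.
  obtain ⟨d₀, p, m, rfl, hp, hm⟩ := exists_factorization' g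
  have hp' := hg.of_comp
  let t : (properDegeneracy ((truncInclusion j).obj d)).FullSubcategory :=
    ⟨Under.mk ((truncInclusion j).map p), hp, fun h => hp' (by
      have h' : IsIso ((truncInclusion j).map p) := h
      refine IsSplitMono.mk' ⟨truncIndexHom (inv ((truncInclusion j).map p)), ?_⟩
      apply truncInclusion_map_injective
      rw [(truncInclusion j).map_comp, map_truncIndexHom, IsIso.hom_inv_id, (truncInclusion j).map_id])⟩
  have h3 := hzt t =≫ X.map m
  rw [Functor.map_comp, ← relFamProj_map p m hp' hg]
  rw [Category.assoc, Category.assoc] at h3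
  exact h3

end Truncated

end

section



/-! ### Reedy fibrant replacements -/

section Discrete

variable {E : Type} [SmallCategory E]

/-- The functor represented by `b` is freely generated by the identity, so lifting families indexed
by it and evaluating at the identity solves a lifting problem at `b`. -/
theorem kanComplex_of_isKanFibration_relMatch {X : E ⥤ SSet.{u}} {deg : E → ℕ}
    (hdeg : IsReedyDegree deg)
    (hX : ∀ b, IsKanFibration (relMatch (terminal.from X) b NotSplitMono)) (b : E) :
    KanComplex (X.obj b) := by
  rw [← isKanFibration_terminal_app_iff]
  intro K L i hi
  refine ⟨fun {a v} _ => ?_⟩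
  have hT : ∀ e, IsTerminal ((⊤_ (E ⥤ SSet.{u})).obj e) := fun e =>
    IsTerminal.isTerminalObj ((evaluation E SSet.{u}).obj e) _ terminalIsTerminal
  obtain ⟨z, -, hz, -⟩ := exists_family_lift (j := i) (q := terminal.from X) hdeg (N := ⊤)
    (F := coyoneda.obj (op b))
    (fun e x => ⟨b, x, 𝟙 b, Category.id_comp _, ENat.natCast_lt_top _, fun e' f g hfg => by
      have : 𝟙 b ≫ f = 𝟙 b ≫ g := hfg
      rwa [Category.id_comp, Category.id_comp] at this⟩)
    (fun d _ => hX d i hi) (fun e t => a ≫ X.map t) (fun e _ => (hT e).from L)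
    (fun e e' g t => by
      rw [Category.assoc]
      exact congr_arg (a ≫ ·) (X.map_comp _ _)) (fun e e' g t => (hT e').hom_ext _ _)
    (fun e t => (hT e).hom_ext _ _)
  refine ⟨⟨⟨z (𝟙 b), ?_, (hT b).hom_ext _ _⟩⟩⟩
  rw [hz, X.map_id, Category.comp_id]

/-- A diagram of sets, seen as a diagram of discrete simplicial sets. -/
def discrete (F : E ⥤ Type) : E ⥤ SSet.{u} :=
  F ⋙ uliftFunctor.{u, 0} ⋙ Functor.const _

def discreteMap {F G : E ⥤ Type} (α : F ⟶ G) : discrete.{u} F ⟶ discrete G :=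
  Functor.whiskerRight α _

lemma mono_discreteMap_app {F G : E ⥤ Type} (α : F ⟶ G)
    (hα : ∀ e, Function.Injective (α.app e)) (e : E) : Mono ((discreteMap.{u} α).app e) := by
  have : ∀ k, Mono (((discreteMap.{u} α).app e).app k) := fun k => by
    rw [mono_iff_injective]
    exact ULift.map_injective.2 (hα e)
  exact NatTrans.mono_of_mono_app _

/-- The inclusion of the maps from `b` which are not split monomorphisms. -/
def nonSplitInclusion (b : E) : nonSplit b ⟶ coyoneda.obj (op b) where
  app e := ↾fun f => f.1

def discreteDesc {F : E ⥤ Type} {L : SSet.{u}} {M : E ⥤ SSet.{u}}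
    (y : ∀ ⦃e⦄, F.obj e → (L ⟶ M.obj e))
    (hy : ∀ ⦃e e'⦄ (g : e ⟶ e') (t : F.obj e), y (F.map g t) = y t ≫ M.map g) :
    discrete F ⊗ (Functor.const E).obj L ⟶ M :=
  diagHomMk (fun _ m f x => (y f.down).app m x)
    (fun _ _ _ θ f x => NatTrans.naturality_apply (y f.down) θ x)
    (fun g m f x => ConcreteCategory.congr_hom (NatTrans.congr_app (hy g f.down) m) x)

/-- By Yoneda, maps to `M` from the discrete diagram on the arrows out of `b`, tensored with `L`,
are maps `L ⟶ M b`. Restricting to arrows that are not split monomorphisms gives maps to the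
matching object. This is what makes Reedy fibrancy accessible to the small object argument. -/
theorem isKanFibration_relMatch_of_hasLiftingProperty {M : E ⥤ SSet.{u}} (b : E)
    (h : ∀ n (k : Fin (n + 2)), HasLiftingProperty
      (diagLeibniz (discreteMap.{u} (nonSplitInclusion b)) Λ[n + 1, k].ι).ι (terminal.from M)) :
    IsKanFibration (relMatch (terminal.from M) b NotSplitMono) := by
  intro K L i hi
  simp only [modelCategoryQuillen.J, MorphismProperty.iSup_iff] at hi
  obtain ⟨n, ⟨k⟩⟩ := hi
  refine ⟨fun {a v} sq => ?_⟩
  have hsq : ∀ {e : E} (f : b ⟶ e) (hf : NotSplitMono f),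
      Λ[n + 1, k].ι ≫ v ≫ relFamProj (terminal.from M) b NotSplitMono f hf = a ≫ M.map f :=
    fun f hf => by
      have := sq.w =≫ relFamProj (terminal.from M) b NotSplitMono f hf
      rw [Category.assoc, relMatch_proj, Category.assoc] at this
      exact this.symm
  obtain ⟨φ, h1, h2, -⟩ := exists_lift_diagLeibniz (h n k)
    (discreteDesc (F := nonSplit b)
      (fun e f => v ≫ relFamProj (terminal.from M) b NotSplitMono f.1 f.2) (fun e e' g t => by
        rw [Category.assoc, relFamProj_map t.1 g t.2 ((nonSplit b).map g t).2]
        rfl))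
    (discreteDesc (F := coyoneda.obj (op b)) (fun e f => a ≫ M.map f) (fun e e' g t => by
      rw [Category.assoc]
      exact congr_arg (a ≫ ·) (M.map_comp _ _)))
    (terminal.from _) (by
      refine diag_hom_ext fun e m f x => ?_
      exact ConcreteCategory.congr_hom (NatTrans.congr_app (hsq f.down.1 f.down.2) m) x)
    (Subsingleton.elim _ _) (Subsingleton.elim _ _)
  let z : Δ[n + 1] ⟶ M.obj b :=
    { app m := ↾fun x => diagApp φ (e := b) ⟨𝟙 b⟩ x
      naturality m m' θ := by
        ext x
        exact (map_diagApp' φ θ ⟨𝟙 b⟩ x).symm }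
  refine ⟨⟨⟨z, ?_, mappingPath.abs_hom_ext fun e f hf => ?_⟩⟩⟩
  · ext m x
    refine (congr_arg (fun ψ => diagApp (A := discrete (coyoneda.obj (op b))) ψ (e := b) ⟨𝟙 b⟩ x) h2).trans ?_
    change (a ≫ M.map (𝟙 b)).app m x = _
    rw [M.map_id, Category.comp_id]
    rfl
  · rw [Category.assoc, relMatch_proj]
    ext m x
    refine (map_diagApp φ f (k := m) ⟨𝟙 b⟩ x).trans ?_
    have hf' : ((discrete (coyoneda.obj (op b))).map f).app m ⟨𝟙 b⟩ =
      ((discreteMap.{u} (nonSplitInclusion b)).app e).app m ⟨⟨f, hf⟩⟩ :=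
        congr_arg ULift.up (Category.id_comp f)
    refine (congr_arg (fun t => diagApp φ (e := e) t x) hf').trans ?_
    exact congr_arg (fun ψ => diagApp (A := discrete (nonSplit b)) ψ (e := e) ⟨⟨f, hf⟩⟩ x) h1

end Discrete

end

/-! ### Common replacements of weakly equivalent diagrams -/

section



section Replacement

variable {E : Type} [SmallCategory E]

lemma acyclic_inl_app_of_isPushout {A B X P : E ⥤ SSet.{u}} {f : A ⟶ X} {g : A ⟶ B} {i : X ⟶ P}
    {i' : B ⟶ P} (h : IsPushout f g i i') {e : E} (hg : acyclic (g.app e)) :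
    acyclic (i.app e) :=
  acyclic.of_isPushout (h.map ((evaluation E SSet.{u}).obj e)) hg

/-- The maps from a diagram and from the point to the cone on the diagram. -/
def coneEnd (V : E ⥤ SSet.{u}) (b : Bool) : E ⥤ SSet.{u} :=
  match b with
  | true => V
  | false => ⊤_ _

def coneEndInclusion (V : E ⥤ SSet.{u}) (b : Bool) :
    coneEnd V b ⟶ mappingCylinder (terminal.from V) :=
  match b with
  | true => mappingCylinder.inl _
  | false => mappingCylinder.inr _

lemma mono_coneEndInclusion_app (V : E ⥤ SSet.{u}) (b : Bool) (e : E) :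
    Mono ((coneEndInclusion V b).app e) :=
  match b with
  | true => mappingCylinder.mono_inl_app _ _
  | false => mappingCylinder.mono_inr_app _ _

lemma isWeakEquiv_coneEndInclusion_app (V : E ⥤ SSet.{u}) (b : Bool) (e : E)
    (hV : IsWeakEquiv ((terminal.from V).app e)) : IsWeakEquiv ((coneEndInclusion V b).app e) :=
  match b with
  | true => mappingCylinder.isWeakEquiv_inl_app _ hV
  | false => mappingCylinder.isWeakEquiv_inr_app _ _

/-- Two diagrams weakly equivalent to a third one have a common Reedy fibrant replacement that does
not distinguish between given contractible diagrams. -/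
theorem exists_common_replacement {V W Y Y₁ Y₂ : E ⥤ SSet.{u}} (f : Y ⟶ Y₁) (g : Y ⟶ Y₂)
    (hf : ∀ e, IsWeakEquiv (f.app e)) (hg : ∀ e, IsWeakEquiv (g.app e))
    (hV : ∀ e, IsWeakEquiv ((terminal.from V).app e))
    (hW : ∀ e, IsWeakEquiv ((terminal.from W).app e)) :
    ∃ (M : E ⥤ SSet.{u}) (t₁ : Y₁ ⟶ M) (t₂ : Y₂ ⟶ M), (∀ e, IsWeakEquiv (t₁.app e)) ∧
      (∀ e, IsWeakEquiv (t₂.app e)) ∧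
      (∀ b, IsKanFibration (relMatch (terminal.from M) b NotSplitMono)) ∧
      WeaklyEquivalent ((mapSp V).obj M) ((mapSp W).obj M) := by
  -- The double mapping cylinder of `f` and `g`: objectwise, the inclusion of `Y` in the mapping
  -- cylinder of `g` is a monomorphism and a weak equivalence, so its pushout is acyclic and both
  -- `Y₁` and `Y₂` map to `X` by weak equivalences.
  let X := pushout f (mappingCylinder.inl g)
  have hX : IsPushout f (mappingCylinder.inl g) (pushout.inl f (mappingCylinder.inl g))
    (pushout.inr f (mappingCylinder.inl g)) := .of_hasPushout _ _
  have hX₁ : ∀ e, IsWeakEquiv ((pushout.inl f (mappingCylinder.inl g)).app e) := fun e =>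
    (acyclic_inl_app_of_isPushout hX
      (acyclic_of_mono (mappingCylinder.isWeakEquiv_inl_app _ (hg e)))).isWeakEquiv
  have hX₂ : ∀ e, IsWeakEquiv ((pushout.inr f (mappingCylinder.inl g)).app e) := fun e => by
    refine (mappingCylinder.isWeakEquiv_inl_app g (hg e)).of_comp_left ?_
    rw [← NatTrans.comp_app, ← hX.w, NatTrans.comp_app]
    exact (hf e).comp (hX₁ e)
  obtain ⟨M, t, ht, hM, hM'⟩ := exists_fibrant_replacement X
    (a := fun i : Bool × Bool => coneEndInclusion (cond i.1 V W) i.2)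
    (fun i e => mono_coneEndInclusion_app _ _ _)
    (fun i e => isWeakEquiv_coneEndInclusion_app _ _ _ (by obtain ⟨_ | _, _⟩ := i; exacts [hW e, hV e]))
    (fun b : E => discreteMap.{u} (nonSplitInclusion b))
    (fun b e => mono_discreteMap_app _ (fun e => Subtype.val_injective) e)
  refine ⟨M, pushout.inl f (mappingCylinder.inl g) ≫ t,
    mappingCylinder.inr g ≫ pushout.inr f (mappingCylinder.inl g) ≫ t,
    fun e => (hX₁ e).comp (ht e).isWeakEquiv,
    fun e => (mappingCylinder.isWeakEquiv_inr_app g e).comp ((hX₂ e).comp (ht e).isWeakEquiv),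
    fun b => isKanFibration_relMatch_of_hasLiftingProperty b (hM' b), ?_⟩
  -- Restriction from the cone to either of its ends is a trivial fibration of mapping spaces into
  -- `M`, so each contractible diagram has the same mapping space as the point.
  have key : ∀ i : Bool, WeaklyEquivalent ((mapSp (cond i V W)).obj M)
      ((mapSp (⊤_ _)).obj M) := fun i =>
    .trans _ _ _
      (.symm _ _ (.rel _ _ ⟨_, (isTrivialFibration_mapSpPre _ (hM (i, true))).isWeakEquiv⟩))
      (.rel _ _ ⟨_, (isTrivialFibration_mapSpPre _ (hM (i, false))).isWeakEquiv⟩)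
  exact .trans _ _ _ (key true) (.symm _ _ (key false))

end Replacement

end

section



/-! ### The Fubini theorem for mapping spaces -/

section Fubini

variable {C D E : Type} [SmallCategory C] [SmallCategory D] [SmallCategory E]

/-- The external product of two diagrams. -/
def extProd (A : C ⥤ SSet.{u}) (B : D ⥤ SSet.{u}) : C × D ⥤ SSet.{u} :=
  (CategoryTheory.Prod.fst C D ⋙ A) ⊗ (CategoryTheory.Prod.snd C D ⋙ B)

variable {A : C ⥤ SSet.{u}} {B : D ⥤ SSet.{u}} {X Y : C ⥤ D ⥤ SSet.{u}} {K L : SSet.{u}}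
  {m : SimplexCategoryᵒᵖ}

/-- The value of a map from an external product. -/
def extApp (ψ : extProd A B ⊗ (Functor.const (C × D)).obj K ⟶
    CategoryTheory.Functor.uncurry.obj X) {c : C} {d : D} (a : (A.obj c).obj m)
    (b : (B.obj d).obj m) (x : K.obj m) : ((X.obj c).obj d).obj m :=
  diagApp ψ (e := (c, d)) (a, b) x

lemma map_app_extApp (ψ : extProd A B ⊗ (Functor.const (C × D)).obj K ⟶
    CategoryTheory.Functor.uncurry.obj X) {c c' : C} (f : c ⟶ c') {d : D} (a : (A.obj c).obj m)
    (b : (B.obj d).obj m) (x : K.obj m) :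
    ((X.map f).app d).app m (extApp ψ a b x) = extApp ψ ((A.map f).app m a) b x := by
  have h := map_diagApp ψ (e := (c, d)) (e' := (c', d)) (f, 𝟙 d) (k := m) (a, b) x
  have h1 : (CategoryTheory.Functor.uncurry.obj X).map
      ((f, 𝟙 d) : ((c, d) : C × D) ⟶ (c', d)) = (X.map f).app d :=
    (congr_arg _ ((X.obj c').map_id d)).trans (Category.comp_id _)
  have h2 : ((extProd A B).map ((f, 𝟙 d) : ((c, d) : C × D) ⟶ (c', d))).app m (a, b) =
      ((A.map f).app m a, b) := by
    have hb : (B.map (𝟙 d)).app m b = b := by rw [B.map_id]; rfl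
    exact Prod.ext rfl hb
  rw [h1, h2] at h
  exact h

lemma obj_map_extApp (ψ : extProd A B ⊗ (Functor.const (C × D)).obj K ⟶
    CategoryTheory.Functor.uncurry.obj X) {c : C} {d d' : D} (g : d ⟶ d') (a : (A.obj c).obj m)
    (b : (B.obj d).obj m) (x : K.obj m) :
    ((X.obj c).map g).app m (extApp ψ a b x) = extApp ψ a ((B.map g).app m b) x := by
  have h := map_diagApp ψ (e := (c, d)) (e' := (c, d')) (𝟙 c, g) (k := m) (a, b) x
  have h1 : (CategoryTheory.Functor.uncurry.obj X).map
      ((𝟙 c, g) : ((c, d) : C × D) ⟶ (c, d')) = (X.obj c).map g :=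
    (congr_arg (fun t : X.obj c ⟶ X.obj c => t.app d ≫ (X.obj c).map g) (X.map_id c)).trans
      (Category.id_comp _)
  have h2 : ((extProd A B).map ((𝟙 c, g) : ((c, d) : C × D) ⟶ (c, d'))).app m (a, b) =
      (a, (B.map g).app m b) := by
    have ha : (A.map (𝟙 c)).app m a = a := by rw [A.map_id]; rfl
    exact Prod.ext ha rfl
  rw [h1, h2] at h
  exact h

lemma map_extApp (ψ : extProd A B ⊗ (Functor.const (C × D)).obj K ⟶
    CategoryTheory.Functor.uncurry.obj X) {c : C} {d : D} {m' : SimplexCategoryᵒᵖ} (θ : m ⟶ m')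
    (a : (A.obj c).obj m) (b : (B.obj d).obj m) (x : K.obj m) :
    ((X.obj c).obj d).map θ (extApp ψ a b x) =
      extApp ψ ((A.obj c).map θ a) ((B.obj d).map θ b) (K.map θ x) :=
  map_diagApp' ψ (e := (c, d)) θ (a, b) x

lemma ext_hom_ext {ψ ψ' : extProd A B ⊗ (Functor.const (C × D)).obj K ⟶
    CategoryTheory.Functor.uncurry.obj X}
    (h : ∀ (c : C) (d : D) (m : SimplexCategoryᵒᵖ) (a : (A.obj c).obj m) (b : (B.obj d).obj m)
      (x : K.obj m), extApp ψ a b x = extApp ψ' a b x) : ψ = ψ' :=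
  diagApp_ext fun e k a x => h e.1 e.2 k a.1 a.2 x

/-- The value of a map to a diagram of mapping spaces. -/
def iterApp (φ : A ⊗ (Functor.const C).obj K ⟶ X ⋙ mapSp B) {c : C} {d : D}
    (a : (A.obj c).obj m) (b : (B.obj d).obj m) (x : K.obj m) : ((X.obj c).obj d).obj m :=
  diagApp (mapSpDesc (φ.app c)) b (a, x)

lemma obj_map_iterApp (φ : A ⊗ (Functor.const C).obj K ⟶ X ⋙ mapSp B) {c : C} {d d' : D}
    (g : d ⟶ d') (a : (A.obj c).obj m) (b : (B.obj d).obj m) (x : K.obj m) :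
    ((X.obj c).map g).app m (iterApp φ a b x) = iterApp φ a ((B.map g).app m b) x :=
  map_diagApp (mapSpDesc (φ.app c)) g b (a, x)

lemma map_iterApp (φ : A ⊗ (Functor.const C).obj K ⟶ X ⋙ mapSp B) {c : C} {d : D}
    {m' : SimplexCategoryᵒᵖ} (θ : m ⟶ m')
    (a : (A.obj c).obj m) (b : (B.obj d).obj m) (x : K.obj m) :
    ((X.obj c).obj d).map θ (iterApp φ a b x) =
      iterApp φ ((A.obj c).map θ a) ((B.obj d).map θ b) (K.map θ x) :=
  map_diagApp' (mapSpDesc (φ.app c)) θ b (a, x)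

lemma map_app_iterApp (φ : A ⊗ (Functor.const C).obj K ⟶ X ⋙ mapSp B) {c c' : C} (f : c ⟶ c')
    {d : D} (a : (A.obj c).obj m) (b : (B.obj d).obj m) (x : K.obj m) :
    ((X.map f).app d).app m (iterApp φ a b x) = iterApp φ ((A.map f).app m a) b x := by
  have h : mapSpDesc (φ.app c) ≫ X.map f =
      B ◁ (Functor.const D).map (A.map f ▷ K) ≫ mapSpDesc (φ.app c') :=
    (mapSpDesc_comp_map (K := A.obj c ⊗ K) (φ.app c) (X.map f)).symm.trans
      ((congr_arg mapSpDesc (φ.naturality f).symm).trans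
        (mapSpDesc_comp (A.map f ▷ K) (φ.app c')))
  exact congr_arg (fun ψ => diagApp (A := B) (K := A.obj c ⊗ K) ψ b (a, x)) h

lemma iter_hom_ext {φ φ' : A ⊗ (Functor.const C).obj K ⟶ X ⋙ mapSp B}
    (h : ∀ (c : C) (d : D) (m : SimplexCategoryᵒᵖ) (a : (A.obj c).obj m) (b : (B.obj d).obj m)
      (x : K.obj m), iterApp φ a b x = iterApp φ' a b x) : φ = φ' :=
  NatTrans.ext (funext fun c => mapSpDesc_injective (diagApp_ext fun d m b x =>
    h c d m x.1 b x.2))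

def fubiniSlice (ψ : extProd A B ⊗ (Functor.const (C × D)).obj K ⟶
    CategoryTheory.Functor.uncurry.obj X) (c : C) :
    B ⊗ (Functor.const D).obj (A.obj c ⊗ K) ⟶ X.obj c :=
  diagHomMk (fun _ _ b x => extApp ψ x.1 b x.2)
    (fun _ _ _ θ b x => (map_extApp ψ θ x.1 b x.2).symm)
    (fun g _ b x => (obj_map_extApp ψ g x.1 b x.2).symm)

variable (A B X K) in
/-- Maps from an external product are maps to the diagram of mapping spaces. -/
def fubiniEquiv : (extProd A B ⊗ (Functor.const (C × D)).obj K ⟶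
      CategoryTheory.Functor.uncurry.obj X) ≃
    (A ⊗ (Functor.const C).obj K ⟶ X ⋙ mapSp B) where
  toFun ψ :=
    { app c := mapSpLift (fubiniSlice ψ c)
      naturality c c' f := by
        apply mapSpDesc_injective
        refine (mapSpDesc_comp (A.map f ▷ K) (mapSpLift (fubiniSlice ψ c'))).trans ?_
        refine Eq.trans ?_ (mapSpDesc_comp_map (mapSpLift (fubiniSlice ψ c)) (X.map f)).symm
        rw [mapSpDesc_lift, mapSpDesc_lift]
        exact diagApp_ext fun d m b x => (map_app_extApp ψ f x.1 b x.2).symm }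
  invFun φ := diagHomMk (fun _ _ a x => iterApp φ a.1 a.2 x)
    (fun _ _ _ θ a x => (map_iterApp φ θ a.1 a.2 x).symm)
    (fun {e e'} g m a x => by
      refine Eq.symm ((congr_arg (((X.obj e'.1).map g.2).app m)
        (map_app_iterApp φ g.1 a.1 a.2 x)).trans ?_)
      exact obj_map_iterApp φ g.2 _ a.2 x)
  left_inv ψ := by
    refine ext_hom_ext fun c d m a b x => ?_
    change diagApp (mapSpDesc (mapSpLift (fubiniSlice ψ c))) b (a, x) = _
    rw [mapSpDesc_lift]
    rfl
  right_inv φ := by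
    refine iter_hom_ext fun c d m a b x => ?_
    refine (congr_arg (fun ψ => diagApp (A := B) (K := A.obj c ⊗ K) ψ b (a, x))
      (mapSpDesc_lift _)).trans ?_
    rfl

lemma iterApp_fubiniEquiv (ψ : extProd A B ⊗ (Functor.const (C × D)).obj K ⟶
    CategoryTheory.Functor.uncurry.obj X) {c : C} {d : D}
    (a : (A.obj c).obj m) (b : (B.obj d).obj m) (x : K.obj m) :
    iterApp (fubiniEquiv A B X K ψ) a b x = extApp ψ a b x := by
  refine (congr_arg (fun ψ => diagApp (A := B) (K := A.obj c ⊗ K) ψ b (a, x))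
      (mapSpDesc_lift _)).trans ?_
  rfl

variable (A B) in
/-- The mapping space of an external product is an iterated mapping space. -/
def fubiniIso : CategoryTheory.Functor.uncurry ⋙ mapSp (extProd A B) ≅
    (Functor.whiskeringRight C _ _).obj (mapSp B) ⋙ mapSp A :=
  NatIso.ofComponents
    (fun X => NatIso.ofComponents (fun k => (fubiniEquiv A B X (stdSimplex.obj k.unop)).toIso)
      (fun {k k'} θ => by
        refine ConcreteCategory.hom_ext _ _ fun ψ => iter_hom_ext fun c d m a b x => ?_
        refine (iterApp_fubiniEquiv _ a b x).trans ?_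
        exact (iterApp_fubiniEquiv (X := X) (K := stdSimplex.obj k.unop) ψ a b
          ((SSet.stdSimplex.map θ.unop).app m x)).symm))
    (fun {X Y} f => by
      refine NatTrans.ext (funext fun k => ConcreteCategory.hom_ext _ _ fun ψ =>
        iter_hom_ext fun c d m a b x => ?_)
      refine (iterApp_fubiniEquiv _ a b x).trans ?_
      exact congr_arg (((f.app c).app d).app m) (iterApp_fubiniEquiv (X := X)
        (K := stdSimplex.obj k.unop) ψ a b x).symm)

end Fubini

end

/-! ### Iterated homotopy limits as single mapping spaces -/

section



section Iterated

section Whisker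

variable {C D E : Type} [SmallCategory C] [SmallCategory D] [SmallCategory E]

/-- Mapping spaces of diagrams are invariant under restriction along an equivalence. -/
def mapSpWhiskerIso (π : E ⥤ C) [π.IsEquivalence] (A : C ⥤ SSet.{u}) :
    mapSp A ≅ (Functor.whiskeringLeft E C SSet.{u}).obj π ⋙ mapSp (π ⋙ A) :=
  NatIso.ofComponents
    (fun X => NatIso.ofComponents (fun k =>
      ((Functor.FullyFaithful.ofFullyFaithful
        ((Functor.whiskeringLeft E C SSet.{u}).obj π)).homEquiv
          (X := A ⊗ (Functor.const C).obj (SSet.stdSimplex.{u}.obj k.unop)) (Y := X)).toIso)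
      (fun {k k'} θ => rfl))
    (fun {X Y} f => rfl)

variable {e : E} (he : IsInitial e)

/-- Maps from the constant diagram at a point are simplices at an initial object. -/
def mapSpUnitEquiv (X : E ⥤ SSet.{u}) (k : SimplexCategoryᵒᵖ) :
    ((mapSp (𝟙_ (E ⥤ SSet.{u}))).obj X).obj k ≃ (X.obj e).obj k where
  toFun s := diagApp (mapSpHom s) (e := e) (k := k) PUnit.unit (idSimplex k)
  invFun x := diagHomMk (A := 𝟙_ (E ⥤ SSet.{u})) (K := SSet.stdSimplex.{u}.obj k.unop)
    (fun d m _ t => (yonedaEquiv.symm x ≫ X.map (he.to d)).app m t)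
    (fun d m m' θ _ t => NatTrans.naturality_apply (yonedaEquiv.symm x ≫ X.map (he.to d)) θ t)
    (fun {d d'} g m _ t => by
      have : yonedaEquiv.symm x ≫ X.map (he.to d') =
        (yonedaEquiv.symm x ≫ X.map (he.to d)) ≫ X.map g := by
        rw [Category.assoc, ← X.map_comp, he.hom_ext (he.to d ≫ g) (he.to d')]
      exact ConcreteCategory.congr_hom (NatTrans.congr_app this m) t)
  left_inv s := by
    refine diagApp_ext fun d m a t => ?_
    obtain ⟨t, rfl⟩ := stdSimplex.objEquiv.symm.surjective t
    change (X.map (he.to d)).app m ((X.obj e).map t.op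
      (diagApp (mapSpHom s) (e := e) (k := k) PUnit.unit (idSimplex k))) = _
    refine (congr_arg ((X.map (he.to d)).app m) (map_diagApp' (mapSpHom s) t.op _ _)).trans ?_
    refine (map_diagApp (mapSpHom s) (he.to d) _ _).trans ?_
    exact congr_arg (diagApp (mapSpHom s) (e := d) a)
      (congr_arg stdSimplex.objEquiv.symm (Category.comp_id t))
  right_inv x := by
    have h : X.map (he.to e) = 𝟙 _ := by rw [he.hom_ext (he.to e) (𝟙 e), X.map_id]
    change (X.map (he.to e)).app k ((X.obj e).map (𝟙 _) x) = x
    rw [h, (X.obj e).map_id_apply]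
    rfl

/-- The limit over a category with an initial object, as a mapping space. -/
def mapSpUnitIso : mapSp (𝟙_ (E ⥤ SSet.{u})) ≅ (evaluation E SSet.{u}).obj e :=
  NatIso.ofComponents
    (fun X => NatIso.ofComponents (fun k => (mapSpUnitEquiv he X k).toIso)
      (fun {k k'} θ => by
        refine ConcreteCategory.hom_ext _ _ fun s => ?_
        refine Eq.trans ?_ (map_diagApp' (mapSpHom s) (e := e) (k := k) θ PUnit.unit
          (idSimplex k)).symm
        exact congr_arg (diagApp (mapSpHom s) (e := e) (k := k') PUnit.unit)
          (congr_arg stdSimplex.objEquiv.symm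
            ((Category.id_comp θ.unop).trans (Category.comp_id θ.unop).symm))))
    (fun {X Y} f => rfl)

end Whisker

variable {n : ℕ}

/-- Split off the first coordinate of a truncated multi-index. -/
def splitFirst (j : Fin (n + 1) → ℕ) :
    TruncIndex j ⥤ SimplexCategory.Truncated (j 0) × TruncIndex fun i => j i.succ :=
  Functor.prod' (Pi.eval _ 0)
    { obj e i := e i.succ
      map f i := f i.succ }

instance (j : Fin (n + 1) → ℕ) : (splitFirst j).IsEquivalence where
  faithful := ⟨fun {e e' f g} h => by
    funext i
    refine Fin.cases ?_ (fun i => ?_) i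
    · exact congr_arg Prod.fst h
    · exact congr_fun (congr_arg Prod.snd h) i⟩
  full := ⟨fun {e e'} f => ⟨fun i => Fin.cases (motive := fun i => e i ⟶ e' i) f.1 f.2 i, rfl⟩⟩
  essSurj := ⟨fun c => ⟨fun i => Fin.cases (motive := fun i => SimplexCategory.Truncated (j i))
    c.1 c.2 i, ⟨Iso.refl _⟩⟩⟩

/-- The external product of the nerves of over-categories of the factors. -/
def iteratedNerve : ∀ (n : ℕ) (j : Fin n → ℕ), TruncIndex j ⥤ SSet.{u} := fun n j =>
  match n, j with
  | 0, _ => 𝟙_ _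
  | n + 1, j => splitFirst j ⋙ extProd (overNerve _) (iteratedNerve n fun i => j i.succ)

/-- By induction the remaining factors can be collapsed, products preserving weak equivalences, and
the first factor is the nerve of a category with a terminal object. -/
theorem isWeakEquiv_iteratedNerve (j : Fin n → ℕ) (d : TruncIndex j) {T : SSet.{u}}
    (hT : IsTerminal T) (p : (iteratedNerve n j).obj d ⟶ T) : IsWeakEquiv p := by
  induction n generalizing T with
  | zero =>
    have h : p = ((isTerminalTensorUnit (C := SSet.{u})).uniqueUpToIso hT).hom := hT.hom_ext _ _
    have h' : IsWeakEquiv ((isTerminalTensorUnit (C := SSet.{u})).uniqueUpToIso hT).hom :=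
      .of_isIso _
    exact h ▸ h'
  | succ n ih =>
    let V := (overNerve.{u} (SimplexCategory.Truncated (j 0))).obj (d 0)
    let B := (iteratedNerve.{u} n fun i => j i.succ).obj fun i => d i.succ
    have h : p = (V ◁ toUnit B ≫ (ρ_ V).hom) ≫ hT.from V := hT.hom_ext _ _
    rw [h]
    exact (((ih _ _ isTerminalTensorUnit _).whiskerLeft V).comp (.of_isIso _)).comp
      (isWeakEquiv_overNerve _ hT _)

/-- A multi-index is determined by its first and its remaining coordinates. -/
def consIso (m : Fin (n + 1) → SimplexCategory) :
    ((consFunctor n).obj (m 0)).obj (fun i => m i.succ) ≅ m where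
  hom i := Fin.cases (motive := fun i => (Fin.cons (m 0) (fun i => m i.succ) :
    Fin (n + 1) → SimplexCategory) i ⟶ m i) (𝟙 _) (fun _ => 𝟙 _) i
  inv i := Fin.cases (motive := fun i => m i ⟶ (Fin.cons (m 0) (fun i => m i.succ) :
    Fin (n + 1) → SimplexCategory) i) (𝟙 _) (fun _ => 𝟙 _) i
  hom_inv_id := by
    funext i
    exact Fin.cases (Category.comp_id (𝟙 (m 0))) (fun k => Category.comp_id (𝟙 (m k.succ))) i
  inv_hom_id := by
    funext i
    exact Fin.cases (Category.comp_id (𝟙 (m 0))) (fun k => Category.comp_id (𝟙 (m k.succ))) i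

lemma consIso_naturality {m m' : Fin (n + 1) → SimplexCategory} (f : m ⟶ m') :
    (((consFunctor n).map (f 0)).app (fun i => m i.succ) ≫
      ((consFunctor n).obj (m' 0)).map (Y := fun i => m' i.succ) (fun i => f i.succ)) ≫
        (consIso m').hom = (consIso m).hom ≫ f := by
  funext i
  refine Fin.cases ?_ (fun k => ?_) i
  · change (f 0 ≫ 𝟙 _) ≫ 𝟙 _ = 𝟙 _ ≫ f 0
    simp
  · change (𝟙 _ ≫ f k.succ) ≫ 𝟙 _ = 𝟙 _ ≫ f k.succ
    simp

/-- Restriction to truncated multi-indices, one direction at a time. -/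
def restrictionIso (j : Fin (n + 1) → ℕ) :
    (slice.{u} n ⋙ (Functor.whiskeringRight SimplexCategory _ _).obj
      ((Functor.whiskeringLeft _ _ _).obj (truncInclusion fun i => j i.succ)) ⋙
      (Functor.whiskeringLeft _ _ _).obj (SimplexCategory.Truncated.inclusion (j 0))) ⋙
      CategoryTheory.Functor.uncurry ⋙ (Functor.whiskeringLeft _ _ _).obj (splitFirst j) ≅
    (Functor.whiskeringLeft _ _ _).obj (truncInclusion j) :=
  NatIso.ofComponents
    (fun Y => NatIso.ofComponents (fun e => Y.mapIso (consIso ((truncInclusion j).obj e)))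
      (fun {e e'} f => by
        have := congr_arg (fun t => Y.map t) (consIso_naturality ((truncInclusion j).map f))
        simp only [Y.map_comp] at this
        exact this))
    (fun {Y Z} f => by
      ext e : 2
      exact (f.naturality _).symm)

def emptyIndexInitial (j : Fin 0 → ℕ) :
    IsInitial (C := TruncIndex j) (fun i => i.elim0) :=
  IsInitial.ofUniqueHom (fun _ i => i.elim0) (fun _ _ => funext fun i => i.elim0)

/-- The iterated homotopy limit as a single mapping space. -/
def iteratedHolimIso : ∀ (n : ℕ) (j : Fin n → ℕ), iteratedHolim.{u} n j ≅
    (Functor.whiskeringLeft _ _ _).obj (truncInclusion j) ⋙ mapSp (iteratedNerve n j) := fun n j =>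
  match n, j with
  | 0, j => (evaluation (Fin 0 → SimplexCategory) SSet.{u}).mapIso
      { hom i := i.elim0
        inv i := i.elim0
        hom_inv_id := funext fun i => i.elim0
        inv_hom_id := funext fun i => i.elim0 } ≪≫
      Functor.isoWhiskerLeft ((Functor.whiskeringLeft _ _ _).obj (truncInclusion j))
        (mapSpUnitIso (emptyIndexInitial j)).symm
  | n + 1, j =>
      Functor.isoWhiskerLeft (slice n) (Functor.isoWhiskerRight
        ((Functor.whiskeringRight SimplexCategory _ _).mapIso
          (iteratedHolimIso n fun i => j i.succ)) (holimTrunc (j 0))) ≪≫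
      Functor.isoWhiskerLeft (slice.{u} n ⋙ (Functor.whiskeringRight SimplexCategory _ _).obj
        ((Functor.whiskeringLeft _ _ _).obj (truncInclusion fun i => j i.succ)) ⋙
        (Functor.whiskeringLeft _ _ _).obj (SimplexCategory.Truncated.inclusion (j 0)))
        ((fubiniIso (overNerve _) (iteratedNerve n fun i => j i.succ)).symm ≪≫
          Functor.isoWhiskerLeft _ (mapSpWhiskerIso (splitFirst j) _)) ≪≫
      Functor.isoWhiskerRight (restrictionIso j) (mapSp (iteratedNerve (n + 1) j))

lemma isTrivialFibration_map_iff_of_iso {𝒞 : Type*} [Category* 𝒞] {F G : 𝒞 ⥤ SSet.{u}} (α : F ≅ G)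
    {X Y : 𝒞} (q : X ⟶ Y) : IsTrivialFibration (F.map q) ↔ IsTrivialFibration (G.map q) :=
  modelCategoryQuillen.I.{u}.rlp.arrow_mk_iso_iff
    (Arrow.isoMk (α.app X) (α.app Y) (α.hom.naturality q).symm)

/-- The recursion for mapping spaces out of iterated nerves. -/
def mapSpIteratedNerveIso (j : Fin (n + 1) → ℕ) :
    mapSp (iteratedNerve.{u} (n + 1) j) ≅
      ((Functor.whiskeringLeft _ _ _).obj (splitFirst j).inv ⋙
        CategoryTheory.Functor.curry ⋙
        (Functor.whiskeringRight _ _ _).obj (mapSp (iteratedNerve n fun i => j i.succ))) ⋙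
        holim (SimplexCategory.Truncated (j 0)) :=
  let L := (Functor.whiskeringLeft _ _ SSet.{u}).obj (splitFirst j).inv
  let A := iteratedNerve.{u} n fun i => j i.succ
  (Iso.refl _ : mapSp (iteratedNerve.{u} (n + 1) j) ≅
      (Functor.whiskeringLeft _ _ _).obj (𝟭 _) ⋙ mapSp (iteratedNerve (n + 1) j)) ≪≫
    Functor.isoWhiskerRight ((Functor.whiskeringLeft _ _ SSet.{u}).mapIso
      (splitFirst j).asEquivalence.unitIso) (mapSp (iteratedNerve (n + 1) j)) ≪≫
    Functor.isoWhiskerLeft L ((mapSpWhiskerIso (splitFirst j) (extProd (overNerve _) A)).symm ≪≫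
      (Functor.leftUnitor _).symm ≪≫
      Functor.isoWhiskerRight (CategoryTheory.Functor.currying
        (C := SimplexCategory.Truncated (j 0))
        (D := TruncIndex fun i => j i.succ) (E := SSet.{u})).counitIso.symm
        (mapSp (extProd (overNerve _) A)) ≪≫
      Functor.isoWhiskerLeft CategoryTheory.Functor.curry (fubiniIso (overNerve _) A))

/-- The mapping space is an iterated homotopy limit, and each step preserves objectwise trivial
fibrations. -/
theorem isTrivialFibration_mapSp_iteratedNerve (j : Fin n → ℕ) {X Y : TruncIndex j ⥤ SSet.{u}}
    (q : X ⟶ Y) (hq : ∀ d, IsTrivialFibration (q.app d)) :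
    IsTrivialFibration ((mapSp (iteratedNerve n j)).map q) := by
  induction n with
  | zero => exact (isTrivialFibration_map_iff_of_iso (mapSpUnitIso (emptyIndexInitial j)) q).2 (hq _)
  | succ n ih =>
    rw [isTrivialFibration_map_iff_of_iso (mapSpIteratedNerveIso j)]
    exact isTrivialFibration_holim_map _ fun c => ih _ _ fun d => hq _

end Iterated

end

section



/-! ### Coskeleta -/

section Coskeleta

section Local

variable {𝓔 : Type} [SmallCategory 𝓔]

/-- A diagram is local with respect to a class of objects if it is the right Kan extension of its
restriction to these objects. -/
def IsLocal (P : ObjectProperty 𝓔) (Z : 𝓔 ⥤ SSet.{u}) : Prop :=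
  ∀ ⦃L : SSet.{u}⦄ ⦃e : 𝓔⦄ (x : ∀ ⦃m : 𝓔⦄, (e ⟶ m) → P m → (L ⟶ Z.obj m)),
    (∀ ⦃m m' : 𝓔⦄ (f : e ⟶ m) (g : m ⟶ m') (hm : P m) (hm' : P m'),
      x (f ≫ g) hm' = x f hm ≫ Z.map g) →
    ∃! z : L ⟶ Z.obj e, ∀ ⦃m : 𝓔⦄ (f : e ⟶ m) (hm : P m), z ≫ Z.map f = x f hm

variable {P Q : ObjectProperty 𝓔} {Y Z : 𝓔 ⥤ SSet.{u}}

lemma isLocal_of_forall (hP : ∀ m, P m) : IsLocal P Z := fun L e x hx =>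
  ⟨x (𝟙 e) (hP e), fun m f hm => by rw [← hx (𝟙 e) f (hP e) hm, Category.id_comp],
    fun z hz => by rw [← hz, Z.map_id, Category.comp_id]⟩

/-- By the pointwise formula the value at `e` is a limit over the arrows from `e` to objects of `P`.
The counit, invertible since the inclusion is fully faithful, identifies the terms of this limit
with values of the extension. -/
lemma isLocal_ran (F : P.FullSubcategory ⥤ SSet.{u}) : IsLocal P (P.ι.ran.obj F) := by
  intro L e x hx
  let κ (m : P.FullSubcategory) : (P.ι.ran.obj F).obj m.obj ⟶ F.obj m :=
    (P.ι.ranCounit.app F).app m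
  have hκ : ∀ m, IsIso (κ m) := fun m => inferInstanceAs (IsIso ((P.ι.ranCounit.app F).app m))
  have hκ' : ∀ {m m' : P.FullSubcategory} (g : m ⟶ m'),
      (P.ι.ran.obj F).map g.hom ≫ κ m' = κ m ≫ F.map g :=
    fun g => (P.ι.ranCounit.app F).naturality g
  let y (f : StructuredArrow e P.ι) : L ⟶ F.obj f.right :=
    x f.hom f.right.property ≫ κ f.right
  have hy : ∀ {f f' : StructuredArrow e P.ι} (g : f ⟶ f'), y f' = y f ≫ F.map g.right :=
    fun {f f'} g => by
      have h := hx f.hom g.right.hom f.right.property f'.right.property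
      have hg : f.hom ≫ g.right.hom = f'.hom := StructuredArrow.w g
      rw [hg] at h
      simp only [y, h, Category.assoc, hκ']
  let c : Cone (StructuredArrow.proj e P.ι ⋙ F) :=
    { pt := L
      π :=
        { app f := y f
          naturality f f' g := (Category.id_comp _).trans (hy g) } }
  let w (f : StructuredArrow e P.ι) : limit (StructuredArrow.proj e P.ι ⋙ F) ⟶ F.obj f.right :=
    limit.π (StructuredArrow.proj e P.ι ⋙ F) f
  have hw : ∀ f, (P.ι.ranObjObjIsoLimit F e).hom ≫ w f = (P.ι.ran.obj F).map f.hom ≫ κ f.right :=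
    fun f => P.ι.ranObjObjIsoLimit_hom_π F e f
  have hz : ∀ (z : L ⟶ (P.ι.ran.obj F).obj e) (f : StructuredArrow e P.ι),
      z ≫ (P.ι.ran.obj F).map f.hom = x f.hom f.right.property ↔
        (z ≫ (P.ι.ranObjObjIsoLimit F e).hom) ≫ w f = y f := fun z f => by
    rw [Category.assoc, hw, ← Category.assoc]
    exact (cancel_mono (κ f.right)).symm
  refine ⟨limit.lift _ c ≫ (P.ι.ranObjObjIsoLimit F e).inv, fun m f hm => ?_, fun z hz' => ?_⟩
  · refine (hz _ (StructuredArrow.mk (Y := (⟨m, hm⟩ : P.FullSubcategory)) f)).2 ?_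
    rw [(Iso.eq_comp_inv _).1 rfl]
    exact limit.lift_π c _
  · rw [Iso.eq_comp_inv]
    exact limit.hom_ext fun f => ((hz z f).1 (hz' f.hom f.right.property)).trans
      (limit.lift_π c f).symm

lemma isIso_ranUnit_app {m : 𝓔} (hm : P m) :
    IsIso (((P.ι.ranAdjunction SSet.{u}).unit.app Y).app m) := by
  have h := P.ι.ranCounit_app_app_ranAdjunction_unit_app_app Y (⟨m, hm⟩ : P.FullSubcategory)
  have : IsIso (((P.ι.ranAdjunction SSet.{u}).unit.app Y).app m ≫
      (P.ι.ranCounit.app (P.ι ⋙ Y)).app ⟨m, hm⟩) := by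
    refine (congr_arg IsIso h).mpr ?_
    exact inferInstanceAs (IsIso (𝟙 (Y.obj m)))
  exact IsIso.of_isIso_comp_right _ ((P.ι.ranCounit.app (P.ι ⋙ Y)).app ⟨m, hm⟩)

end Local

section Mix

/-- The first object if `β` holds, and the second one otherwise. -/
def mixObj (β : Bool) (x y : SimplexCategory) : SimplexCategory :=
  match β with
  | true => x
  | false => y

def mixMap (β : Bool) {x x' y y' : SimplexCategory} (f : x ⟶ x') (g : y ⟶ y') :
    mixObj β x y ⟶ mixObj β x' y' :=
  match β with
  | true => f
  | false => g

def mixIn (β : Bool) {x y : SimplexCategory} (h : x ⟶ y) : x ⟶ mixObj β x y :=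
  match β with
  | true => 𝟙 x
  | false => h

def mixOut (β : Bool) {x y : SimplexCategory} (h : x ⟶ y) : mixObj β x y ⟶ y :=
  match β with
  | true => h
  | false => 𝟙 y

lemma mixIn_mixOut (β : Bool) {x y : SimplexCategory} (h : x ⟶ y) :
    mixIn β h ≫ mixOut β h = h := by
  cases β
  · exact Category.comp_id h
  · exact Category.id_comp h

lemma mixIn_mixMap (β : Bool) {x x' y y' : SimplexCategory} {f : x ⟶ x'} {g : y ⟶ y'} {h : x ⟶ y}
    {h' : x' ⟶ y'} (w : f ≫ h' = h ≫ g) : mixIn β h ≫ mixMap β f g = f ≫ mixIn β h' := by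
  cases β
  · exact w.symm
  · exact (Category.id_comp f).trans (Category.comp_id f).symm

lemma mixMap_mixOut (β : Bool) {x x' y y' : SimplexCategory} {f : x ⟶ x'} {g : y ⟶ y'} {h : x ⟶ y}
    {h' : x' ⟶ y'} (w : f ≫ h' = h ≫ g) : mixMap β f g ≫ mixOut β h' = mixOut β h ≫ g := by
  cases β
  · exact (Category.comp_id g).trans (Category.id_comp g).symm
  · exact w

variable {n : ℕ} (i : Fin n) {m m' k k' : Fin n → SimplexCategory}

/-- The multi-index with `i`-th coordinate from `m` and the other ones from `k`. -/
def updateAt (m k : Fin n → SimplexCategory) : Fin n → SimplexCategory :=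
  fun a => mixObj (decide (a = i)) (m a) (k a)

def updateAtMap (f : m ⟶ m') (g : k ⟶ k') : updateAt i m k ⟶ updateAt i m' k' :=
  fun a => mixMap (decide (a = i)) (f a) (g a)

def toUpdateAt (h : m ⟶ k) : m ⟶ updateAt i m k := fun a => mixIn (decide (a = i)) (h a)

def fromUpdateAt (h : m ⟶ k) : updateAt i m k ⟶ k := fun a => mixOut (decide (a = i)) (h a)

lemma toUpdateAt_fromUpdateAt (h : m ⟶ k) : toUpdateAt i h ≫ fromUpdateAt i h = h :=
  funext fun a => mixIn_mixOut _ (h a)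

lemma toUpdateAt_map {f : m ⟶ m'} {g : k ⟶ k'} {h : m ⟶ k} {h' : m' ⟶ k'} (w : f ≫ h' = h ≫ g) :
    toUpdateAt i h ≫ updateAtMap i f g = f ≫ toUpdateAt i h' :=
  funext fun a => mixIn_mixMap _ (congr_fun w a)

lemma map_fromUpdateAt {f : m ⟶ m'} {g : k ⟶ k'} {h : m ⟶ k} {h' : m' ⟶ k'}
    (w : f ≫ h' = h ≫ g) : updateAtMap i f g ≫ fromUpdateAt i h' = fromUpdateAt i h ≫ g :=
  funext fun a => mixMap_mixOut _ (congr_fun w a)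

lemma updateAt_self : updateAt i m k i = m i := by simp [updateAt, mixObj]

lemma updateAt_of_ne {a : Fin n} (h : a ≠ i) : updateAt i m k a = k a := by
  simp [updateAt, mixObj, h]

end Mix

section

variable {n : ℕ}

/-- Successive Kan extensions amount to one along the intersection. Given components on `R`, they
are first extended to all of `P` using the locality of `Y` and the isomorphisms `t`, then to `e`
using the locality of `Z`. An arrow from `m` in `P` to `k` in `Q` passes through the index with
`i`-th coordinate from `m` and the others from `k`, which lies in `R`; this is why truncations in
different directions do not interfere. -/
lemma IsLocal.inf {i : Fin n} {P Q R : ObjectProperty (Fin n → SimplexCategory)}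
    (hR : ∀ m, R m ↔ P m ∧ Q m) (hPQ : ∀ m k, P m → Q k → R (updateAt i m k))
    {Y Z : CosimplicialSpace.{u} n} (t : Y ⟶ Z)
    (ht : ∀ m, P m → IsIso (t.app m)) (hY : IsLocal Q Y) (hZ : IsLocal P Z) : IsLocal R Z := by
  intro L e x hx
  have htR : ∀ m, R m → IsIso (t.app m) := fun m hm => ht m ((hR m).1 hm).1
  -- The component of `y` along `h` is the given component at the mixed index, transported to `Y` by
  -- the inverse of `t` and pushed forward to `k`.
  have key : ∀ ⦃m⦄ (g : e ⟶ m) (hm : P m), ∃! y : L ⟶ Y.obj m, ∀ ⦃k⦄ (h : m ⟶ k) (hk : Q k),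
      y ≫ Y.map h = (have := htR _ (hPQ m k hm hk);
        x (g ≫ toUpdateAt i h) (hPQ m k hm hk) ≫ inv (t.app _) ≫ Y.map (fromUpdateAt i h)) := by
    intro m g hm
    refine hY _ fun k k' h f hk hk' => ?_
    have := htR _ (hPQ m k hm hk)
    have := htR _ (hPQ m k' hm hk')
    have w : 𝟙 m ≫ h ≫ f = h ≫ f := Category.id_comp _
    have h1 := toUpdateAt_map i w
    have h2 := map_fromUpdateAt i w
    rw [Category.id_comp] at h1
    have h3 := hx (g ≫ toUpdateAt i h) (updateAtMap i (𝟙 m) f) (hPQ m k hm hk) (hPQ m k' hm hk')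
    simp only [Category.assoc, h1] at h3
    rw [h3, Category.assoc, Category.assoc, Category.assoc, ← Y.map_comp, ← h2, Y.map_comp]
    congr 1
    rw [← Category.assoc, ← Category.assoc]
    congr 1
    rw [IsIso.comp_inv_eq, Category.assoc, t.naturality, IsIso.inv_hom_id_assoc]
  choose y hy hy' using key
  obtain ⟨z, hz, -⟩ := hZ (fun m g hm => y g hm ≫ t.app m) (fun m m' g f hm hm' => by
    rw [Category.assoc, ← t.naturality, ← Category.assoc]
    congr 1
    refine (hy' _ _ _ fun k h hk => ?_).symm
    have := htR _ (hPQ m k hm hk)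
    have := htR _ (hPQ m' k hm' hk)
    rw [Category.assoc, ← Y.map_comp, hy g hm (f ≫ h) hk]
    have w : f ≫ h = (f ≫ h) ≫ 𝟙 k := (Category.comp_id _).symm
    have h1 := toUpdateAt_map i w
    have h2 := map_fromUpdateAt i w
    rw [Category.comp_id] at h2
    have h3 := hx (g ≫ toUpdateAt i (f ≫ h)) (updateAtMap i f (𝟙 k)) (hPQ m k hm hk)
      (hPQ m' k hm' hk)
    simp only [Category.assoc, h1] at h3
    rw [← h2, Y.map_comp]
    simp only [Category.assoc, h3]
    congr 1
    rw [← Category.assoc, ← Category.assoc]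
    congr 1
    rw [IsIso.eq_comp_inv, Category.assoc, t.naturality, IsIso.inv_hom_id_assoc])
  have hzR : ∀ ⦃m⦄ (g : e ⟶ m) (hm : R m), z ≫ Z.map g = x g hm := fun m g hm => by
    obtain ⟨hP, hQ⟩ := (hR m).1 hm
    have := htR _ (hPQ m m hP hQ)
    rw [hz g hP, ← Category.comp_id (y g hP), ← Y.map_id, hy g hP (𝟙 m) hQ]
    simp only [Category.assoc]
    rw [t.naturality, IsIso.inv_hom_id_assoc, ← hx _ _ _ hm, Category.assoc,
      toUpdateAt_fromUpdateAt, Category.comp_id]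
  refine ⟨z, hzR, fun z' hz' => ?_⟩
  -- Uniqueness is tested on `P` by locality of `Z`, and then, after transport to `Y`, on `Q`, where
  -- only components at mixed indices matter.
  · refine (hZ (fun m g _ => z ≫ Z.map g) (fun m m' g f _ _ => by
      rw [Z.map_comp, Category.assoc])).unique (fun m g hm => ?_) (fun _ _ _ => rfl)
    have := ht m hm
    rw [← cancel_mono (inv (t.app m))]
    refine (hY (fun k h _ => (z ≫ Z.map g) ≫ inv (t.app m) ≫ Y.map h) (fun k k' h f _ _ => by
      simp only [Y.map_comp, Category.assoc])).unique (fun k h hk => ?_)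
      (fun k h hk => by simp only [Category.assoc])
    have hu := hPQ m k hm hk
    have := htR _ hu
    have h1 : ∀ v : L ⟶ Z.obj e, (v ≫ Z.map g) ≫ inv (t.app m) ≫ Y.map h =
        (v ≫ Z.map (g ≫ toUpdateAt i h)) ≫ inv (t.app _) ≫ Y.map (fromUpdateAt i h) := fun v => by
      have h2 : inv (t.app m) ≫ Y.map (toUpdateAt i h) =
          Z.map (toUpdateAt i h) ≫ inv (t.app _) := by
        rw [IsIso.inv_comp_eq, ← Category.assoc, IsIso.eq_comp_inv, t.naturality]
      conv_lhs => rw [← toUpdateAt_fromUpdateAt i h]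
      rw [Y.map_comp, reassoc_of% h2, Z.map_comp]
      simp only [Category.assoc]
    have h3 : z ≫ Z.map (g ≫ toUpdateAt i h) = z' ≫ Z.map (g ≫ toUpdateAt i h) := by
      rw [hz' _ hu, hzR _ hu]
    rw [Category.assoc, h1, h1, h3]

end

end Coskeleta

end

/-! ### The multi-coskeleton as a single Kan extension -/

section



section CoskeletonIso

variable {n : ℕ} {j : Fin n → ℕ}

/-- Stated for a list of directions so that the directions can be added one at a time: the unit of
each further coskeleton is invertible on its truncation, and `IsLocal.inf` combines the new locality
with the previous one. -/
lemma exists_coskeleton_unit (j : Fin n → ℕ) (Y : CosimplicialSpace.{u} n) (l : List (Fin n)) :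
    ∃ t : Y ⟶ l.foldr (fun i Z => coskIn i (j i) Z) Y,
      (∀ m, (∀ i ∈ l, (m i).len ≤ j i) → IsIso (t.app m)) ∧
      IsLocal (fun m => ∀ i ∈ l, (m i).len ≤ j i) (l.foldr (fun i Z => coskIn i (j i) Z) Y) := by
  induction l with
  | nil => exact ⟨𝟙 Y, fun m _ => inferInstanceAs (IsIso (𝟙 (Y.obj m))),
      isLocal_of_forall fun m i hi => absurd hi List.not_mem_nil⟩
  | cons i l ih =>
    obtain ⟨t, ht, hl⟩ := ih
    let W := l.foldr (fun i Z => coskIn i (j i) Z) Y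
    let s : W ⟶ coskIn i (j i) W := ((truncIn i (j i)).ι.ranAdjunction SSet.{u}).unit.app W
    have hs : ∀ m, truncIn i (j i) m → IsIso (s.app m) := fun m hm => isIso_ranUnit_app hm
    refine ⟨t ≫ s, fun m hm => ?_, ?_⟩
    · have := ht m fun k hk => hm k (List.mem_cons_of_mem _ hk)
      have := hs m (hm i List.mem_cons_self)
      exact inferInstanceAs (IsIso (t.app m ≫ s.app m))
    · refine IsLocal.inf (i := i) (P := truncIn i (j i)) (fun m => ?_) (fun m k hm hk a ha => ?_) s
        hs hl (isLocal_ran _)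
      · exact List.forall_mem_cons
      · by_cases h : a = i
        · subst h
          rw [updateAt_self]
          exact hm
        · rw [updateAt_of_ne i h]
          exact hk a ((List.mem_cons.1 ha).resolve_left h)

/-- The multi-indices with coordinates bounded by those of `j`. -/
def truncAll (j : Fin n → ℕ) : ObjectProperty (Fin n → SimplexCategory) :=
  fun m => ∀ i, (m i).len ≤ j i

section Projections

variable {Y : CosimplicialSpace.{u} n} {e e' m m' : Fin n → SimplexCategory} {L : SSet.{u}}

/-- The components of the extension of the restriction of a diagram. -/
def extendProj (f : e ⟶ m) (hm : truncAll j m) :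
    (extend (truncInclusion j) (truncInclusion j ⋙ Y)).obj e ⟶ Y.obj m :=
  familiesApp (homsTo (truncInclusion j) e) (truncInclusion j ⋙ Y) (e := fun i => ⟨m i, hm i⟩) f

lemma extendProj_map (f : e ⟶ m) (g : m ⟶ m') (hm : truncAll j m) (hm' : truncAll j m') :
    extendProj f hm ≫ Y.map g = extendProj (f ≫ g) hm' :=
  familiesApp_map (F := homsTo (truncInclusion j) e) (X := truncInclusion j ⋙ Y)
    (truncIndexHom (d := fun i => ⟨m i, hm i⟩) (d' := fun i => ⟨m' i, hm' i⟩) g) f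

lemma map_extendProj (g : e' ⟶ e) (f : e ⟶ m) (hm : truncAll j m) :
    (extend (truncInclusion j) (truncInclusion j ⋙ Y)).map g ≫ extendProj f hm =
      extendProj (g ≫ f) hm := rfl

lemma extendProj_hom_ext {z z' : L ⟶ (extend (truncInclusion j) (truncInclusion j ⋙ Y)).obj e}
    (h : ∀ ⦃m⦄ (f : e ⟶ m) (hm : truncAll j m), z ≫ extendProj f hm = z' ≫ extendProj f hm) :
    z = z' :=
  families_hom_ext fun d f => h f fun i => (d i).property

def extendLift (y : ∀ ⦃m⦄ (_ : e ⟶ m), truncAll j m → (L ⟶ Y.obj m))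
    (hy : ∀ ⦃m m'⦄ (f : e ⟶ m) (g : m ⟶ m') (hm : truncAll j m) (hm' : truncAll j m'),
      y (f ≫ g) hm' = y f hm ≫ Y.map g) :
    L ⟶ (extend (truncInclusion j) (truncInclusion j ⋙ Y)).obj e :=
  familiesLift (F := homsTo (truncInclusion j) e) (X := truncInclusion j ⋙ Y)
    (fun d f => y (m := (truncInclusion j).obj d) f fun i => (d i).property)
    (fun _ _ g f => hy f ((truncInclusion j).map g) _ _)

lemma extendLift_proj (y : ∀ ⦃m⦄ (_ : e ⟶ m), truncAll j m → (L ⟶ Y.obj m))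
    (hy : ∀ ⦃m m'⦄ (f : e ⟶ m) (g : m ⟶ m') (hm : truncAll j m) (hm' : truncAll j m'),
      y (f ≫ g) hm' = y f hm ≫ Y.map g) (f : e ⟶ m) (hm : truncAll j m) :
    extendLift y hy ≫ extendProj f hm = y f hm := rfl

end Projections

/-- A diagram which is local with respect to the truncated multi-indices is extended from its
restriction to these. -/
theorem nonempty_iso_extend {Y W : CosimplicialSpace.{u} n} (t : Y ⟶ W)
    (ht : ∀ m, truncAll j m → IsIso (t.app m)) (hW : IsLocal (truncAll j) W) :
    Nonempty (W ≅ extend (truncInclusion j) (truncInclusion j ⋙ Y)) := by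
  let r (e : Fin n → SimplexCategory) :
      W.obj e ⟶ (extend (truncInclusion j) (truncInclusion j ⋙ Y)).obj e :=
    extendLift (fun m f hm => have := ht m hm; W.map f ≫ inv (t.app m))
      (fun m m' f g hm hm' => by
        have := ht m hm
        have := ht m' hm'
        rw [IsIso.comp_inv_eq, Category.assoc, Category.assoc, t.naturality,
          IsIso.inv_hom_id_assoc, W.map_comp])
  have hr' : ∀ {e m : Fin n → SimplexCategory} (f : e ⟶ m) (hm : truncAll j m),
      r e ≫ extendProj f hm ≫ t.app m = W.map f := fun {e m} f hm => by
    have := ht m hm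
    rw [← Category.assoc, extendLift_proj, Category.assoc, IsIso.inv_hom_id, Category.comp_id]
  have hr : ∀ {e : Fin n → SimplexCategory} {L : SSet.{u}} (z : L ⟶ W.obj e)
      (y : L ⟶ (extend (truncInclusion j) (truncInclusion j ⋙ Y)).obj e),
      z ≫ r e = y ↔ ∀ ⦃m⦄ (f : e ⟶ m) (hm : truncAll j m),
        z ≫ W.map f = y ≫ extendProj f hm ≫ t.app m := fun {e L} z y => by
    constructor
    · rintro rfl m f hm
      rw [Category.assoc, hr']
    · intro h
      refine extendProj_hom_ext fun m f hm => ?_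
      have := ht m hm
      rw [← cancel_mono (t.app m), Category.assoc, Category.assoc, Category.assoc, hr', h]
  -- Through `t`, having image `y` under `r e` means having prescribed components on truncated
  -- indices, so locality of `W` gives a unique preimage.
  have hext : ∀ {e : Fin n → SimplexCategory} {L : SSet.{u}}
      (y : L ⟶ (extend (truncInclusion j) (truncInclusion j ⋙ Y)).obj e),
      ∃! z : L ⟶ W.obj e, z ≫ r e = y := fun {e L} y => by
    simp only [hr]
    exact hW (fun m f hm => y ≫ extendProj f hm ≫ t.app m) (fun m m' f g hm hm' => by
      rw [← extendProj_map f g hm hm']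
      simp only [Category.assoc, t.naturality])
  have hiso : ∀ e, IsIso (r e) := fun e => by
    obtain ⟨z, hz, -⟩ := hext (𝟙 ((extend (truncInclusion j) (truncInclusion j ⋙ Y)).obj e))
    refine ⟨z, (hext (r e)).unique ?_ (Category.id_comp _), hz⟩
    rw [Category.assoc, hz, Category.comp_id]
  refine ⟨NatIso.ofComponents (fun e => asIso (r e)) fun {e e'} g => ?_⟩
  refine (hr (W.map g) _).2 fun m f hm => ?_
  have h : (extend (truncInclusion j) (truncInclusion j ⋙ Y)).map g ≫ extendProj f hm ≫ t.app m =
      extendProj (g ≫ f) hm ≫ t.app m := by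
    rw [← map_extendProj, Category.assoc]
  rw [asIso_hom, Category.assoc, h, hr', W.map_comp]

theorem nonempty_coskeletonIso (j : Fin n → ℕ) (Y : CosimplicialSpace.{u} n) :
    Nonempty (cosk j Y ≅ extend (truncInclusion j) (truncInclusion j ⋙ Y)) := by
  obtain ⟨t, ht, hW⟩ := exists_coskeleton_unit j Y (List.finRange n)
  have h : (fun m : Fin n → SimplexCategory => ∀ i ∈ List.finRange n, (m i).len ≤ j i) =
      truncAll j := by
    funext m
    simp [truncAll]
  rw [h] at hW
  exact nonempty_iso_extend t (fun m hm => ht m fun i _ => hm i) hW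

end CoskeletonIso

end

/-! ### Comparison of the two homotopy limits -/

section



section Comparison

variable {C D : Type} [SmallCategory C] [SmallCategory D]

lemma IsTrivialFibration.weaklyEquivalent {X Y : SSet.{u}} {p : X ⟶ Y}
    (hp : IsTrivialFibration p) : WeaklyEquivalent X Y :=
  .rel _ _ ⟨p, hp.isWeakEquiv⟩

lemma weaklyEquivalent_of_iso {X Y : SSet.{u}} (e : X ≅ Y) : WeaklyEquivalent X Y :=
  .rel _ _ ⟨e.hom, .of_isIso _⟩

/-- The first projection and the end point map of the mapping path object of `f` form a span of
objectwise trivial fibrations from `X` to `Y`. -/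
theorem weaklyEquivalent_mapSp {A X Y : D ⥤ SSet.{u}}
    (hA : ∀ {P Q : D ⥤ SSet.{u}} (q : P ⟶ Q), (∀ d, IsTrivialFibration (q.app d)) →
      IsTrivialFibration ((mapSp A).map q)) (f : X ⟶ Y)
    (hf : ∀ d, IsWeakEquiv (f.app d)) (hX : ∀ d, KanComplex (X.obj d))
    (hY : ∀ d, KanComplex (Y.obj d)) :
    WeaklyEquivalent ((mapSp A).obj X) ((mapSp A).obj Y) :=
  .trans _ _ _
    (.symm _ _ (hA (mappingPath.fst f) fun d =>
      mappingPath.isTrivialFibration_fst_app (hY d)).weaklyEquivalent)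
    (hA (mappingPath.endpoint f) fun d =>
      mappingPath.isTrivialFibration_endpoint_app (hY d) (hX d) (hf d)).weaklyEquivalent

/-- Right Kan extension preserves objectwise weak equivalences of Reedy fibrant diagrams. -/
theorem weaklyEquivalent_holim_extend {𝓔 : Type} [SmallCategory 𝓔] (G : C ⥤ 𝓔) (ι : D ⥤ 𝓔)
    {deg : D → ℕ} (hdeg : IsReedyDegree deg)
    (hι : ∀ e, IsGeneratedBelow deg ⊤ (homsTo ι e)) {X Y : D ⥤ SSet.{u}} (f : X ⟶ Y)
    (hf : ∀ d, IsWeakEquiv (f.app d))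
    (hX : ∀ d, IsKanFibration (relMatch (terminal.from X) d NotSplitMono))
    (hY : ∀ d, IsKanFibration (relMatch (terminal.from Y) d NotSplitMono)) :
    WeaklyEquivalent ((holim C).obj (G ⋙ extend ι X)) ((holim C).obj (G ⋙ extend ι Y)) := by
  have key : ∀ {Z : D ⥤ SSet.{u}} (q : mappingPath f ⟶ Z),
      (∀ d, IsTrivialFibration (relMatch q d NotSplitMono)) →
      WeaklyEquivalent ((holim C).obj (G ⋙ extend ι (mappingPath f)))
        ((holim C).obj (G ⋙ extend ι Z)) := fun q hq =>
    (isTrivialFibration_holim_map (Functor.whiskerLeft G (extendMap ι q)) fun c =>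
      isTrivialFibration_familiesMap hdeg (hι _) fun d _ => hq d).weaklyEquivalent
  refine .trans _ _ _ (.symm _ _ (key (mappingPath.fst f) fun d =>
    mappingPath.isTrivialFibration_relMatch_fst (hY d))) (key (mappingPath.endpoint f) ?_)
  -- Objectwise triviality would not pass through the Kan extension; the end point map is also a
  -- Reedy fibration, hence a Reedy trivial fibration.
  exact isTrivialFibration_relMatch hdeg
    (fun d => mappingPath.isKanFibration_relMatch_endpoint (hY d) (hX d))
    (fun d => mappingPath.isTrivialFibration_endpoint_app
      (kanComplex_of_isKanFibration_relMatch hdeg hY d)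
      (kanComplex_of_isKanFibration_relMatch hdeg hX d) (hf d))

/-- The iterated homotopy limit is the homotopy limit of the diagonal of the coskeleton. -/
theorem weaklyEquivalent_iteratedHolim {n : ℕ} {j : Fin n → ℕ}
    {Y Y' Y'' : CosimplicialSpace.{u} n}
    (f : Y ⟶ Y') (hf : IsLevelwiseWeakEquiv f)
    (hY' : IsLevelwiseFibrant Y')
    (g : Y ⟶ Y'') (hg : IsLevelwiseWeakEquiv g)
    (hY'' : IsReedyFibrant Y'') :
    WeaklyEquivalent
      ((iteratedHolim n j).obj Y')
      ((holimTrunc (∑ i, j i)).obj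
        (diag (cosk j Y''))) := by
  have hT : ∀ d, IsTerminal ((⊤_ (TruncIndex j ⥤ SSet.{u})).obj d) := fun d =>
    IsTerminal.isTerminalObj ((evaluation _ SSet.{u}).obj d) _ terminalIsTerminal
  -- `M` receives the restrictions of `Y'` and `Y''` and has equivalent mapping spaces from the two
  -- contractible diagrams that represent the two sides.
  obtain ⟨M, t₁, t₂, ht₁, ht₂, hM, h⟩ := exists_common_replacement
    (V := iteratedNerve n j)
    (W := commaNerve (truncDiag n (∑ i, j i)) (truncInclusion j))
    (Functor.whiskerLeft (truncInclusion j) f) (Functor.whiskerLeft (truncInclusion j) g)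
    (fun d => hf _) (fun d => hg _) (fun d => isWeakEquiv_iteratedNerve j d (hT d) _)
    (fun d => isWeakEquiv_commaNerve _ _ d
      (isWeakEquiv_nerve_truncDiag (totalDegree_le d)) (hT d) _)
  have h₁ := weaklyEquivalent_mapSp (isTrivialFibration_mapSp_iteratedNerve j) t₁ ht₁
    (fun d => hY' _) (kanComplex_of_isKanFibration_relMatch isReedyDegree_totalDegree hM)
  have h₂ := weaklyEquivalent_holim_extend (truncDiag n (∑ i, j i)) (truncInclusion j)
    isReedyDegree_totalDegree isGeneratedBelow_homsTo t₂ ht₂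
    (isKanFibration_relMatch_of_isReedyFibrant hY'') hM
  obtain ⟨α⟩ := nonempty_coskeletonIso j Y''
  have h₃ := weaklyEquivalent_of_iso ((iteratedHolimIso n j).app Y')
  have h₄ := weaklyEquivalent_of_iso (mapSpCommaIso (truncDiag n (∑ i, j i)) (truncInclusion j) M)
  have h₅ := weaklyEquivalent_of_iso ((holim _).mapIso
    (Functor.isoWhiskerLeft (truncDiag n (∑ i, j i)) α))
  -- Fubini, replacement of `Y'` by `M`, exchange of the contractible sources, adjunction,
  -- replacement of `M` by `Y''` under the Kan extension, and identification with the coskeleton.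
  exact h₃.trans _ _ _ (h₁.trans _ _ _ (h.trans _ _ _ (h₄.trans _ _ _
    ((h₂.symm _ _).trans _ _ _ (h₅.symm _ _)))))

end Comparison

end

end MultiCosimplicial
end

theorem proposition3p2 (n : ℕ) (j : Fin n → ℕ)
    (Y Y' Y'' : MultiCosimplicial.CosimplicialSpace.{u} n)
    (f : Y ⟶ Y') (hf : MultiCosimplicial.IsLevelwiseWeakEquiv f)
    (hY' : MultiCosimplicial.IsLevelwiseFibrant Y')
    (g : Y ⟶ Y'') (hg : MultiCosimplicial.IsLevelwiseWeakEquiv g)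
    (hY'' : MultiCosimplicial.IsReedyFibrant Y'') :
    MultiCosimplicial.WeaklyEquivalent
      ((MultiCosimplicial.iteratedHolim n j).obj Y')
      ((MultiCosimplicial.holimTrunc (∑ i, j i)).obj
        (MultiCosimplicial.diag (MultiCosimplicial.cosk j Y''))) :=
  MultiCosimplicial.weaklyEquivalent_iteratedHolim f hf hY' g hg hY''
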